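/- **Setting.** Let $\Omega'\subseteq\mathbb R^{n'}$ and $\Omega\subseteq\mathbb R^{n}$ be open, $m\in\mathbb R$, $0<\rho\le 1$, $0\le\delta<1$, and $s:=\min\{\rho,1-\delta\}>0$. For a locally convex space $E$ with seminorms $(p_i)_{i\in I}$ let $\mathcal M_E$ be the set of nets $(u_\varepsilon)_{\varepsilon\in(0,1]}$ in $E$ such that for all $i$ there is $N\in\mathbb N$ with $p_i(u_\varepsilon)=O(\varepsilon^{-N})$ as $\varepsilon\to0$, let $\mathcal N_E$ be the set of nets with $p_i(u_\varepsilon)=O(\varepsilon^{q})$ for all $i$ and all $q\in\mathbb N$, and put $\mathcal G_E:=\mathcal M_E/\mathcal N_E$, a module over the ring $\widetilde{\mathbb C}:=\mathcal G_{\mathbb C}$. Its sharp topology is determined by the ultra-pseudo-seminorms $e^{-\mathrm{val}_{p_i}}$, where $\mathrm{val}_{p_i}([(u_\varepsilon)_\varepsilon])=\sup\{b\in\mathbb R:\ p_i(u_\varepsilon)=O(\varepsilon^b)\}$. * $\mathcal G(\Omega'):=\mathcal G_{C^\infty(\Omega')}$, with the seminorms $p_{K,i}(f)=\sup_{x\in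 K,|\alpha|\le i}|\partial^\alpha f(x)|$, $K\subset\Omega'$ compact, $i\in\mathbb N$; $\mathcal G(\Omega)$ and $\mathcal G_{C^k(\Omega')}$ (with $i\le k$) are defined likewise. * $\mathcal G_c(\Omega)$ is the module of all $u\in\mathcal G(\Omega)$ with compact support. It carries the inductive limit topology, i.e. the finest locally convex $\widetilde{\mathbb C}$-linear topology for which the inclusions of all $\mathcal G_K(\Omega)=\{u:\operatorname{supp}u\subseteq K\}$, $K\subset\Omega$ compact, are continuous; $\mathcal G_K(\Omega)$ is topologized by the ultra-pseudo-seminorms $e^{-\mathrm{val}_{p_{L,i}}}$ with $i\in\mathbb N$ and $L\subset\Omega$ compact, $K\subseteq\operatorname{int}L$. (A topology on a $\widetilde{\mathbb C}$-module is locally convex $\widetilde{\mathbb C}$-linear if addition and scalar multiplication are continuous and $0$ has a base of neighbourhoods $V$ with $V+V\subseteq V$ and $[(\varepsilon^b)_\varepsilon]V\subseteq V$ for all $b\ge0$.) * $\widetilde{\mathcal S}^m_{\rho,\delta}(\Omega'\times\Omega\times\mathbb R^p):=\mathcal G_E$ for the Hörmander symbol space $E=S^m_{\rho,\delta}(\Omega'\times\Omega\times\mathbb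 R^p)$ with the seminorms $\sup\{|\partial_\xi^\alpha\partial_{x,y}^\beta a|\,\langle\xi\rangle^{-m+\rho|\alpha|-\delta|\beta|}:\ (x,y)\in K,\ \xi\in\mathbb R^p,\ |\alpha+\beta|\le i\}$, $K\subset\Omega'\times\Omega$ compact, $i\in\mathbb N$. * $\mathcal M_\Phi(\Omega';\Omega\times\mathbb R^p)$ is the set of nets $(\phi_\varepsilon)_\varepsilon$ of continuous real valued functions on $\Omega'\times\Omega\times\mathbb R^p$, smooth for $\xi\ne0$, positively homogeneous of degree $1$ in $\xi$, with $\nabla_{y,\xi}\phi_\varepsilon\neq0$ for $\xi\ne0$, that are moderate with respect to the seminorms $\sup\{|\xi|^{-1+|\alpha|}|\partial^\alpha_\xi\partial^\beta_{x,y}\phi|:\ (x,y)\in K,\ \xi\neq0,\ |\alpha+\beta|\le i\}$, and such that for all compact $K'\subset\Omega'$, $K\subset\Omega$ there are $r>0$ and $\eta\in(0,1]$ with $|\nabla_{y,\xi}\phi_\varepsilon(x,y,\xi/|\xi|)|^2\ge\varepsilon^r$ for all $x\in K'$, $y\in K$, $\xi\ne0$, $\varepsilon\le\eta$. Generalized phase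 functions, the elements of $\widetilde\Phi(\Omega';\Omega\times\mathbb R^p)$, are the classes of such nets modulo nets that are negligible for the same seminorms. * For $\chi\in C^\infty_c(\mathbb R^p)$ with $\chi=1$ for $|\xi|<1/4$ and $\chi=0$ for $|\xi|>1/2$ put $$L_{\phi}=\sum_{j=1}^p a_j\,\partial_{\xi_j}+\sum_{k=1}^n b_k\,\partial_{y_k}+c,\qquad a_j=i(1-\chi)\varphi_\phi\,\partial_{\xi_j}\phi,\quad b_k=i(1-\chi)|\xi|^{-2}\varphi_\phi\,\partial_{y_k}\phi,\quad c=\chi+\sum_j\partial_{\xi_j}a_j+\sum_k\partial_{y_k}b_k,$$ where $\varphi_\phi(x,y,\xi)=|\nabla_{y,\xi}\phi(x,y,\xi/|\xi|)|^{-2}$; thus ${}^tL_\phi e^{i\phi}=e^{i\phi}$. **Theorem.** Let $\phi\in\widetilde\Phi(\Omega';\Omega\times\mathbb R^p)$ and $a\in\widetilde{\mathcal S}^m_{\rho,\delta}(\Omega'\times\Omega\times\mathbb R^p)$. For every $u\in\mathcal G_c(\Omega)$ the generalized oscillatory integral $$I_\phi(a)(u)(x)=\int_{\Omega\times\mathbb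 R^p}e^{i\phi(x,y,\xi)}a(x,y,\xi)u(y)\,dy\,\frac{d\xi}{(2\pi)^p}$$ is a well-defined element of $\mathcal G(\Omega')$. That is, there is exactly one $w=I_\phi(a)(u)\in\mathcal G(\Omega')$ such that for all representatives $(\phi_\varepsilon)_\varepsilon$, $(a_\varepsilon)_\varepsilon$, $(u_\varepsilon)_\varepsilon$ of $\phi$, $a$, $u$, all $\chi$ as above, all compact $K\subset\Omega$ with $\operatorname{supp}u\subseteq\operatorname{int}K$, and all $k,h\in\mathbb N$ with $m-hs+1+k<-p$, the integrals $$\int_{K\times\mathbb R^p}e^{i\phi_\varepsilon(x,y,\xi)}L_{\phi_\varepsilon}^h\bigl(a_\varepsilon(x,y,\xi)u_\varepsilon(y)\bigr)\,dy\,\frac{d\xi}{(2\pi)^p}\qquad(x\in\Omega')$$ converge absolutely, form a net in $\mathcal M_{C^k(\Omega')}$, and this net represents the image of $w$ in $\mathcal G_{C^k(\Omega')}$. Moreover the map $A:\mathcal G_c(\Omega)\to\mathcal G(\Omega')$, $u\mapsto I_\phi(a)(u)$ (the generalized Fourier integral operator with phase $\phi$ and amplitude $a$), is $\widetilde{\mathbb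 C}$-linear and continuous. -/

import Mathlib

open Filter Topology Set MeasureTheory
open scoped ContDiff

noncomputable section

namespace Colombeau

/-! ## Nets in the parameter `ε ∈ (0,1]` -/

/-- The parameter set `(0,1]`. -/
abbrev Eps : Type := Set.Ioc (0 : ℝ) 1

/-- The filter `ε → 0` on `(0,1]`. -/
def epsZero : Filter Eps := comap (fun ε : Eps => (ε : ℝ)) (𝓝 0)

/-- `f ε = O(ε ^ b)` as `ε → 0`. -/
def IsOrder (f : Eps → ℝ) (b : ℝ) : Prop :=
  f =O[epsZero] fun ε : Eps => (ε : ℝ) ^ b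

/-- `∃ N ∈ ℕ, f ε = O(ε ^ (-N))`. -/
def IsModerate (f : Eps → ℝ) : Prop := ∃ N : ℕ, IsOrder f (-(N : ℝ))

/-- `∀ q ∈ ℕ, f ε = O(ε ^ q)`. -/
def IsNegligible (f : Eps → ℝ) : Prop := ∀ q : ℕ, IsOrder f (q : ℝ)

theorem IsOrder.mono {f g : Eps → ℝ} {b : ℝ} (hg : IsOrder g b) (h : ∀ ε, |f ε| ≤ |g ε|) :
    IsOrder f b :=
  (Asymptotics.IsBigO.of_bound 1 (Eventually.of_forall fun ε => by simpa using h ε)).trans hg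

theorem IsOrder.weaken {f : Eps → ℝ} {b c : ℝ} (hf : IsOrder f b) (h : c ≤ b) :
    IsOrder f c := by
  refine hf.trans (Asymptotics.IsBigO.of_bound 1 (Eventually.of_forall fun ε => ?_))
  have h0 : (0 : ℝ) < ε := ε.2.1
  rw [Real.norm_of_nonneg (Real.rpow_nonneg h0.le _),
    Real.norm_of_nonneg (Real.rpow_nonneg h0.le _), one_mul]
  exact Real.rpow_le_rpow_of_exponent_ge h0 ε.2.2 h

theorem IsOrder.add {f g : Eps → ℝ} {b : ℝ} (hf : IsOrder f b) (hg : IsOrder g b) :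
    IsOrder (fun ε => f ε + g ε) b :=
  Asymptotics.IsBigO.add hf hg

theorem IsOrder.mul {f g : Eps → ℝ} {b c : ℝ} (hf : IsOrder f b) (hg : IsOrder g c) :
    IsOrder (fun ε => f ε * g ε) (b + c) := by
  refine (Asymptotics.IsBigO.mul hf hg).congr_right fun ε => ?_
  exact (Real.rpow_add ε.2.1 b c).symm

theorem isOrder_zero (b : ℝ) : IsOrder (fun _ => 0) b :=
  Asymptotics.isBigO_zero _ _

theorem IsModerate.mono {f g : Eps → ℝ} (hg : IsModerate g) (h : ∀ ε, |f ε| ≤ |g ε|) :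
    IsModerate f :=
  hg.imp fun _ hN => hN.mono h

theorem IsNegligible.mono {f g : Eps → ℝ} (hg : IsNegligible g) (h : ∀ ε, |f ε| ≤ |g ε|) :
    IsNegligible f :=
  fun q => (hg q).mono h

theorem IsModerate.add {f g : Eps → ℝ} (hf : IsModerate f) (hg : IsModerate g) :
    IsModerate (fun ε => f ε + g ε) := by
  obtain ⟨N, hN⟩ := hf
  obtain ⟨M, hM⟩ := hg
  refine ⟨N + M, (hN.weaken ?_).add (hM.weaken ?_)⟩ <;> push_cast <;>
    linarith [(Nat.cast_nonneg N : (0 : ℝ) ≤ N), (Nat.cast_nonneg M : (0 : ℝ) ≤ M)]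

theorem IsModerate.mul {f g : Eps → ℝ} (hf : IsModerate f) (hg : IsModerate g) :
    IsModerate (fun ε => f ε * g ε) := by
  obtain ⟨N, hN⟩ := hf
  obtain ⟨M, hM⟩ := hg
  refine ⟨N + M, (hN.mul hM).weaken (le_of_eq ?_)⟩
  push_cast; ring

theorem IsNegligible.add {f g : Eps → ℝ} (hf : IsNegligible f) (hg : IsNegligible g) :
    IsNegligible (fun ε => f ε + g ε) :=
  fun q => (hf q).add (hg q)

theorem IsModerate.mul_negligible {f g : Eps → ℝ} (hf : IsModerate f) (hg : IsNegligible g) :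
    IsNegligible (fun ε => f ε * g ε) := by
  obtain ⟨N, hN⟩ := hf
  intro q
  refine (hN.mul (hg (N + q))).weaken (le_of_eq ?_)
  push_cast; ring

theorem IsNegligible.mul_moderate {f g : Eps → ℝ} (hf : IsNegligible f) (hg : IsModerate g) :
    IsNegligible (fun ε => f ε * g ε) := by
  simpa only [mul_comm] using hg.mul_negligible hf

theorem isNegligible_zero : IsNegligible (fun _ => 0) := fun _ => isOrder_zero _

theorem IsNegligible.moderate {f : Eps → ℝ} (hf : IsNegligible f) : IsModerate f :=
  ⟨0, by simpa using hf 0⟩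

theorem isModerate_const (c : ℝ) : IsModerate (fun _ => c) := by
  refine ⟨0, ?_⟩
  simpa [IsOrder] using Asymptotics.isBigO_const_const c (one_ne_zero (α := ℝ)) epsZero

/-- `sup {b ∈ ℝ : f ε = O(ε ^ b)}`, as an extended real number. -/
def valuation (f : Eps → ℝ) : EReal := sSup {b : EReal | ∃ c : ℝ, b = c ∧ IsOrder f c}

/-! ## The ring of complex generalized numbers -/

/-- Moderate nets of complex numbers. -/
def moderateNumbers : Subring (Eps → ℂ) where
  carrier := {z | IsModerate fun ε => ‖z ε‖}
  zero_mem' := by simpa using isModerate_const 0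
  one_mem' := by simpa using isModerate_const 1
  add_mem' {z w} hz hw := by
    refine (IsModerate.add hz hw).mono fun ε => ?_
    simp only [Pi.add_apply, abs_norm]
    exact (norm_add_le _ _).trans (le_abs_self _)
  mul_mem' {z w} hz hw := by simpa using IsModerate.mul hz hw
  neg_mem' {z} hz := by simpa using hz

/-- Negligible nets of complex numbers. -/
def negligibleNumbers : Ideal moderateNumbers where
  carrier := {z | IsNegligible fun ε => ‖z.1 ε‖}
  zero_mem' := by simpa using isNegligible_zero
  add_mem' {z w} hz hw := by
    refine (IsNegligible.add hz hw).mono fun ε => ?_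
    simp only [Subring.coe_add, Pi.add_apply, abs_norm]
    exact (norm_add_le _ _).trans (le_abs_self _)
  smul_mem' z w hw := by simpa using IsModerate.mul_negligible z.2 hw

/-- The ring `ℂ̃` of complex generalized numbers. -/
def GenNumber : Type := moderateNumbers ⧸ negligibleNumbers

instance : CommRing GenNumber := inferInstanceAs (CommRing (moderateNumbers ⧸ negligibleNumbers))

/-- The class of a moderate net of complex numbers. -/
def GenNumber.mk (z : moderateNumbers) : GenNumber := Ideal.Quotient.mk negligibleNumbers z

/-- The ultra-pseudo-norm `|z|_e = exp (-val z)` on `ℂ̃`. The valuation does not depend on the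
representative of `z`. -/
def GenNumber.absE (z : GenNumber) : ENNReal :=
  EReal.exp (-(⨆ (w : moderateNumbers) (_ : GenNumber.mk w = z), valuation fun ε => ‖w.1 ε‖))

/-- The sharp topology of `ℂ̃`. -/
instance : TopologicalSpace GenNumber :=
  TopologicalSpace.generateFrom
    {B | ∃ (z : GenNumber) (r : ENNReal), 0 < r ∧ B = {w | GenNumber.absE (w - z) < r}}

/-- The generalized number `[(ε ^ b)_ε]`. -/
def GenNumber.epsPow (b : ℝ) : GenNumber :=
  GenNumber.mk ⟨fun ε => (((ε : ℝ) ^ b : ℝ) : ℂ), by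
    obtain ⟨N, hN⟩ := exists_nat_ge (-b)
    refine ⟨N, IsOrder.weaken (b := b) ?_ (by linarith)⟩
    refine IsOrder.mono (Asymptotics.isBigO_refl _ _) fun ε => ?_
    simp⟩

/-! ## The `ℂ̃`-module based on a locally convex space -/

section GenModule

variable {E ι : Type} [AddCommGroup E] [Module ℂ E] (P : ι → Seminorm ℂ E)

/-- The `E`-moderate nets, `E` being topologized by the seminorms `P i`. -/
def moderateNets : Submodule moderateNumbers (Eps → E) where
  carrier := {u | ∀ i, IsModerate fun ε => P i (u ε)}
  zero_mem' i := by simpa using isModerate_const 0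
  add_mem' {u v} hu hv i := by
    refine ((hu i).add (hv i)).mono fun ε => ?_
    rw [abs_of_nonneg (apply_nonneg _ _)]
    exact (map_add_le_add (P i) _ _).trans (le_abs_self _)
  smul_mem' z u hu i := by
    have := IsModerate.mul z.2 (hu i)
    refine this.mono fun ε => le_of_eq ?_
    congr 1
    exact map_smul_eq_mul (P i) (z.1 ε) (u ε)

/-- The `E`-negligible nets. -/
def negligibleNets : Submodule moderateNumbers (Eps → E) where
  carrier := {u | ∀ i, IsNegligible fun ε => P i (u ε)}
  zero_mem' i := by simpa using isNegligible_zero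
  add_mem' {u v} hu hv i := by
    refine ((hu i).add (hv i)).mono fun ε => ?_
    rw [abs_of_nonneg (apply_nonneg _ _)]
    exact (map_add_le_add (P i) _ _).trans (le_abs_self _)
  smul_mem' z u hu i := by
    have := IsModerate.mul_negligible z.2 (hu i)
    refine this.mono fun ε => le_of_eq ?_
    congr 1
    exact map_smul_eq_mul (P i) (z.1 ε) (u ε)

/-- Generalized functions based on `E`: moderate nets modulo negligible nets. -/
def GenModule : Type := moderateNets P ⧸ (negligibleNets P).submoduleOf (moderateNets P)

instance : AddCommGroup (GenModule P) :=
  inferInstanceAs (AddCommGroup (moderateNets P ⧸ (negligibleNets P).submoduleOf (moderateNets P)))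

theorem isTorsionBySet_quotient :
    Module.IsTorsionBySet moderateNumbers
      (moderateNets P ⧸ (negligibleNets P).submoduleOf (moderateNets P))
      (negligibleNumbers : Set moderateNumbers) := by
  intro u z
  obtain ⟨u, rfl⟩ := Submodule.Quotient.mk_surjective _ u
  rw [← Submodule.Quotient.mk_smul, Submodule.Quotient.mk_eq_zero]
  intro i
  refine (IsNegligible.mul_moderate z.2 (u.2 i)).mono fun ε => le_of_eq ?_
  congr 1
  exact map_smul_eq_mul (P i) (z.1.1 ε) (u.1 ε)

/-- `ℂ̃` acts by multiplication of representatives. -/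
instance : Module GenNumber (GenModule P) :=
  (isTorsionBySet_quotient P).module

/-- The class of a moderate net. -/
def GenModule.mk (u : moderateNets P) : GenModule P := Submodule.Quotient.mk u

theorem GenModule.mk_surjective : Function.Surjective (GenModule.mk P) :=
  Submodule.Quotient.mk_surjective _

theorem GenModule.smul_mk (z : moderateNumbers) (u : moderateNets P) :
    GenNumber.mk z • GenModule.mk P u = GenModule.mk P (z • u) := rfl

theorem GenModule.exists_smul_rep (z : GenNumber) (u : moderateNets P) :
    ∃ (c : moderateNumbers) (v : moderateNets P), GenModule.mk P v = z • GenModule.mk P u ∧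
      ∀ i ε, P i (v.1 ε) = ‖c.1 ε‖ * P i (u.1 ε) := by
  obtain ⟨c, rfl⟩ : ∃ c, GenNumber.mk c = z := Ideal.Quotient.mk_surjective z
  exact ⟨c, c • u, rfl, fun i ε => map_smul_eq_mul (P i) (c.1 ε) (u.1 ε)⟩

/-- The ultra-pseudo-seminorm `exp (-val)` belonging to the seminorm `P i`. The valuation does not
depend on the representative of `u`. -/
def GenModule.ultra (i : ι) (u : GenModule P) : ENNReal :=
  EReal.exp (-(⨆ (v : moderateNets P) (_ : GenModule.mk P v = u), valuation fun ε => P i (v.1 ε)))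

/-- The sharp topology: the topology determined by all the ultra-pseudo-seminorms. -/
instance : TopologicalSpace (GenModule P) :=
  TopologicalSpace.generateFrom
    {B | ∃ (i : ι) (u : GenModule P) (r : ENNReal), 0 < r ∧
      B = {v | GenModule.ultra P i (v - u) < r}}

end GenModule

/-- A set `A` in a `ℂ̃`-module is `ℂ̃`-convex if `A + A ⊆ A` and `[(ε ^ b)_ε] A ⊆ A` for all
`b ≥ 0`. -/
def IsGenConvex {G : Type} [AddCommGroup G] [Module GenNumber G] (A : Set G) : Prop :=
  (∀ u ∈ A, ∀ v ∈ A, u + v ∈ A) ∧ ∀ b : ℝ, 0 ≤ b → ∀ u ∈ A, GenNumber.epsPow b • u ∈ A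

/-- `t` is a locally convex `ℂ̃`-linear topology: addition and multiplication by scalars are
continuous, and there is a base of `ℂ̃`-convex neighbourhoods of the origin. -/
def IsLocallyConvexTopology {G : Type} [AddCommGroup G] [Module GenNumber G]
    (t : TopologicalSpace G) : Prop :=
  @ContinuousAdd G t _ ∧ @ContinuousSMul GenNumber G _ _ t ∧
    ∀ U ∈ @nhds G t 0, ∃ A ∈ @nhds G t 0, A ⊆ U ∧ IsGenConvex A

/-! ## Function spaces with weighted suprema of partial derivatives -/

/-- Iterated partial derivatives: for a list `l = [j₁, …, jₖ]` of indices,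
`pderiv e l f = ∂_{e j₁} ⋯ ∂_{e jₖ} f`. -/
def pderiv {J Z : Type} [NormedAddCommGroup Z] [NormedSpace ℝ Z] (e : J → Z) :
    List J → (Z → ℂ) → Z → ℂ
  | [], f => f
  | j :: l, f => fun z => fderiv ℝ (pderiv e l f) z (e j)

/-- Data for a space of `C^r` functions on an open set `U`, topologized by the seminorms
`f ↦ sup {w l z * |∂^l f z| : z ∈ S k, |l| ≤ min i r}`. -/
structure WeightSystem (J Z κ : Type) [NormedAddCommGroup Z] [NormedSpace ℝ Z] where
  /-- the directions of the partial derivatives -/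
  e : J → Z
  /-- the domain -/
  U : Set Z
  isOpen_U : IsOpen U
  /-- the regularity -/
  r : ℕ∞
  /-- the sets on which suprema are taken -/
  S : κ → Set Z
  S_subset : ∀ k, S k ⊆ U
  /-- the weights -/
  w : List J → Z → ℝ
  w_nonneg : ∀ l z, 0 ≤ w l z

namespace WeightSystem

variable {J Z κ : Type} [NormedAddCommGroup Z] [NormedSpace ℝ Z] (s : WeightSystem J Z κ)

theorem contDiffOn_pderiv {e : J → Z} {U : Set Z} (hU : IsOpen U) {r : ℕ∞} {f : Z → ℂ}
    (hf : ContDiffOn ℝ r f U) (l : List J) (k : ℕ∞) (h : (l.length : ℕ∞) + k ≤ r) :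
    ContDiffOn ℝ k (pderiv e l f) U := by
  induction l generalizing k with
  | nil => exact hf.of_le (by simpa using h)
  | cons j l ih =>
    have h1 : ContDiffOn ℝ ((k + 1 : ℕ∞) : WithTop ℕ∞) (pderiv e l f) U := by
      apply ih
      simp only [List.length_cons, Nat.cast_add, Nat.cast_one] at h
      rwa [add_comm k 1, ← add_assoc]
    have h2 : ContDiffOn ℝ k (fderiv ℝ (pderiv e l f)) U :=
      h1.fderiv_of_isOpen hU (by push_cast; exact le_rfl)
    exact h2.clm_apply contDiffOn_const

theorem differentiableAt_pderiv {e : J → Z} {U : Set Z} (hU : IsOpen U) {r : ℕ∞} {f : Z → ℂ}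
    (hf : ContDiffOn ℝ r f U) (l : List J) (h : (l.length : ℕ∞) + 1 ≤ r) {z : Z} (hz : z ∈ U) :
    DifferentiableAt ℝ (pderiv e l f) z :=
  ((contDiffOn_pderiv hU hf l 1 h).differentiableOn (by simp)).differentiableAt (hU.mem_nhds hz)

theorem pderiv_add {e : J → Z} {U : Set Z} (hU : IsOpen U) {r : ℕ∞} {f g : Z → ℂ}
    (hf : ContDiffOn ℝ r f U) (hg : ContDiffOn ℝ r g U) (l : List J)
    (h : (l.length : ℕ∞) ≤ r) {z : Z} (hz : z ∈ U) :
    pderiv e l (f + g) z = pderiv e l f z + pderiv e l g z := by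
  induction l generalizing z with
  | nil => rfl
  | cons j l ih =>
    have h1 : (l.length : ℕ∞) + 1 ≤ r := by simpa using h
    have h2 : pderiv e l (f + g) =ᶠ[𝓝 z] pderiv e l f + pderiv e l g :=
      Filter.mem_of_superset (hU.mem_nhds hz) fun y hy => ih (le_self_add.trans h1) hy
    simp only [pderiv]
    rw [h2.fderiv_eq, fderiv_add (differentiableAt_pderiv hU hf l h1 hz)
      (differentiableAt_pderiv hU hg l h1 hz)]
    rfl

theorem pderiv_smul {e : J → Z} {U : Set Z} (hU : IsOpen U) {r : ℕ∞} {f : Z → ℂ} (c : ℂ)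
    (hf : ContDiffOn ℝ r f U) (l : List J) (h : (l.length : ℕ∞) ≤ r) {z : Z} (hz : z ∈ U) :
    pderiv e l (c • f) z = c * pderiv e l f z := by
  induction l generalizing z with
  | nil => rfl
  | cons j l ih =>
    have h1 : (l.length : ℕ∞) + 1 ≤ r := by simpa using h
    have h2 : pderiv e l (c • f) =ᶠ[𝓝 z] c • pderiv e l f :=
      Filter.mem_of_superset (hU.mem_nhds hz) fun y hy => ih (le_self_add.trans h1) hy
    simp only [pderiv]
    rw [h2.fderiv_eq, fderiv_const_smul (differentiableAt_pderiv hU hf l h1 hz)]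
    rfl

/-- The index set of the supremum that defines a seminorm. -/
abbrev Index (k : κ) (i : ℕ) : Type :=
  {q : List J × Z // q.2 ∈ s.S k ∧ q.1.length ≤ i ∧ (q.1.length : ℕ∞) ≤ s.r}

/-- The weighted derivatives over which the supremum is taken. -/
def value (f : Z → ℂ) (k : κ) (i : ℕ) (q : s.Index k i) : ℝ :=
  s.w q.1.1 q.1.2 * ‖pderiv s.e q.1.1 f q.1.2‖

theorem value_nonneg (f : Z → ℂ) (k : κ) (i : ℕ) (q : s.Index k i) : 0 ≤ s.value f k i q :=
  mul_nonneg (s.w_nonneg _ _) (norm_nonneg _)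

theorem value_add_le {f g : Z → ℂ} (hf : ContDiffOn ℝ s.r f s.U) (hg : ContDiffOn ℝ s.r g s.U)
    (k : κ) (i : ℕ) (q : s.Index k i) :
    s.value (f + g) k i q ≤ s.value f k i q + s.value g k i q := by
  simp only [value]
  rw [pderiv_add s.isOpen_U hf hg _ q.2.2.2 (s.S_subset _ q.2.1), ← mul_add]
  exact mul_le_mul_of_nonneg_left (norm_add_le _ _) (s.w_nonneg _ _)

theorem value_smul {f : Z → ℂ} (c : ℂ) (hf : ContDiffOn ℝ s.r f s.U)
    (k : κ) (i : ℕ) (q : s.Index k i) :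
    s.value (c • f) k i q = ‖c‖ * s.value f k i q := by
  simp only [value]
  rw [pderiv_smul s.isOpen_U c hf _ q.2.2.2 (s.S_subset _ q.2.1), norm_mul]
  ring

/-- The `C^r` functions on `U` for which all the suprema are finite. The functions are defined on
the whole space, but only their restrictions to `U` matter. -/
def space : Submodule ℂ (Z → ℂ) where
  carrier := {f | ContDiffOn ℝ s.r f s.U ∧ ∀ k i, BddAbove (Set.range (s.value f k i))}
  zero_mem' := by
    refine ⟨contDiffOn_const, fun k i => ⟨0, ?_⟩⟩
    rintro _ ⟨q, rfl⟩
    have := s.value_smul (f := 0) 0 contDiffOn_const k i q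
    rw [zero_smul, norm_zero, zero_mul] at this
    exact this.le
  add_mem' {f g} hf hg := by
    refine ⟨hf.1.add hg.1, fun k i => ?_⟩
    obtain ⟨A, hA⟩ := hf.2 k i
    obtain ⟨B, hB⟩ := hg.2 k i
    refine ⟨A + B, ?_⟩
    rintro _ ⟨q, rfl⟩
    exact (s.value_add_le hf.1 hg.1 k i q).trans (add_le_add (hA ⟨q, rfl⟩) (hB ⟨q, rfl⟩))
  smul_mem' c f hf := by
    refine ⟨contDiffOn_const.smul hf.1, fun k i => ?_⟩
    obtain ⟨A, hA⟩ := hf.2 k i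
    refine ⟨‖c‖ * A, ?_⟩
    rintro _ ⟨q, rfl⟩
    rw [s.value_smul c hf.1]
    exact mul_le_mul_of_nonneg_left (hA ⟨q, rfl⟩) (norm_nonneg _)

/-- The seminorm `f ↦ sup {w l z * |∂^l f z| : z ∈ S k, |l| ≤ min i r}`. -/
def seminorm (ki : κ × ℕ) : Seminorm ℂ s.space :=
  Seminorm.of (fun f => ⨆ q, s.value f.1 ki.1 ki.2 q)
    (fun f g => by
      refine Real.iSup_le (fun q => ?_) (add_nonneg
        (Real.iSup_nonneg (s.value_nonneg _ _ _)) (Real.iSup_nonneg (s.value_nonneg _ _ _)))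
      exact (s.value_add_le f.2.1 g.2.1 _ _ q).trans
        (add_le_add (le_ciSup (f.2.2 _ _) q) (le_ciSup (g.2.2 _ _) q)))
    (fun c f => by
      rw [Real.mul_iSup_of_nonneg (norm_nonneg c)]
      exact iSup_congr fun q => s.value_smul c f.2.1 _ _ q)

end WeightSystem

/-- Euclidean space `ℝ^n`. -/
abbrev Euc (n : ℕ) : Type := EuclideanSpace ℝ (Fin n)

/-- The compact subsets of a set. -/
abbrev CompactIn {X : Type} [TopologicalSpace X] (U : Set X) : Type :=
  {K : Set X // IsCompact K ∧ K ⊆ U}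

/-! ## The spaces `C^r(Ω)` and the Colombeau algebras -/

section Colombeau

variable {n : ℕ}

/-- `C^r(Ω)` with the seminorms `p_{K,i}(f) = sup {|∂^α f x| : x ∈ K, |α| ≤ min i r}`. -/
def smoothSystem (r : ℕ∞) (Ω : TopologicalSpace.Opens (Euc n)) :
    WeightSystem (Fin n) (Euc n) (CompactIn (Ω : Set (Euc n))) where
  e j := EuclideanSpace.single j 1
  U := Ω
  isOpen_U := Ω.isOpen
  r := r
  S K := K.1
  S_subset K := K.2.2
  w _ _ := 1
  w_nonneg _ _ := zero_le_one

/-- The space `C^r(Ω)`, where `r = ⊤` stands for `C^∞(Ω)`. -/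
abbrev CSpace (r : ℕ∞) (Ω : TopologicalSpace.Opens (Euc n)) : Type := (smoothSystem r Ω).space

theorem mem_smoothSystem_space_iff (r : ℕ∞) (Ω : TopologicalSpace.Opens (Euc n)) (f : Euc n → ℂ) :
    f ∈ (smoothSystem r Ω).space ↔ ContDiffOn ℝ r f Ω := by
  refine ⟨fun h => h.1, fun h => ⟨h, fun K i => ?_⟩⟩
  have hl : ∀ l : List (Fin n), ∃ C : ℝ, (l.length : ℕ∞) ≤ r →
      ∀ x ∈ K.1, ‖pderiv (smoothSystem r Ω).e l f x‖ ≤ C := by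
    intro l
    by_cases hr : (l.length : ℕ∞) ≤ r
    · have hc : ContinuousOn (pderiv (smoothSystem r Ω).e l f) K.1 :=
        (WeightSystem.contDiffOn_pderiv Ω.isOpen h l 0 (by simpa using hr)).continuousOn.mono K.2.2
      obtain ⟨C, hC⟩ := K.2.1.exists_bound_of_continuousOn hc
      exact ⟨C, fun _ => hC⟩
    · exact ⟨0, fun h => absurd h hr⟩
  choose C hC using hl
  have hfin : {l : List (Fin n) | l.length ≤ i}.Finite := List.finite_length_le _ i
  obtain ⟨B, hB⟩ := (hfin.image C).bddAbove
  refine ⟨B, ?_⟩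
  rintro _ ⟨⟨⟨l, x⟩, hx, hi, hr⟩, rfl⟩
  have h1 := (hC l hr x hx).trans (hB ⟨l, hi, rfl⟩)
  simpa [WeightSystem.value, smoothSystem] using h1

/-- The inclusion `C^∞(Ω) ⊆ C^r(Ω)`. -/
def CSpace.incl (r : ℕ∞) (Ω : TopologicalSpace.Opens (Euc n)) (f : CSpace ⊤ Ω) : CSpace r Ω :=
  ⟨f.1, (mem_smoothSystem_space_iff r Ω f.1).2
    (((mem_smoothSystem_space_iff ⊤ Ω f.1).1 f.2).of_le (by exact_mod_cast le_top))⟩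

/-- The nets in `M_{C^r(Ω)}`. -/
abbrev moderateC (r : ℕ∞) (Ω : TopologicalSpace.Opens (Euc n)) :
    Submodule moderateNumbers (Eps → CSpace r Ω) :=
  moderateNets (smoothSystem r Ω).seminorm

/-- The nets in `N_{C^r(Ω)}`. -/
abbrev negligibleC (r : ℕ∞) (Ω : TopologicalSpace.Opens (Euc n)) :
    Submodule moderateNumbers (Eps → CSpace r Ω) :=
  negligibleNets (smoothSystem r Ω).seminorm

/-- The Colombeau algebra `G(Ω)`, as a `ℂ̃`-module with its sharp topology. -/
abbrev GenFun (Ω : TopologicalSpace.Opens (Euc n)) : Type := GenModule (smoothSystem ⊤ Ω).seminorm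

variable (Ω : TopologicalSpace.Opens (Euc n))

/-- The restriction of `u ∈ G(Ω)` to the open set `V ⊆ Ω` is zero in `G(V)`. -/
def GenFun.IsZeroOn (u : GenFun Ω) (V : Set (Euc n)) : Prop :=
  ∃ v : moderateC ⊤ Ω, GenModule.mk _ v = u ∧
    ∀ (K : CompactIn (Ω : Set (Euc n))) (i : ℕ), K.1 ⊆ V →
      IsNegligible fun ε => (smoothSystem ⊤ Ω).seminorm (K, i) (v.1 ε)

/-- The support of `u ∈ G(Ω)`: the complement in `Ω` of the largest open set on which `u` is
zero. -/
def GenFun.supp (u : GenFun Ω) : Set (Euc n) :=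
  {x | x ∈ Ω ∧ ∀ V : Set (Euc n), IsOpen V → V ⊆ Ω → x ∈ V → ¬ GenFun.IsZeroOn Ω u V}

variable {Ω}

theorem GenFun.IsZeroOn.mono {u : GenFun Ω} {V W : Set (Euc n)} (h : GenFun.IsZeroOn Ω u V)
    (hW : W ⊆ V) : GenFun.IsZeroOn Ω u W := by
  obtain ⟨v, hv, hz⟩ := h
  exact ⟨v, hv, fun K i hK => hz K i (hK.trans hW)⟩

theorem GenFun.isZeroOn_zero (V : Set (Euc n)) : GenFun.IsZeroOn Ω 0 V :=
  ⟨0, rfl, fun K i _ => by simpa using isNegligible_zero⟩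

theorem GenFun.IsZeroOn.add {u v : GenFun Ω} {V : Set (Euc n)} (hu : GenFun.IsZeroOn Ω u V)
    (hv : GenFun.IsZeroOn Ω v V) : GenFun.IsZeroOn Ω (u + v) V := by
  obtain ⟨a, rfl, ha⟩ := hu
  obtain ⟨b, rfl, hb⟩ := hv
  refine ⟨a + b, rfl, fun K i hK => ((ha K i hK).add (hb K i hK)).mono fun ε => ?_⟩
  rw [abs_of_nonneg (apply_nonneg _ _)]
  exact (map_add_le_add ((smoothSystem ⊤ Ω).seminorm (K, i)) _ _).trans (le_abs_self _)

theorem GenFun.IsZeroOn.smul {u : GenFun Ω} {V : Set (Euc n)} (z : GenNumber)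
    (hu : GenFun.IsZeroOn Ω u V) : GenFun.IsZeroOn Ω (z • u) V := by
  obtain ⟨a, rfl, ha⟩ := hu
  obtain ⟨c, v, hv, hc⟩ := GenModule.exists_smul_rep _ z a
  refine ⟨v, hv, fun K i hK => (IsModerate.mul_negligible c.2 (ha K i hK)).mono
    fun ε => le_of_eq ?_⟩
  rw [hc]

theorem GenFun.supp_zero : GenFun.supp Ω 0 = ∅ := by
  refine Set.eq_empty_of_forall_notMem fun x hx => ?_
  exact hx.2 Ω Ω.isOpen subset_rfl hx.1 (GenFun.isZeroOn_zero _)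

theorem GenFun.supp_add (u v : GenFun Ω) :
    GenFun.supp Ω (u + v) ⊆ GenFun.supp Ω u ∪ GenFun.supp Ω v := by
  intro x hx
  by_contra h
  simp only [GenFun.supp, Set.mem_union, Set.mem_ofPred_eq, not_or, not_and, not_forall,
    not_not] at h
  obtain ⟨V, hV, hVΩ, hxV, hu⟩ := h.1 hx.1
  obtain ⟨W, hW, -, hxW, hv⟩ := h.2 hx.1
  exact hx.2 (V ∩ W) (hV.inter hW) (Set.inter_subset_left.trans hVΩ) ⟨hxV, hxW⟩
    ((hu.mono Set.inter_subset_left).add (hv.mono Set.inter_subset_right))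

theorem GenFun.supp_smul (z : GenNumber) (u : GenFun Ω) :
    GenFun.supp Ω (z • u) ⊆ GenFun.supp Ω u :=
  fun _ hx => ⟨hx.1, fun V hV hVΩ hxV hu => hx.2 V hV hVΩ hxV (hu.smul z)⟩

variable (Ω)

/-- The submodule of all `u ∈ G(Ω)` whose support is contained in a compact subset of `Ω`. -/
def compactlySupported : Submodule GenNumber (GenFun Ω) where
  carrier := {u | ∃ K : CompactIn (Ω : Set (Euc n)), GenFun.supp Ω u ⊆ K.1}
  zero_mem' := ⟨⟨∅, isCompact_empty, Set.empty_subset _⟩, by simp [GenFun.supp_zero]⟩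
  add_mem' {u v} hu hv := by
    obtain ⟨K, hK⟩ := hu
    obtain ⟨L, hL⟩ := hv
    exact ⟨⟨K.1 ∪ L.1, K.2.1.union L.2.1, Set.union_subset K.2.2 L.2.2⟩,
      (GenFun.supp_add u v).trans (Set.union_subset_union hK hL)⟩
  smul_mem' z u hu := hu.imp fun _ hK => (GenFun.supp_smul z u).trans hK

/-- The algebra `G_c(Ω)` of generalized functions with compact support, as a `ℂ̃`-module. -/
def GenFunC : Type := compactlySupported Ω

instance : AddCommGroup (GenFunC Ω) := inferInstanceAs (AddCommGroup (compactlySupported Ω))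

instance : Module GenNumber (GenFunC Ω) :=
  inferInstanceAs (Module GenNumber (compactlySupported Ω))

variable {Ω} in
/-- The inclusion `G_c(Ω) ⊆ G(Ω)`. -/
def GenFunC.toGenFun (u : GenFunC Ω) : GenFun Ω := Subtype.val (p := (· ∈ compactlySupported Ω)) u

/-- The set `G_K(Ω)` of all `u ∈ G_c(Ω)` with support in the compact set `K`. -/
def GenFunK (K : CompactIn (Ω : Set (Euc n))) : Type :=
  {u : GenFunC Ω // GenFun.supp Ω u.toGenFun ⊆ K.1}

/-- The topology of `G_K(Ω)`: it is determined by the ultra-pseudo-seminorms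
`exp (-val_{p_{L,i}})`, where `L` is a compact subset of `Ω` that contains `K` in its interior. -/
instance (K : CompactIn (Ω : Set (Euc n))) : TopologicalSpace (GenFunK Ω K) :=
  TopologicalSpace.generateFrom
    {B | ∃ (L : CompactIn (Ω : Set (Euc n))) (i : ℕ) (u : GenFunK Ω K) (r : ENNReal),
      K.1 ⊆ interior L.1 ∧ 0 < r ∧
      B = {v | GenModule.ultra (smoothSystem ⊤ Ω).seminorm (L, i)
        (v.1.toGenFun - u.1.toGenFun) < r}}

/-- The topology of `G_c(Ω)`: the inductive limit of the `G_K(Ω)`, that is, the finest locally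
convex `ℂ̃`-linear topology for which all the inclusions `G_K(Ω) ⊆ G_c(Ω)` are continuous. -/
instance : TopologicalSpace (GenFunC Ω) :=
  sInf {t | IsLocallyConvexTopology t ∧
    ∀ K : CompactIn (Ω : Set (Euc n)), Continuous[inferInstance, t]
      (fun u : GenFunK Ω K => u.1)}

end Colombeau

/-! ## Generalized symbols and generalized phase functions -/

section Symbols

variable {n₁ n p : ℕ}

/-- The space of the variables `(x, y, ξ)`. -/
abbrev Var (n₁ n p : ℕ) : Type := Euc n₁ × Euc n × Euc p

/-- The indices of the partial derivatives in `x`, in `y` and in `ξ`. -/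
abbrev Dir (n₁ n p : ℕ) : Type := Fin n₁ ⊕ Fin n ⊕ Fin p

/-- The coordinate directions. -/
def dirVec : Dir n₁ n p → Var n₁ n p
  | .inl i => (EuclideanSpace.single i 1, 0, 0)
  | .inr (.inl k) => (0, EuclideanSpace.single k 1, 0)
  | .inr (.inr j) => (0, 0, EuclideanSpace.single j 1)

/-- The index of `∂_{y_k}`. -/
abbrev dirY (k : Fin n) : Dir n₁ n p := .inr (.inl k)

/-- The index of `∂_{ξ_j}`. -/
abbrev dirXi (j : Fin p) : Dir n₁ n p := .inr (.inr j)

/-- Is the derivative taken in a `ξ`-direction? -/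
def isXi : Dir n₁ n p → Bool
  | .inl _ => false
  | .inr (.inl _) => false
  | .inr (.inr _) => true

/-- The order in `ξ` of an iterated partial derivative. -/
def xiOrder (l : List (Dir n₁ n p)) : ℕ := l.countP fun d => isXi d

/-- The order in `(x, y)` of an iterated partial derivative. -/
def xyOrder (l : List (Dir n₁ n p)) : ℕ := l.countP fun d => !isXi d

/-- `⟨ξ⟩ = (1 + |ξ|²)^{1/2}`. -/
def bracket (ξ : Euc p) : ℝ := √(1 + ‖ξ‖ ^ 2)

variable (Ω₁ : TopologicalSpace.Opens (Euc n₁)) (Ω : TopologicalSpace.Opens (Euc n))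

/-- The set `Ω₁ × Ω`. -/
abbrev base : Set (Euc n₁ × Euc n) := (Ω₁ : Set (Euc n₁)) ×ˢ (Ω : Set (Euc n))

variable (p) in
/-- The set `Ω₁ × Ω × ℝ^p`. -/
abbrev fullDomain : Set (Var n₁ n p) := {z | (z.1, z.2.1) ∈ base Ω₁ Ω}

theorem isOpen_fullDomain : IsOpen (fullDomain p Ω₁ Ω) :=
  (Ω₁.isOpen.prod Ω.isOpen).preimage (continuous_fst.prodMk (continuous_fst.comp continuous_snd))

variable (p) in
/-- The symbols on `Ω₁ × Ω × ℝ^p` of order `m` and type `(ρ, δ)`, with the seminorms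
`sup {|∂_ξ^α ∂_{x,y}^β a| ⟨ξ⟩^{-m + ρ|α| - δ|β|} : (x, y) ∈ K, ξ ∈ ℝ^p, |α + β| ≤ i}`. -/
def symbolSystem (m ρ δ : ℝ) :
    WeightSystem (Dir n₁ n p) (Var n₁ n p) (CompactIn (base Ω₁ Ω)) where
  e := dirVec
  U := fullDomain p Ω₁ Ω
  isOpen_U := isOpen_fullDomain Ω₁ Ω
  r := ⊤
  S K := {z | (z.1, z.2.1) ∈ K.1}
  S_subset K _ hz := K.2.2 hz
  w l z := bracket z.2.2 ^ (-m + ρ * xiOrder l - δ * xyOrder l)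
  w_nonneg _ _ := Real.rpow_nonneg (Real.sqrt_nonneg _) _

variable (p) in
/-- The symbol space `S^m_{ρ,δ}(Ω₁ × Ω × ℝ^p)`. -/
abbrev SymbolSpace (m ρ δ : ℝ) : Type := (symbolSystem p Ω₁ Ω m ρ δ).space

variable (p) in
/-- The generalized symbols `S̃^m_{ρ,δ}(Ω₁ × Ω × ℝ^p)`. -/
abbrev GenSymbol (m ρ δ : ℝ) : Type := GenModule (symbolSystem p Ω₁ Ω m ρ δ).seminorm

variable (p) in
/-- The seminorms `sup {|ξ|^{-1 + |α|} |∂_ξ^α ∂_{x,y}^β a| : (x, y) ∈ K, ξ ≠ 0, |α + β| ≤ i}` of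
`S^1_hg(Ω₁ × Ω × ℝ^p \ 0)`. -/
def hgSystem : WeightSystem (Dir n₁ n p) (Var n₁ n p) (CompactIn (base Ω₁ Ω)) where
  e := dirVec
  U := {z | z ∈ fullDomain p Ω₁ Ω ∧ z.2.2 ≠ 0}
  isOpen_U := (isOpen_fullDomain Ω₁ Ω).inter
    (isOpen_ne.preimage (continuous_snd.comp continuous_snd))
  r := ⊤
  S K := {z | (z.1, z.2.1) ∈ K.1 ∧ z.2.2 ≠ 0}
  S_subset K _ hz := ⟨K.2.2 hz.1, hz.2⟩
  w l z := ‖z.2.2‖ ^ (-1 + (xiOrder l : ℝ))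
  w_nonneg _ _ := Real.rpow_nonneg (norm_nonneg _) _

variable (p) in
/-- Smooth functions on `Ω₁ × Ω × (ℝ^p \ 0)` for which all the seminorms of `hgSystem` are finite.
The homogeneous functions in this space form `S^1_hg(Ω₁ × Ω × ℝ^p \ 0)`. -/
abbrev HgSpace : Type := (hgSystem p Ω₁ Ω).space

/-- `|∇_{y,ξ} φ|²`. -/
def gradSq (φ : Var n₁ n p → ℂ) (z : Var n₁ n p) : ℝ :=
  ∑ j : Fin p, ‖pderiv dirVec [dirXi j] φ z‖ ^ 2 + ∑ k : Fin n, ‖pderiv dirVec [dirY k] φ z‖ ^ 2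

/-- `(x, y, ξ) ↦ (x, y, ξ / |ξ|)`. -/
def toSphere (z : Var n₁ n p) : Var n₁ n p := (z.1, z.2.1, ‖z.2.2‖⁻¹ • z.2.2)

variable {Ω₁ Ω} in
/-- `φ` is continuous on `Ω₁ × Ω × ℝ^p`, real valued, positively homogeneous of degree `1` in `ξ`,
and `∇_{y,ξ} φ` has no zero with `ξ ≠ 0`. Smoothness for `ξ ≠ 0` is part of `HgSpace`. -/
structure IsPhase (φ : HgSpace p Ω₁ Ω) : Prop where
  continuousOn : ContinuousOn φ.1 (fullDomain p Ω₁ Ω)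
  real : ∀ z ∈ fullDomain p Ω₁ Ω, (φ.1 z).im = 0
  homogeneous : ∀ x ∈ Ω₁, ∀ y ∈ Ω, ∀ ξ : Euc p, ∀ t : ℝ, 0 < t →
    φ.1 (x, y, t • ξ) = t * φ.1 (x, y, ξ)
  gradient : ∀ z ∈ fullDomain p Ω₁ Ω, z.2.2 ≠ 0 → gradSq φ.1 z ≠ 0

variable (p) in
/-- The nets of phase functions in `M_Φ(Ω₁; Ω × ℝ^p)`. The last condition says that, for compact
`K₁ ⊆ Ω₁` and `K ⊆ Ω`, the net of the infima of `|∇_{y,ξ} φ_ε(x, y, ξ / |ξ|)|²` over `x ∈ K₁`,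
`y ∈ K`, `ξ ≠ 0` is strictly nonzero. -/
structure PhaseNet where
  net : Eps → HgSpace p Ω₁ Ω
  isPhase : ∀ ε, IsPhase (net ε)
  moderate : net ∈ moderateNets (hgSystem p Ω₁ Ω).seminorm
  strictlyNonzero : ∀ (K₁ : CompactIn (Ω₁ : Set (Euc n₁))) (K : CompactIn (Ω : Set (Euc n))),
    ∃ r > (0 : ℝ), ∃ η : Eps, ∀ ε ≤ η, ∀ x ∈ K₁.1, ∀ y ∈ K.1, ∀ ξ : Euc p, ξ ≠ 0 →
      (ε : ℝ) ^ r ≤ gradSq (net ε).1 (toSphere (x, y, ξ))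

/-- Equivalence of nets of phase functions: the difference is negligible in
`S^1_hg(Ω₁ × Ω × ℝ^p \ 0)`. -/
instance PhaseNet.setoid : Setoid (PhaseNet p Ω₁ Ω) where
  r φ ψ := φ.net - ψ.net ∈ negligibleNets (hgSystem p Ω₁ Ω).seminorm
  iseqv :=
    { refl := fun φ => by simp [zero_mem]
      symm := fun {φ ψ} h => by simpa using neg_mem h
      trans := fun {φ ψ θ} h h₂ => by simpa using add_mem h h₂ }

variable (p) in
/-- The generalized phase functions `Φ̃(Ω₁; Ω × ℝ^p)`. -/
def GenPhase : Type := Quotient (PhaseNet.setoid (p := p) Ω₁ Ω)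

/-! ## Oscillatory integrals -/

/-- A cut-off function: smooth, equal to `1` for `|ξ| < 1/4` and to `0` for `|ξ| > 1/2`. -/
structure IsCutoff (χ : Euc p → ℂ) : Prop where
  smooth : ContDiff ℝ ∞ χ
  eq_one : ∀ ξ, ‖ξ‖ < 1 / 4 → χ ξ = 1
  eq_zero : ∀ ξ, 1 / 2 < ‖ξ‖ → χ ξ = 0

/-- `a_j = i (1 - χ(ξ)) |∇_{y,ξ} φ(x, y, ξ / |ξ|)|^{-2} ∂_{ξ_j} φ`. -/
def coeffA (χ : Euc p → ℂ) (φ : Var n₁ n p → ℂ) (j : Fin p) (z : Var n₁ n p) : ℂ :=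
  Complex.I * (1 - χ z.2.2) * ((gradSq φ (toSphere z))⁻¹ : ℝ) * pderiv dirVec [dirXi j] φ z

/-- `b_k = i (1 - χ(ξ)) |ξ|^{-2} |∇_{y,ξ} φ(x, y, ξ / |ξ|)|^{-2} ∂_{y_k} φ`. -/
def coeffB (χ : Euc p → ℂ) (φ : Var n₁ n p → ℂ) (k : Fin n) (z : Var n₁ n p) : ℂ :=
  Complex.I * (1 - χ z.2.2) * ((‖z.2.2‖ ^ 2)⁻¹ : ℝ) * ((gradSq φ (toSphere z))⁻¹ : ℝ) *
    pderiv dirVec [dirY k] φ z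

/-- `c = χ + ∑_j ∂_{ξ_j} a_j + ∑_k ∂_{y_k} b_k`. -/
def coeffC (χ : Euc p → ℂ) (φ : Var n₁ n p → ℂ) (z : Var n₁ n p) : ℂ :=
  χ z.2.2 + ∑ j : Fin p, pderiv dirVec [dirXi j] (coeffA χ φ j) z +
    ∑ k : Fin n, pderiv dirVec [dirY k] (coeffB χ φ k) z

/-- The operator `L_φ = ∑_j a_j ∂_{ξ_j} + ∑_k b_k ∂_{y_k} + c`. Its transpose maps `e^{iφ}` to
itself. -/
def opL (χ : Euc p → ℂ) (φ : Var n₁ n p → ℂ) (g : Var n₁ n p → ℂ) : Var n₁ n p → ℂ :=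
  fun z => ∑ j : Fin p, coeffA χ φ j z * pderiv dirVec [dirXi j] g z +
    ∑ k : Fin n, coeffB χ φ k z * pderiv dirVec [dirY k] g z + coeffC χ φ z * g z

/-- The integrand `e^{iφ} L_φ^h (a u)` with the normalizing factor `(2π)^{-p}` of `đξ`. -/
def integrand (χ : Euc p → ℂ) (φ a : Var n₁ n p → ℂ) (u : Euc n → ℂ) (h : ℕ) (x : Euc n₁)
    (q : Euc n × Euc p) : ℂ :=
  (((2 * Real.pi) ^ p)⁻¹ : ℝ) * (Complex.exp (Complex.I * φ (x, q)) *
    ((opL χ φ)^[h] fun z => a z * u z.2.1) (x, q))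

variable {Ω₁ Ω} {m ρ δ : ℝ}

/-- `w ∈ G(Ω₁)` is the generalized oscillatory integral `∫ e^{iφ(x,y,ξ)} a(x,y,ξ) u(y) dy đξ`.
Take any representatives of `φ`, `a` and `u`, any cut-off in `L_φ` and any compact set `K ⊆ Ω` that
contains the support of `u` in its interior. If `m - h s + 1 + k < -p`, where `s = min ρ (1 - δ)`,
then the net of the integrals of `e^{iφ_ε} L_{φ_ε}^h (a_ε u_ε)` over `K × ℝ^p` converges absolutely,
it is a moderate net in `C^k(Ω₁)`, and its class in `G_{C^k(Ω₁)}` is the image of `w`. -/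
def IsOscillatoryIntegral (φ : GenPhase p Ω₁ Ω) (a : GenSymbol p Ω₁ Ω m ρ δ) (u : GenFunC Ω)
    (w : GenFun Ω₁) : Prop :=
  ∀ (φN : PhaseNet p Ω₁ Ω) (aN : moderateNets (symbolSystem p Ω₁ Ω m ρ δ).seminorm)
    (uN : moderateC ⊤ Ω) (wN : moderateC ⊤ Ω₁),
    Quotient.mk _ φN = φ → GenModule.mk _ aN = a → GenModule.mk _ uN = u.toGenFun →
    GenModule.mk _ wN = w →
    ∀ χ : Euc p → ℂ, IsCutoff χ →
    ∀ K : CompactIn (Ω : Set (Euc n)), GenFun.supp Ω u.toGenFun ⊆ interior K.1 →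
    ∀ k h : ℕ, m - h * min ρ (1 - δ) + 1 + k < -(p : ℝ) →
      (∀ (ε : Eps), ∀ x ∈ Ω₁, IntegrableOn
        (integrand χ (φN.net ε).1 (aN.1 ε).1 (uN.1 ε).1 h x) (K.1 ×ˢ Set.univ)) ∧
      ∃ v ∈ moderateC k Ω₁,
        (∀ (ε : Eps), ∀ x ∈ Ω₁, (v ε).1 x = ∫ q in K.1 ×ˢ Set.univ,
          integrand χ (φN.net ε).1 (aN.1 ε).1 (uN.1 ε).1 h x q) ∧
        (fun ε => v ε - CSpace.incl k Ω₁ (wN.1 ε)) ∈ negligibleC k Ω₁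

end Symbols

end Colombeau

end

open Colombeau

noncomputable section

namespace Colombeau

/-! ## The sharp topology -/

/-! For fixed `ε` the argument is classical. Since `∇_{y,ξ} φ` has no zero, the coefficients `a_j`,
`b_k`, `c` of `L_φ` are symbols of order `0`, `-1`, `-1`, so `L_φ` lowers the order by `s = min ρ (1
- δ)` (`PhasePair.pair_opL`), and its transpose fixes `e^{iφ}` (`IsPhase.exp_mul_opL`). After enough
applications the integrand is absolutely integrable. If `u` vanishes off `K`, integration by parts
shows that the value depends neither on `h` nor on `χ` nor on `K` (`oscInt_eq`). What remains is to
control all constants in `ε`.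

The control is organised by symbol estimates for families over an arbitrary index set `T` with a map
`τ : T → Eps`, whose constants lie in a `BoundIdeal`. `NetBound` is such an estimate for one family;
`PairBound` asks for moderate bounds on one family and for bounds in `I` on its difference from
another. Products, inverses, derivatives and `L_φ` respect both. Different choices of `T` and `I`
then give different results: `T = Eps` with the moderate ideal gives moderateness, with the
negligible ideal independence of representatives; `T = ℕ` gives bounds uniform in the
regularization; and `T` ranging over all test data with a weighted ideal gives a continuity
estimate.

The condition `m - h s + 1 + k < -p` counts orders. Each `x`-derivative of `e^{iφ} g` costs at most
one power of `⟨ξ⟩`, which accounts for `k`. A change of phase costs one more, because `|e^{iφ} -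
e^{iφ'}| ≤ |φ - φ'|` and the right side has order `1`.

A representative of `u` need not vanish off `K`, so integration by parts is not available for it.
`GenFun.exists_rep_eq_zero` supplies one that vanishes off `K`; passing to it at fixed `h`, `χ`, `K`
changes the integral by a negligible net only. `IsOscNet.sub_mem` combines both facts. For a
vanishing representative the integrals for all `h` are one and the same function, which is therefore
smooth and represents `w`.

Linearity and uniqueness both follow from `IsOscillatoryIntegral.smul_add`, as a net negligible in
every `C^k` is negligible. For continuity, a seminorm of the image is at most `|B ε|` times a
seminorm of `u` with `B = O(ε^{-M})`; hence valuations drop by at most `M`, and the inductive limit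
topology asks for no more than such bounds on each `G_K`. -/

theorem expE_neg_lt_iff (S : EReal) (r : ENNReal) :
    EReal.exp (-S) < r ↔ -ENNReal.log r < S := by
  have : r = EReal.exp (ENNReal.log r) := by simp
  conv_lhs => rw [this, EReal.exp_lt_exp_iff]
  exact EReal.neg_lt_comm

theorem lt_valuation_iff (f : Eps → ℝ) (c : EReal) :
    c < valuation f ↔ ∃ b : ℝ, IsOrder f b ∧ c < b := by
  rw [valuation, lt_sSup_iff]
  constructor
  · rintro ⟨_, ⟨b, rfl, hb⟩, h⟩
    exact ⟨b, hb, h⟩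
  · rintro ⟨b, hb, h⟩
    exact ⟨b, ⟨b, rfl, hb⟩, h⟩

/-- A strict upper bound on `exp (-sup)` is witnessed by a single representative with a single
exponent. Working with such witnesses avoids having to show that the valuation is independent of the
representative. -/
theorem GenNumber.absE_lt_iff (z : GenNumber) (r : ENNReal) :
    GenNumber.absE z < r ↔ ∃ (b : ℝ) (w : moderateNumbers), GenNumber.mk w = z ∧
      IsOrder (fun ε => ‖w.1 ε‖) b ∧ EReal.exp (-(b : EReal)) < r := by
  simp only [GenNumber.absE, expE_neg_lt_iff, lt_iSup_iff, lt_valuation_iff, exists_prop]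
  exact ⟨fun ⟨w, hw, b, hb, h⟩ => ⟨b, w, hw, hb, h⟩, fun ⟨b, w, hw, hb, h⟩ => ⟨w, hw, b, hb, h⟩⟩

section GenModule

variable {E ι : Type} [AddCommGroup E] [Module ℂ E] (P : ι → Seminorm ℂ E)

theorem GenModule.ultra_lt_iff (i : ι) (u : GenModule P) (r : ENNReal) :
    GenModule.ultra P i u < r ↔ ∃ (b : ℝ) (v : moderateNets P), GenModule.mk P v = u ∧
      IsOrder (fun ε => P i (v.1 ε)) b ∧ EReal.exp (-(b : EReal)) < r := by
  simp only [GenModule.ultra, expE_neg_lt_iff, lt_iSup_iff, lt_valuation_iff, exists_prop]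
  exact ⟨fun ⟨w, hw, b, hb, h⟩ => ⟨b, w, hw, hb, h⟩, fun ⟨b, w, hw, hb, h⟩ => ⟨w, hw, b, hb, h⟩⟩

theorem exists_expE_neg_lt {r : ENNReal} (hr : 0 < r) : ∃ b : ℝ, EReal.exp (-(b : EReal)) < r := by
  simp only [expE_neg_lt_iff]
  have h : -ENNReal.log r < ⊤ := by
    rw [lt_top_iff_ne_top, Ne, EReal.neg_eq_top_iff, ENNReal.log_eq_bot_iff]
    exact hr.ne'
  obtain ⟨q, hq, -⟩ := EReal.exists_rat_btwn_of_lt h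
  exact ⟨((q : ℚ) : ℝ), hq⟩

theorem GenModule.ultra_zero_lt (i : ι) {r : ENNReal} (hr : 0 < r) :
    GenModule.ultra P i 0 < r := by
  obtain ⟨b, hb⟩ := exists_expE_neg_lt hr
  refine (GenModule.ultra_lt_iff P i 0 r).2 ⟨b, 0, rfl, ?_, hb⟩
  simpa using isOrder_zero b

theorem GenNumber.absE_zero_lt {r : ENNReal} (hr : 0 < r) : GenNumber.absE 0 < r := by
  obtain ⟨b, hb⟩ := exists_expE_neg_lt hr
  refine (GenNumber.absE_lt_iff 0 r).2 ⟨b, 0, rfl, ?_, hb⟩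
  simpa using isOrder_zero b

theorem GenModule.ultra_add_lt {i : ι} {u v : GenModule P} {r : ENNReal}
    (hu : GenModule.ultra P i u < r) (hv : GenModule.ultra P i v < r) :
    GenModule.ultra P i (u + v) < r := by
  rw [GenModule.ultra_lt_iff] at hu hv ⊢
  obtain ⟨b, u, rfl, hb, hbr⟩ := hu
  obtain ⟨c, v, rfl, hc, hcr⟩ := hv
  refine ⟨min b c, u + v, rfl, ?_, ?_⟩
  · refine ((hb.weaken (min_le_left b c)).add (hc.weaken (min_le_right b c))).mono fun ε => ?_
    rw [abs_of_nonneg (apply_nonneg _ _)]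
    exact (map_add_le_add (P i) _ _).trans (le_abs_self _)
  · rcases min_choice b c with h | h <;> rwa [h]

theorem GenModule.ultra_smul_lt {i : ι} {z : GenNumber} {u : GenModule P} {r s : ENNReal}
    (hz : GenNumber.absE z < r) (hu : GenModule.ultra P i u < s) :
    GenModule.ultra P i (z • u) < r * s := by
  rw [GenModule.ultra_lt_iff] at hu ⊢
  rw [GenNumber.absE_lt_iff] at hz
  obtain ⟨c, z, rfl, hc, hcr⟩ := hz
  obtain ⟨b, u, rfl, hb, hbr⟩ := hu
  refine ⟨c + b, z • u, (GenModule.smul_mk P z u).symm, ?_, ?_⟩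
  · refine (hc.mul hb).mono fun ε => le_of_eq ?_
    congr 1
    exact map_smul_eq_mul (P i) (z.1 ε) (u.1 ε)
  · have h : EReal.exp (-((c + b : ℝ) : EReal)) =
        EReal.exp (-(c : EReal)) * EReal.exp (-(b : EReal)) := by
      rw [← EReal.exp_add, ← EReal.coe_neg, ← EReal.coe_neg, ← EReal.coe_neg, ← EReal.coe_add]
      congr 2; ring
    rw [h]
    exact ENNReal.mul_lt_mul hcr hbr

theorem GenModule.ultra_lt_top (i : ι) (u : GenModule P) : GenModule.ultra P i u < ⊤ := by
  obtain ⟨u, rfl⟩ := GenModule.mk_surjective P u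
  obtain ⟨N, hN⟩ := u.2 i
  exact (GenModule.ultra_lt_iff P i _ ⊤).2 ⟨_, u, rfl, hN, by
    rw [EReal.exp_lt_top_iff, ← EReal.coe_neg]; exact EReal.coe_lt_top _⟩

theorem GenNumber.absE_lt_top (z : GenNumber) : GenNumber.absE z < ⊤ := by
  obtain ⟨z, rfl⟩ : ∃ c, GenNumber.mk c = z := Ideal.Quotient.mk_surjective z
  obtain ⟨N, hN⟩ := z.2
  exact (GenNumber.absE_lt_iff _ ⊤).2 ⟨_, z, rfl, hN, by
    rw [EReal.exp_lt_top_iff, ← EReal.coe_neg]; exact EReal.coe_lt_top _⟩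

theorem GenModule.ultra_sub_lt_mem_nhds (i : ι) (u : GenModule P) {r : ENNReal} (hr : 0 < r) :
    {v | GenModule.ultra P i (v - u) < r} ∈ 𝓝 u := by
  refine IsOpen.mem_nhds (TopologicalSpace.isOpen_generateFrom_of_mem ⟨i, u, r, hr, rfl⟩) ?_
  simpa using GenModule.ultra_zero_lt P i hr

theorem GenNumber.absE_sub_lt_mem_nhds (z : GenNumber) {r : ENNReal} (hr : 0 < r) :
    {w | GenNumber.absE (w - z) < r} ∈ 𝓝 z := by
  refine IsOpen.mem_nhds (TopologicalSpace.isOpen_generateFrom_of_mem ⟨z, r, hr, rfl⟩) ?_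
  simpa using GenNumber.absE_zero_lt hr

/-- By the ultrametric inequality a subbasic ball that contains `u` contains the ball of the same
radius about `u`, so only balls centred at `u` need testing. -/
theorem GenModule.tendsto_nhds {α : Type} {l : Filter α} {f : α → GenModule P} {u : GenModule P}
    (h : ∀ i (r : ENNReal), 0 < r → ∀ᶠ a in l, GenModule.ultra P i (f a - u) < r) :
    Tendsto f l (𝓝 u) := by
  rw [TopologicalSpace.tendsto_nhds_generateFrom_iff]
  rintro _ ⟨i, v, r, hr, rfl⟩ hu
  filter_upwards [h i r hr] with a ha
  have := GenModule.ultra_add_lt P ha hu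
  simpa using this

instance : ContinuousAdd (GenModule P) := by
  refine ⟨continuous_iff_continuousAt.2 fun ⟨u, v⟩ => GenModule.tendsto_nhds P fun i r hr => ?_⟩
  filter_upwards [prod_mem_nhds (GenModule.ultra_sub_lt_mem_nhds P i u hr)
    (GenModule.ultra_sub_lt_mem_nhds P i v hr)] with ⟨a, b⟩ h
  have := GenModule.ultra_add_lt P h.1 h.2
  rwa [sub_add_sub_comm] at this

theorem exists_pos_mul_lt_ennreal {a r : ENNReal} (ha : a < ⊤) (hr : 0 < r) :
    ∃ s : ENNReal, 0 < s ∧ s ≤ 1 ∧ s * a < r ∧ a * s < r := by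
  have h : Tendsto (fun s : ENNReal => s * a) (𝓝 0) (𝓝 (0 * a)) :=
    ENNReal.Tendsto.mul_const tendsto_id (Or.inr ha.ne)
  rw [zero_mul] at h
  have h1 := (h.eventually (gt_mem_nhds hr)).and
    (gt_mem_nhds (zero_lt_one : (0 : ENNReal) < 1))
  have h2 : ∃ᶠ s : ENNReal in 𝓝 0, 0 < s := by
    rw [frequently_iff]
    intro U hU
    obtain ⟨e, he, heU⟩ := ENNReal.nhds_zero_basis.mem_iff.1 hU
    obtain ⟨s, hs, hse⟩ := exists_between he
    exact ⟨s, heU hse, hs⟩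
  obtain ⟨s, hs, h3, h4⟩ := (h2.and_eventually h1).exists
  exact ⟨s, hs, h4.le, h3, by rwa [mul_comm]⟩

instance : ContinuousSMul GenNumber (GenModule P) := by
  refine ⟨continuous_iff_continuousAt.2 fun ⟨z, u⟩ => GenModule.tendsto_nhds P fun i r hr => ?_⟩
  obtain ⟨A, hzA, hA⟩ := exists_between (GenNumber.absE_lt_top z)
  obtain ⟨B, huB, hB⟩ := exists_between (GenModule.ultra_lt_top P i u)
  obtain ⟨s, hs, -, -, hsr⟩ := exists_pos_mul_lt_ennreal hA hr
  obtain ⟨q, hq, -, hqr, -⟩ := exists_pos_mul_lt_ennreal hB hr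
  obtain ⟨e, he, he1, her, -⟩ := exists_pos_mul_lt_ennreal ENNReal.one_lt_top hr
  filter_upwards [prod_mem_nhds
    (inter_mem (GenNumber.absE_sub_lt_mem_nhds z hq) (GenNumber.absE_sub_lt_mem_nhds z he))
    (inter_mem (GenModule.ultra_sub_lt_mem_nhds P i u hs)
      (GenModule.ultra_sub_lt_mem_nhds P i u (zero_lt_one)))] with ⟨w, v⟩ h
  have h1 := (GenModule.ultra_smul_lt P h.1.1 huB).trans hqr
  have h2 := (GenModule.ultra_smul_lt P hzA h.2.1).trans hsr
  have h3 := (GenModule.ultra_smul_lt P h.1.2 h.2.2).trans her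
  have := GenModule.ultra_add_lt P (GenModule.ultra_add_lt P h1 h2) h3
  -- Each of the three terms is small, and the ultrametric inequality keeps their sum below the same
  -- `r`.
  have e : w • v - z • u = (w - z) • u + z • (v - u) + (w - z) • (v - u) := by
    simp only [sub_smul, smul_sub]; abel
  simpa only [e] using this

theorem GenModule.ultra_epsPow_smul_lt {i : ι} {u : GenModule P} {r : ENNReal} {b : ℝ}
    (hb : 0 ≤ b) (hu : GenModule.ultra P i u < r) :
    GenModule.ultra P i (GenNumber.epsPow b • u) < r := by
  rw [GenModule.ultra_lt_iff] at hu ⊢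
  obtain ⟨c, u, rfl, hc, hcr⟩ := hu
  refine ⟨c, _, GenModule.smul_mk P _ u, ?_, hcr⟩
  refine hc.mono fun ε => ?_
  rw [abs_of_nonneg (apply_nonneg _ _), abs_of_nonneg (apply_nonneg _ _)]
  refine (map_smul_eq_mul (P i) _ (u.1 ε)).trans_le ?_
  refine mul_le_of_le_one_left (apply_nonneg _ _) ?_
  rw [Complex.norm_real, Real.norm_of_nonneg (Real.rpow_nonneg ε.2.1.le _)]
  exact Real.rpow_le_one ε.2.1.le ε.2.2 hb

theorem GenModule.exists_genConvex_nhds {U : Set (GenModule P)} (hU : U ∈ 𝓝 0) :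
    ∃ A ∈ 𝓝 (0 : GenModule P), A ⊆ U ∧ IsGenConvex A := by
  -- The sets that contain a convex neighbourhood of the origin form a filter, so it suffices to
  -- treat the subbasic sets; each of those containing `0` contains a ball about `0`, which is
  -- convex.
  let G : Filter (GenModule P) :=
    { sets := {U | ∃ A ∈ 𝓝 (0 : GenModule P), A ⊆ U ∧ IsGenConvex A}
      univ_sets := ⟨univ, univ_mem, subset_rfl, fun _ _ _ _ => trivial, fun _ _ _ _ => trivial⟩
      sets_of_superset := fun ⟨A, hA, h, hc⟩ hUV => ⟨A, hA, h.trans hUV, hc⟩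
      inter_sets := fun ⟨A, hA, h, hc⟩ ⟨B, hB, h', hc'⟩ =>
        ⟨A ∩ B, inter_mem hA hB, inter_subset_inter h h',
          fun u hu v hv => ⟨hc.1 u hu.1 v hv.1, hc'.1 u hu.2 v hv.2⟩,
          fun b hb u hu => ⟨hc.2 b hb u hu.1, hc'.2 b hb u hu.2⟩⟩ }
  suffices h : G ≤ 𝓝 0 from h hU
  rw [TopologicalSpace.nhds_generateFrom]
  refine le_iInf₂ fun s hs => le_principal_iff.2 ?_
  obtain ⟨h0, i, u, r, hr, rfl⟩ := hs
  refine ⟨_, GenModule.ultra_sub_lt_mem_nhds P i 0 hr, fun v hv => ?_, fun v hv w hw => ?_,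
    fun b hb v hv => ?_⟩
  · have := GenModule.ultra_add_lt P hv h0
    simpa [sub_eq_add_neg] using this
  · simp only [Set.mem_ofPred_eq, sub_zero] at *
    exact GenModule.ultra_add_lt P hv hw
  · simp only [Set.mem_ofPred_eq, sub_zero] at *
    exact GenModule.ultra_epsPow_smul_lt P hb hv

end GenModule

/-! ### Continuity on the inductive limit -/

section InductiveLimit

variable {n n₁ : ℕ} {Ω : TopologicalSpace.Opens (Euc n)} {Ω₁ : TopologicalSpace.Opens (Euc n₁)}

/-- A `ℂ̃`-linear map on `G_c(Ω)` is continuous if its restrictions to the `G_K(Ω)` are bounded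
with respect to the ultra-pseudo-seminorms. -/
theorem continuous_of_ultra_bound (A : GenFunC Ω →ₗ[GenNumber] GenFun Ω₁)
    (h : ∀ (K : CompactIn (Ω : Set (Euc n))) (q : CompactIn (Ω₁ : Set (Euc n₁)) × ℕ),
      ∃ (L : CompactIn (Ω : Set (Euc n))) (j : ℕ) (N : ENNReal), K.1 ⊆ interior L.1 ∧ N < ⊤ ∧
        ∀ u : GenFunC Ω, GenFun.supp Ω u.toGenFun ⊆ K.1 → ∀ r : ENNReal,
          GenModule.ultra (smoothSystem ⊤ Ω).seminorm (L, j) u.toGenFun < r →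
          GenModule.ultra (smoothSystem ⊤ Ω₁).seminorm q (A u) < N * r) :
    Continuous A := by
  -- The pullback of the sharp topology along `A` is one of the competitors over which the inductive
  -- limit topology is the finest, and `A` is continuous for it by construction.
  let t : TopologicalSpace (GenFunC Ω) := TopologicalSpace.induced A inferInstance
  suffices ht : t ∈ {t | IsLocallyConvexTopology t ∧
      ∀ K : CompactIn (Ω : Set (Euc n)), Continuous[inferInstance, t]
        (fun u : GenFunK Ω K => u.1)} from
    continuous_le_dom (sInf_le ht) continuous_induced_dom
  refine ⟨⟨?_, ?_, ?_⟩, fun K => ?_⟩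
  · exact continuousAdd_induced A
  · exact (Topology.IsInducing.mk rfl : Topology.IsInducing A).continuousSMul continuous_id
      (fun {c x} => map_smul A c x)
  · intro U hU
    rw [nhds_induced, map_zero, mem_comap] at hU
    obtain ⟨V, hV, hVU⟩ := hU
    obtain ⟨B, hB, hBV, hc⟩ := GenModule.exists_genConvex_nhds _ hV
    refine ⟨A ⁻¹' B, ?_, (preimage_mono hBV).trans hVU, fun u hu v hv => ?_, fun b hb u hu => ?_⟩
    · rw [nhds_induced, map_zero]
      exact preimage_mem_comap hB
    · simpa using hc.1 _ hu _ hv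
    · simpa using hc.2 b hb _ hu
  · rw [continuous_induced_rng, continuous_iff_continuousAt]
    intro u
    refine GenModule.tendsto_nhds _ fun q r hr => ?_
    obtain ⟨L, j, N, hKL, hN, hL⟩ := h K q
    obtain ⟨s, hs, -, -, hsr⟩ := exists_pos_mul_lt_ennreal hN hr
    have hmem : {v : GenFunK Ω K | GenModule.ultra (smoothSystem ⊤ Ω).seminorm (L, j)
        (v.1.toGenFun - u.1.toGenFun) < s} ∈ 𝓝 u := by
      refine IsOpen.mem_nhds (TopologicalSpace.isOpen_generateFrom_of_mem
        ⟨L, j, u, s, hKL, hs, rfl⟩) ?_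
      simpa using GenModule.ultra_zero_lt _ _ hs
    filter_upwards [hmem] with v hv
    have hsupp : GenFun.supp Ω (v.1 - u.1).toGenFun ⊆ K.1 := by
      have e : (v.1 - u.1).toGenFun = v.1.toGenFun + (-1 : GenNumber) • u.1.toGenFun := by
        rw [neg_one_smul, ← sub_eq_add_neg]; rfl
      rw [e]
      exact (GenFun.supp_add _ _).trans
        (union_subset v.2 ((GenFun.supp_smul _ _).trans u.2))
    have := (hL _ hsupp s hv).trans hsr
    rwa [map_sub] at this

end InductiveLimit

/-! ## Classes of bounds -/

/-- A class of bounds for families indexed by `T`, each member of which has a parameter `τ t`. It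
is stable under addition, domination and multiplication by moderate nets. -/
structure BoundIdeal {T : Type} (τ : T → Eps) where
  carrier : Set (T → ℝ)
  zero_mem : (fun _ => 0) ∈ carrier
  add_mem : ∀ {f g}, f ∈ carrier → g ∈ carrier → (fun t => f t + g t) ∈ carrier
  mono_mem : ∀ {f g : T → ℝ}, g ∈ carrier → (∀ t, |f t| ≤ |g t|) → f ∈ carrier
  mul_mem : ∀ {B : Eps → ℝ} {g}, IsModerate B → g ∈ carrier → (fun t => B (τ t) * g t) ∈ carrier

theorem IsModerate.abs {B : Eps → ℝ} (h : IsModerate B) : IsModerate fun ε => |B ε| :=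
  h.mono fun ε => by rw [abs_abs]

theorem IsNegligible.abs {B : Eps → ℝ} (h : IsNegligible B) : IsNegligible fun ε => |B ε| :=
  h.mono fun ε => by rw [abs_abs]

section Calculus

variable {T : Type} {τ : T → Eps}

/-- The bounds `|C t| ≤ |B (τ t)| * P t` with a moderate net `B`. -/
def weightedIdeal (τ : T → Eps) (P : T → ℝ) : BoundIdeal τ where
  carrier := {C | ∃ B, IsModerate B ∧ ∀ t, |C t| ≤ |B (τ t)| * |P t|}
  zero_mem := ⟨fun _ => 0, isModerate_const 0, fun t => by simp⟩
  add_mem := by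
    rintro f g ⟨B, hB, hf⟩ ⟨D, hD, hg⟩
    refine ⟨_, hB.abs.add hD.abs, fun t => (abs_add_le _ _).trans ?_⟩
    refine le_trans ?_ (mul_le_mul_of_nonneg_right (le_abs_self _) (abs_nonneg _))
    rw [add_mul]
    exact add_le_add (hf t) (hg t)
  mono_mem := fun ⟨B, hB, hg⟩ h => ⟨B, hB, fun t => (h t).trans (hg t)⟩
  mul_mem := by
    rintro B g hB ⟨D, hD, hg⟩
    refine ⟨_, hB.mul hD, fun t => ?_⟩
    rw [abs_mul, abs_mul, mul_assoc]
    exact mul_le_mul_of_nonneg_left (hg t) (abs_nonneg _)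

/-- The moderate bounds. -/
def modIdeal (τ : T → Eps) : BoundIdeal τ := weightedIdeal τ fun _ => 1

/-- The negligible bounds. -/
def negIdeal (τ : T → Eps) : BoundIdeal τ where
  carrier := {C | ∃ B, IsNegligible B ∧ ∀ t, |C t| ≤ |B (τ t)|}
  zero_mem := ⟨fun _ => 0, isNegligible_zero, fun t => by simp⟩
  add_mem := by
    rintro f g ⟨B, hB, hf⟩ ⟨D, hD, hg⟩
    refine ⟨_, hB.abs.add hD.abs, fun t => (abs_add_le _ _).trans ?_⟩
    exact (add_le_add (hf t) (hg t)).trans (le_abs_self _)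
  mono_mem := fun ⟨B, hB, hg⟩ h => ⟨B, hB, fun t => (h t).trans (hg t)⟩
  mul_mem := by
    rintro B g hB ⟨D, hD, hg⟩
    refine ⟨_, hB.mul_negligible hD, fun t => ?_⟩
    rw [abs_mul, abs_mul]
    exact mul_le_mul_of_nonneg_left (hg t) (abs_nonneg _)

theorem mem_modIdeal {C : T → ℝ} :
    C ∈ (modIdeal τ).carrier ↔ ∃ B, IsModerate B ∧ ∀ t, |C t| ≤ |B (τ t)| := by
  simp [modIdeal, weightedIdeal]

theorem comp_mem_modIdeal {B : Eps → ℝ} (h : IsModerate B) :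
    (fun t => B (τ t)) ∈ (modIdeal τ).carrier :=
  mem_modIdeal.2 ⟨B, h, fun _ => le_rfl⟩

theorem const_mem_modIdeal (c : ℝ) : (fun _ => c) ∈ (modIdeal τ).carrier :=
  mem_modIdeal.2 ⟨_, isModerate_const c, fun _ => le_rfl⟩

namespace BoundIdeal

variable (I : BoundIdeal τ)

theorem mod_mul_mem {f g : T → ℝ} (hf : f ∈ (modIdeal τ).carrier) (hg : g ∈ I.carrier) :
    (fun t => f t * g t) ∈ I.carrier := by
  obtain ⟨B, hB, hf⟩ := mem_modIdeal.1 hf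
  refine I.mono_mem (I.mul_mem hB hg) fun t => ?_
  rw [abs_mul, abs_mul]
  exact mul_le_mul_of_nonneg_right (hf t) (abs_nonneg _)

theorem const_mul_mem (c : ℝ) {g : T → ℝ} (hg : g ∈ I.carrier) :
    (fun t => c * g t) ∈ I.carrier :=
  I.mod_mul_mem (const_mem_modIdeal c) hg

theorem abs_mem {g : T → ℝ} (hg : g ∈ I.carrier) : (fun t => |g t|) ∈ I.carrier :=
  I.mono_mem hg fun t => by rw [abs_abs]

theorem sum_mem {α : Type} (s : Finset α) {g : α → T → ℝ} (hg : ∀ a ∈ s, g a ∈ I.carrier) :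
    (fun t => ∑ a ∈ s, g a t) ∈ I.carrier := by
  classical
  induction s using Finset.induction_on with
  | empty => simpa using I.zero_mem
  | insert a s ha ih =>
    simp only [Finset.sum_insert ha]
    exact I.add_mem (hg a (Finset.mem_insert_self _ _))
      (ih fun b hb => hg b (Finset.mem_insert_of_mem hb))

end BoundIdeal

/-! ## Calculus of iterated partial derivatives -/

section pderiv

variable {J Z : Type} [NormedAddCommGroup Z] [NormedSpace ℝ Z] {e : J → Z} {U : Set Z}

theorem pderiv_append (l l' : List J) (f : Z → ℂ) :
    pderiv e (l ++ l') f = pderiv e l (pderiv e l' f) := by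
  induction l with
  | nil => rfl
  | cons j l ih => simp only [List.cons_append, pderiv, ih]

theorem pderiv_congr (hU : IsOpen U) {f g : Z → ℂ} (h : EqOn f g U) (l : List J) :
    EqOn (pderiv e l f) (pderiv e l g) U := by
  induction l with
  | nil => exact h
  | cons j l ih =>
    intro z hz
    simp only [pderiv]
    rw [(ih.eventuallyEq_of_mem (hU.mem_nhds hz)).fderiv_eq]

theorem pderiv_zero (l : List J) : pderiv e l (0 : Z → ℂ) = 0 := by
  induction l with
  | nil => rfl
  | cons j l ih =>
    funext z
    simp [pderiv, ih]

theorem pderiv_eq_zero (hU : IsOpen U) {f : Z → ℂ} (h : ∀ z ∈ U, f z = 0) (l : List J) {z : Z}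
    (hz : z ∈ U) : pderiv e l f z = 0 := by
  have := pderiv_congr (e := e) (g := 0) hU (fun z hz => h z hz) l hz
  rw [this, pderiv_zero, Pi.zero_apply]

theorem pderiv_map {J' : Type} (σ : J' → J) (l : List J') (f : Z → ℂ) :
    pderiv (fun j => e (σ j)) l f = pderiv e (l.map σ) f := by
  induction l with
  | nil => rfl
  | cons j l ih => simp only [List.map_cons, pderiv, ih]

theorem contDiffOn_infty_pderiv (hU : IsOpen U) {f : Z → ℂ} (hf : ContDiffOn ℝ ∞ f U)
    (l : List J) : ContDiffOn ℝ ∞ (pderiv e l f) U :=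
  WeightSystem.contDiffOn_pderiv (r := ⊤) hU hf l ⊤ le_top

theorem differentiableAt_of_contDiffOn (hU : IsOpen U) {f : Z → ℂ} (hf : ContDiffOn ℝ ∞ f U)
    {z : Z} (hz : z ∈ U) : DifferentiableAt ℝ f z :=
  (hf.differentiableOn (by simp)).differentiableAt (hU.mem_nhds hz)

theorem pderiv_single_mul {f g : Z → ℂ} {z : Z} (hf : DifferentiableAt ℝ f z)
    (hg : DifferentiableAt ℝ g z) (j : J) :
    pderiv e [j] (fun z => f z * g z) z = pderiv e [j] f z * g z + f z * pderiv e [j] g z := by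
  simp only [pderiv]
  rw [fderiv_fun_mul hf hg]
  simp only [add_apply, smul_apply, smul_eq_mul]
  ring

theorem pderiv_single_add {f g : Z → ℂ} {z : Z} (hf : DifferentiableAt ℝ f z)
    (hg : DifferentiableAt ℝ g z) (j : J) :
    pderiv e [j] (fun z => f z + g z) z = pderiv e [j] f z + pderiv e [j] g z := by
  simp only [pderiv]
  rw [fderiv_fun_add hf hg]
  rfl

theorem pderiv_single_const (c : ℂ) (j : J) (z : Z) : pderiv e [j] (fun _ : Z => c) z = 0 := by
  simp [pderiv]

/-- Derivatives of a function of `π z`. -/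
theorem pderiv_comp_clm {Y : Type} [NormedAddCommGroup Y] [NormedSpace ℝ Y] (π : Z →L[ℝ] Y)
    {V : Set Y} (hV : IsOpen V) {f : Y → ℂ} (hf : ContDiffOn ℝ ∞ f V) (l : List J) {z : Z}
    (hz : π z ∈ V) :
    pderiv e l (fun z => f (π z)) z = pderiv (fun j => π (e j)) l f (π z) := by
  induction l generalizing z with
  | nil => rfl
  | cons j l ih =>
    simp only [pderiv]
    have h1 : pderiv e l (fun z => f (π z)) =ᶠ[𝓝 z]
        (pderiv (fun j => π (e j)) l f) ∘ π :=
      Filter.mem_of_superset ((hV.preimage π.continuous).mem_nhds hz) fun y hy => ih hy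
    rw [h1.fderiv_eq, fderiv_comp z (differentiableAt_of_contDiffOn hV
      (contDiffOn_infty_pderiv hV hf l) hz) π.differentiableAt, π.fderiv]
    rfl

/-- A derivative vanishes if one of the directions is zero. -/
theorem pderiv_eq_zero_of_mem {f : Z → ℂ} {l : List J} {j : J} (hj : j ∈ l) (he : e j = 0) :
    pderiv e l f = 0 := by
  induction l with
  | nil => simp at hj
  | cons k l ih =>
    funext z
    simp only [pderiv]
    rcases List.mem_cons.1 hj with rfl | h
    · simp [he]
    · simp [ih h]

end pderiv

/-! ## Symbol bounds for families of functions -/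

/-- A system of derivatives with weights: `f` has order `μ` if `∂^l f` is bounded on `S` by
`b ^ (μ + cost l)`. -/
structure Frame (J Z : Type) [NormedAddCommGroup Z] [NormedSpace ℝ Z] where
  e : J → Z
  cost : J → ℝ
  b : Z → ℝ
  one_le_b : ∀ z, 1 ≤ b z
  U : Set Z
  isOpen_U : IsOpen U
  S : Set Z
  S_subset : S ⊆ U

variable {J Z : Type} [NormedAddCommGroup Z] [NormedSpace ℝ Z]

/-- A family of smooth functions whose derivatives up to the order `i` satisfy symbol estimates of
order `μ`, with constants in `I`. -/
def NetBound (F : Frame J Z) (I : BoundIdeal τ) (μ : ℝ) (i : ℕ) (f : T → Z → ℂ) : Prop :=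
  (∀ t, ContDiffOn ℝ ∞ (f t) F.U) ∧ ∀ l : List J, l.length ≤ i → ∃ C ∈ I.carrier,
    ∀ t, ∀ z ∈ F.S, ‖pderiv F.e l (f t) z‖ ≤ C t * F.b z ^ (μ + (l.map F.cost).sum)

namespace NetBound

variable {F : Frame J Z} {I : BoundIdeal τ} {μ ν : ℝ} {i : ℕ} {f g : T → Z → ℂ}

theorem value (hf : NetBound F I μ i f) :
    ∃ C ∈ I.carrier, ∀ t, ∀ z ∈ F.S, ‖f t z‖ ≤ C t * F.b z ^ μ := by
  simpa [pderiv] using hf.2 [] (by simp)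

theorem of_le {k : ℕ} (hf : NetBound F I μ i f) (h : k ≤ i) : NetBound F I μ k f :=
  ⟨hf.1, fun l hl => hf.2 l (hl.trans h)⟩

theorem deriv (hf : NetBound F I μ (i + 1) f) (j : J) :
    NetBound F I (μ + F.cost j) i fun t => pderiv F.e [j] (f t) := by
  refine ⟨fun t => contDiffOn_infty_pderiv F.isOpen_U (hf.1 t) _, fun l hl => ?_⟩
  obtain ⟨C, hC, h⟩ := hf.2 (l ++ [j]) (by simpa using hl)
  refine ⟨C, hC, fun t z hz => ?_⟩
  have := h t z hz
  rw [pderiv_append] at this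
  convert this using 3
  simp; ring

/-- The basis of all inductions on the number of derivatives. The derivative split off is the
innermost one, the last entry of the list, so that rules for first derivatives suffice and no
Leibniz formula over lists is required. -/
theorem of_deriv (hs : ∀ t, ContDiffOn ℝ ∞ (f t) F.U)
    (h0 : ∃ C ∈ I.carrier, ∀ t, ∀ z ∈ F.S, ‖f t z‖ ≤ C t * F.b z ^ μ)
    (h : ∀ j, NetBound F I (μ + F.cost j) i fun t => pderiv F.e [j] (f t)) :
    NetBound F I μ (i + 1) f := by
  refine ⟨hs, fun l hl => ?_⟩
  rcases List.eq_nil_or_concat' l with rfl | ⟨l, j, rfl⟩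
  · simpa [pderiv] using h0
  · obtain ⟨C, hC, h1⟩ := (h j).2 l (by simpa using hl)
    refine ⟨C, hC, fun t z hz => ?_⟩
    have := h1 t z hz
    rw [pderiv_append]
    convert this using 3
    simp; ring

theorem of_value (hs : ∀ t, ContDiffOn ℝ ∞ (f t) F.U)
    (h0 : ∃ C ∈ I.carrier, ∀ t, ∀ z ∈ F.S, ‖f t z‖ ≤ C t * F.b z ^ μ) :
    NetBound F I μ 0 f := by
  refine ⟨hs, fun l hl => ?_⟩
  rw [List.length_eq_zero_iff.1 (Nat.le_zero.1 hl)]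
  simpa [pderiv] using h0

theorem congr (hf : NetBound F I μ i f) (h : ∀ t, EqOn (g t) (f t) F.U) :
    NetBound F I μ i g := by
  refine ⟨fun t => (hf.1 t).congr (h t), fun l hl => ?_⟩
  obtain ⟨C, hC, h1⟩ := hf.2 l hl
  refine ⟨C, hC, fun t z hz => ?_⟩
  rw [pderiv_congr F.isOpen_U (h t) l (F.S_subset hz)]
  exact h1 t z hz

theorem mono (hf : NetBound F I μ i f) (h : μ ≤ ν) : NetBound F I ν i f := by
  refine ⟨hf.1, fun l hl => ?_⟩
  obtain ⟨C, hC, h1⟩ := hf.2 l hl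
  refine ⟨_, I.abs_mem hC, fun t z hz => (h1 t z hz).trans ?_⟩
  have := F.one_le_b z
  refine mul_le_mul (le_abs_self _) (Real.rpow_le_rpow_of_exponent_le this (by linarith))
    (by positivity) (abs_nonneg _)

theorem zero : NetBound F I μ i fun _ _ => 0 := by
  refine ⟨fun t => contDiffOn_const, fun l _ => ⟨_, I.zero_mem, fun t z _ => ?_⟩⟩
  have := congrFun (pderiv_zero (e := F.e) l) z
  simp only [Pi.zero_def] at this
  simp [this]

theorem add (hf : NetBound F I μ i f) (hg : NetBound F I μ i g) :
    NetBound F I μ i fun t z => f t z + g t z := by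
  refine ⟨fun t => (hf.1 t).add (hg.1 t), fun l hl => ?_⟩
  obtain ⟨C, hC, h1⟩ := hf.2 l hl
  obtain ⟨D, hD, h2⟩ := hg.2 l hl
  refine ⟨_, I.add_mem hC hD, fun t z hz => ?_⟩
  have := WeightSystem.pderiv_add (e := F.e) (r := ⊤) F.isOpen_U (hf.1 t) (hg.1 t) l le_top
    (F.S_subset hz)
  change ‖pderiv F.e l (f t + g t) z‖ ≤ _
  rw [this, add_mul]
  exact (norm_add_le _ _).trans (add_le_add (h1 t z hz) (h2 t z hz))

theorem const_mul (c : ℂ) (hf : NetBound F I μ i f) : NetBound F I μ i fun t z => c * f t z := by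
  refine ⟨fun t => contDiffOn_const.mul (hf.1 t), fun l hl => ?_⟩
  obtain ⟨C, hC, h1⟩ := hf.2 l hl
  refine ⟨_, I.const_mul_mem ‖c‖ hC, fun t z hz => ?_⟩
  have := WeightSystem.pderiv_smul (e := F.e) (r := ⊤) F.isOpen_U c (hf.1 t) l le_top
    (F.S_subset hz)
  change ‖pderiv F.e l (c • f t) z‖ ≤ _
  rw [this, norm_mul, mul_assoc]
  exact mul_le_mul_of_nonneg_left (h1 t z hz) (norm_nonneg _)

theorem neg (hf : NetBound F I μ i f) : NetBound F I μ i fun t z => -f t z := by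
  simpa using hf.const_mul (-1)

theorem sub (hf : NetBound F I μ i f) (hg : NetBound F I μ i g) :
    NetBound F I μ i fun t z => f t z - g t z := by
  simpa [sub_eq_add_neg] using hf.add hg.neg

theorem sum {α : Type} (s : Finset α) {f : α → T → Z → ℂ}
    (hf : ∀ a ∈ s, NetBound F I μ i (f a)) :
    NetBound F I μ i fun t z => ∑ a ∈ s, f a t z := by
  classical
  induction s using Finset.induction_on with
  | empty => simpa using zero
  | insert a s ha ih =>
    simp only [Finset.sum_insert ha]
    exact (hf a (Finset.mem_insert_self _ _)).add
      (ih fun b hb => hf b (Finset.mem_insert_of_mem hb))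

theorem const (c : ℂ) : NetBound F (modIdeal τ) 0 i fun _ _ => c := by
  refine ⟨fun t => contDiffOn_const, fun l _ => ?_⟩
  refine ⟨_, const_mem_modIdeal ‖c‖, fun t z _ => ?_⟩
  rcases List.eq_nil_or_concat' l with rfl | ⟨l, j, rfl⟩
  · simp [pderiv]
  · have h : pderiv F.e [j] (fun _ : Z => c) = 0 := funext fun z => pderiv_single_const c j z
    rw [pderiv_append, h, pderiv_zero, Pi.zero_apply, norm_zero]
    have := F.one_le_b z
    positivity

/-- Induction on `i`: the product rule reduces `i + 1` derivatives of `f g` to `i` derivatives of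
`f' g` and `f g'`. One factor must be moderate, since bounds in `I` cannot be multiplied with each
other. -/
theorem mul (hf : NetBound F (modIdeal τ) μ i f) (hg : NetBound F I ν i g) :
    NetBound F I (μ + ν) i fun t z => f t z * g t z := by
  have hval : ∀ {μ ν : ℝ} {f g : T → Z → ℂ} {i}, NetBound F (modIdeal τ) μ i f →
      NetBound F I ν i g →
      ∃ C ∈ I.carrier, ∀ t, ∀ z ∈ F.S, ‖f t z * g t z‖ ≤ C t * F.b z ^ (μ + ν) := by
    intro μ ν f g i hf hg
    obtain ⟨C, hC, h1⟩ := hf.value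
    obtain ⟨D, hD, h2⟩ := hg.value
    refine ⟨_, I.mod_mul_mem hC hD, fun t z hz => ?_⟩
    rw [norm_mul, Real.rpow_add (by linarith [F.one_le_b z]), mul_mul_mul_comm]
    exact mul_le_mul (h1 t z hz) (h2 t z hz) (norm_nonneg _)
      ((norm_nonneg _).trans (h1 t z hz))
  induction i generalizing μ ν f g with
  | zero => exact of_value (fun t => (hf.1 t).mul (hg.1 t)) (hval hf hg)
  | succ i ih =>
    refine of_deriv (fun t => (hf.1 t).mul (hg.1 t)) (hval hf hg) fun j => ?_
    have h1 := (ih (hf.deriv j) (hg.of_le i.le_succ)).add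
      ((ih (hf.of_le i.le_succ) (hg.deriv j)).mono (ν := μ + F.cost j + ν) (by linarith))
    refine (h1.congr fun t z hz => ?_).mono (by linarith)
    exact pderiv_single_mul (differentiableAt_of_contDiffOn F.isOpen_U (hf.1 t) hz)
      (differentiableAt_of_contDiffOn F.isOpen_U (hg.1 t) hz) j

/-- Induction on `i` through `(1/f)' = -f' (1/f) (1/f)`, where `1/f` enters on the right only with
derivatives already estimated. A lower bound for `f` is used only for the value itself. -/
theorem inv (hf : ∀ i, NetBound F (modIdeal τ) μ i f) (h0 : ∀ t, ∀ z ∈ F.U, f t z ≠ 0)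
    (hC : ∃ C ∈ (modIdeal τ).carrier, ∀ t, ∀ z ∈ F.S, ‖(f t z)⁻¹‖ ≤ C t * F.b z ^ (-μ)) (i : ℕ) :
    NetBound F (modIdeal τ) (-μ) i fun t z => (f t z)⁻¹ := by
  have hs : ∀ t, ContDiffOn ℝ ∞ (fun z => (f t z)⁻¹) F.U :=
    fun t => ((hf 0).1 t).inv (h0 t)
  induction i with
  | zero => exact of_value hs hC
  | succ i ih =>
    refine of_deriv hs hC fun j => ?_
    have h1 := ((((hf (i + 1)).deriv j).mul ih).mul ih).neg
    refine (h1.mono (ν := -μ + F.cost j) (by linarith)).congr fun t z hz => ?_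
    have hd := differentiableAt_of_contDiffOn F.isOpen_U ((hf 0).1 t) hz
    have h2 := pderiv_single_mul (e := F.e) hd
      (differentiableAt_of_contDiffOn F.isOpen_U (hs t) hz) j
    -- Differentiating `f · f⁻¹ = 1` determines the derivative of `f⁻¹`.
    have h3 : pderiv F.e [j] (fun z => f t z * (f t z)⁻¹) z = 0 := by
      rw [pderiv_congr F.isOpen_U (g := fun _ => 1)
        (fun z hz => mul_inv_cancel₀ (h0 t z hz)) [j] hz, pderiv_single_const]
    rw [h3] at h2
    have := h0 t z hz
    dsimp only at h2 ⊢
    generalize pderiv F.e [j] (fun z => (f t z)⁻¹) z = w at *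
    field_simp
    field_simp at h2
    linear_combination -h2

/-- Change of the frame: fewer derivatives, a smaller set, larger weights. -/
theorem frame {J' : Type} {F' : Frame J' Z} (hf : NetBound F I μ i f) (σ : J' → J)
    (he : ∀ j, F'.e j = F.e (σ j)) (hc : ∀ j, F.cost (σ j) ≤ F'.cost j) (hb : F'.b = F.b)
    (hU : F'.U ⊆ F.U) (hS : F'.S ⊆ F.S) : NetBound F' I μ i f := by
  refine ⟨fun t => (hf.1 t).mono hU, fun l hl => ?_⟩
  obtain ⟨C, hC, h⟩ := hf.2 (l.map σ) (by simpa using hl)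
  refine ⟨_, I.abs_mem hC, fun t z hz => ?_⟩
  rw [show F'.e = fun j => F.e (σ j) from funext he, pderiv_map, hb]
  refine (h t z (hS hz)).trans ?_
  have := F.one_le_b z
  refine mul_le_mul (le_abs_self _) (Real.rpow_le_rpow_of_exponent_le this ?_)
    (by positivity) (abs_nonneg _)
  rw [List.map_map]
  have : (l.map (F.cost ∘ σ)).sum ≤ (l.map F'.cost).sum :=
    List.sum_le_sum fun j _ => hc j
  linarith

end NetBound

/-- `f'` satisfies moderate symbol estimates, and `f - f'` has symbol estimates with constants
in `I`. -/
def PairBound (F : Frame J Z) (I : BoundIdeal τ) (μ : ℝ) (i : ℕ) (f f' : T → Z → ℂ) : Prop :=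
  NetBound F (modIdeal τ) μ i f' ∧ NetBound F I μ i fun t z => f t z - f' t z

namespace PairBound

variable {F : Frame J Z} {I : BoundIdeal τ} {μ ν : ℝ} {i : ℕ} {f f' g g' : T → Z → ℂ}

theorem smooth_left (h : PairBound F I μ i f f') (t : T) : ContDiffOn ℝ ∞ (f t) F.U := by
  have := (h.2.1 t).add (h.1.1 t)
  exact this.congr fun z _ => by simp

theorem refl (h : NetBound F (modIdeal τ) μ i f) : PairBound F I μ i f f :=
  ⟨h, by simpa using NetBound.zero⟩

theorem of_le {k : ℕ} (hf : PairBound F I μ i f f') (h : k ≤ i) : PairBound F I μ k f f' :=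
  ⟨hf.1.of_le h, hf.2.of_le h⟩

theorem mono (hf : PairBound F I μ i f f') (h : μ ≤ ν) : PairBound F I ν i f f' :=
  ⟨hf.1.mono h, hf.2.mono h⟩

theorem congr (hf : PairBound F I μ i f f') (h : ∀ t, EqOn (g t) (f t) F.U)
    (h' : ∀ t, EqOn (g' t) (f' t) F.U) : PairBound F I μ i g g' :=
  ⟨hf.1.congr h', hf.2.congr fun t z hz => by simp only [h t hz, h' t hz]⟩

theorem add (hf : PairBound F I μ i f f') (hg : PairBound F I μ i g g') :
    PairBound F I μ i (fun t z => f t z + g t z) (fun t z => f' t z + g' t z) :=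
  ⟨hf.1.add hg.1, (hf.2.add hg.2).congr fun t z _ => by ring⟩

theorem sum {α : Type} (s : Finset α) {f f' : α → T → Z → ℂ}
    (hf : ∀ a ∈ s, PairBound F I μ i (f a) (f' a)) :
    PairBound F I μ i (fun t z => ∑ a ∈ s, f a t z) (fun t z => ∑ a ∈ s, f' a t z) :=
  ⟨NetBound.sum s fun a ha => (hf a ha).1,
    (NetBound.sum s fun a ha => (hf a ha).2).congr fun t z _ => by simp⟩

/-- `f g - f' g' = f (g - g') + g' (f - f')`. Moderateness of `f` is a separate assumption, because
`I` need not consist of moderate bounds; nothing of the kind is asked of `g`. -/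
theorem mul (hm : NetBound F (modIdeal τ) μ i f) (hf : PairBound F I μ i f f')
    (hg : PairBound F I ν i g g') :
    PairBound F I (μ + ν) i (fun t z => f t z * g t z) (fun t z => f' t z * g' t z) :=
  ⟨hf.1.mul hg.1, ((hm.mul hg.2).add ((hg.1.mul hf.2).mono (by linarith))).congr
    fun t z _ => by ring⟩

theorem const_mul (c : ℂ) (hf : PairBound F I μ i f f') :
    PairBound F I μ i (fun t z => c * f t z) (fun t z => c * f' t z) :=
  ⟨hf.1.const_mul c, (hf.2.const_mul c).congr fun t z _ => by ring⟩

theorem deriv (hf : PairBound F I μ (i + 1) f f') (j : J) :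
    PairBound F I (μ + F.cost j) i (fun t => pderiv F.e [j] (f t))
      (fun t => pderiv F.e [j] (f' t)) := by
  refine ⟨hf.1.deriv j, (hf.2.deriv j).congr fun t z hz => ?_⟩
  have h1 := pderiv_single_add (e := F.e) (differentiableAt_of_contDiffOn F.isOpen_U (hf.2.1 t) hz)
    (differentiableAt_of_contDiffOn F.isOpen_U (hf.1.1 t) hz) j
  simp only [sub_add_cancel] at h1
  exact sub_eq_of_eq_add h1

/-- `1/f - 1/f' = -(1/f) (1/f') (f - f')`. -/
theorem inv (hf : NetBound F (modIdeal τ) (-μ) i fun t z => (f t z)⁻¹)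
    (hf' : NetBound F (modIdeal τ) (-μ) i fun t z => (f' t z)⁻¹) (h : PairBound F I μ i f f')
    (h0 : ∀ t, ∀ z ∈ F.U, f t z ≠ 0) (h0' : ∀ t, ∀ z ∈ F.U, f' t z ≠ 0) :
    PairBound F I (-μ) i (fun t z => (f t z)⁻¹) (fun t z => (f' t z)⁻¹) := by
  refine ⟨hf', ((hf.mul (hf'.mul h.2)).neg.mono (by linarith)).congr fun t z hz => ?_⟩
  have h1 := h0 t z hz
  have h2 := h0' t z hz
  dsimp only
  field_simp
  ring

end PairBound

end Calculus

/-! ## Symbol bounds on `Ω₁ × Ω × ℝ^p` -/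

section Bracket

variable {p : ℕ}

theorem one_le_bracket (ξ : Euc p) : 1 ≤ bracket ξ :=
  Real.one_le_sqrt.2 (by nlinarith [sq_nonneg ‖ξ‖])

theorem norm_le_bracket (ξ : Euc p) : ‖ξ‖ ≤ bracket ξ :=
  Real.le_sqrt_of_sq_le (by linarith)

theorem bracket_le_one_add_norm (ξ : Euc p) : bracket ξ ≤ 1 + ‖ξ‖ :=
  Real.sqrt_le_iff.2 ⟨by positivity, by nlinarith [norm_nonneg ξ]⟩

theorem bracket_le_mul_norm {ξ : Euc p} (h : 1 / 8 < ‖ξ‖) : bracket ξ ≤ 9 * ‖ξ‖ := by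
  have := bracket_le_one_add_norm ξ
  linarith

/-- Away from the origin `|ξ|` and `⟨ξ⟩` are comparable, so homogeneous weights can be exchanged for
symbol weights, whatever the sign of the exponent. -/
theorem exists_norm_rpow_le (s : ℝ) :
    ∃ D : ℝ, ∀ ξ : Euc p, 1 / 8 < ‖ξ‖ → ‖ξ‖ ^ s ≤ D * bracket ξ ^ s := by
  refine ⟨9 ^ |s|, fun ξ h => ?_⟩
  have h0 : 0 < ‖ξ‖ := by linarith
  have hb := one_le_bracket ξ
  rcases le_total 0 s with hs | hs
  · calc ‖ξ‖ ^ s ≤ bracket ξ ^ s := Real.rpow_le_rpow h0.le (norm_le_bracket ξ) hs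
      _ ≤ _ := le_mul_of_one_le_left (by positivity)
        (Real.one_le_rpow (by norm_num) (abs_nonneg s))
  · have h1 : (9 * ‖ξ‖) ^ s ≤ bracket ξ ^ s :=
      Real.rpow_le_rpow_of_nonpos (by linarith) (bracket_le_mul_norm h) hs
    rw [Real.mul_rpow (by norm_num) h0.le] at h1
    rw [abs_of_nonpos hs, Real.rpow_neg (by norm_num), ← div_eq_inv_mul,
      le_div_iff₀ (by positivity)]
    linarith

end Bracket

section Symbols

variable {n₁ n p : ℕ} {Ω₁ : TopologicalSpace.Opens (Euc n₁)} {Ω : TopologicalSpace.Opens (Euc n)}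

/-- The derivatives and weights of symbols of type `(ρ, δ)` over the compact set `K`, in the region
`R < |ξ|`. -/
def symFrame (ρ δ R : ℝ) (K : CompactIn (base Ω₁ Ω)) : Frame (Dir n₁ n p) (Var n₁ n p) where
  e := dirVec
  cost d := if isXi d then -ρ else δ
  b z := bracket z.2.2
  one_le_b _ := one_le_bracket _
  U := {z | z ∈ fullDomain p Ω₁ Ω ∧ R < ‖z.2.2‖}
  isOpen_U := (isOpen_fullDomain Ω₁ Ω).inter
    (isOpen_lt continuous_const (continuous_norm.comp (continuous_snd.comp continuous_snd)))
  S := {z | (z.1, z.2.1) ∈ K.1 ∧ R < ‖z.2.2‖}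
  S_subset _ hz := ⟨K.2.2 hz.1, hz.2⟩

theorem symFrame_cost_sum (ρ δ R : ℝ) (K : CompactIn (base Ω₁ Ω)) (l : List (Dir n₁ n p)) :
    (l.map (symFrame ρ δ R K).cost).sum = -ρ * xiOrder l + δ * xyOrder l := by
  induction l with
  | nil => simp [xiOrder, xyOrder]
  | cons d l ih =>
    rw [List.map_cons, List.sum_cons, ih]
    simp only [symFrame, xiOrder, xyOrder, List.countP_cons]
    cases isXi d <;> simp <;> ring

/-- The value `R = -1` imposes no condition on `ξ`; the value `R = 1/8` is the one used away from
the origin. -/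
theorem symFrame_U_neg_one (ρ δ : ℝ) (K : CompactIn (base Ω₁ Ω)) :
    (symFrame ρ δ (-1) K : Frame (Dir n₁ n p) (Var n₁ n p)).U = fullDomain p Ω₁ Ω := by
  ext z
  have : -1 < ‖z.2.2‖ := by linarith [norm_nonneg z.2.2]
  simp [symFrame, this]

variable {T : Type} {τ : T → Eps} {I : BoundIdeal τ} {K : CompactIn (base Ω₁ Ω)}
  {μ ρ δ : ℝ} {i : ℕ}

theorem NetBound.symFrame_mono {R ρ' δ' : ℝ} {f : T → Var n₁ n p → ℂ}
    (hf : NetBound (symFrame ρ δ R K) I μ i f) (hρ : ρ' ≤ ρ) (hδ : δ ≤ δ') :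
    NetBound (symFrame ρ' δ' R K) I μ i f := by
  refine hf.frame id (fun _ => rfl) (fun d => ?_) rfl subset_rfl subset_rfl
  simp only [symFrame, id]
  split <;> linarith

/-- Extension of symbol bounds by zero to small `ξ`. -/
theorem NetBound.glue {f : T → Var n₁ n p → ℂ} (hf : NetBound (symFrame ρ δ (1 / 8) K) I μ i f)
    (h0 : ∀ t z, ‖z.2.2‖ < 1 / 4 → f t z = 0) : NetBound (symFrame ρ δ (-1) K) I μ i f := by
  have hV : IsOpen {z : Var n₁ n p | ‖z.2.2‖ < 1 / 4} :=
    isOpen_lt (continuous_norm.comp (continuous_snd.comp continuous_snd)) continuous_const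
  refine ⟨fun t => ?_, fun l hl => ?_⟩
  · have h1 : ContDiffOn ℝ ∞ (f t) {z : Var n₁ n p | ‖z.2.2‖ < 1 / 4} :=
      contDiffOn_const.congr fun z hz => h0 t z hz
    -- The open regions `1/8 < |ξ|` and `|ξ| < 1/4` overlap and cover everything.
    refine ((hf.1 t).union_of_isOpen h1 (symFrame ρ δ (1 / 8) K).isOpen_U hV).mono fun z hz => ?_
    by_cases h : ‖z.2.2‖ < 1 / 4
    · exact Or.inr h
    · exact Or.inl ⟨hz.1, by linarith⟩
  · obtain ⟨C, hC, h⟩ := hf.2 l hl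
    refine ⟨_, I.abs_mem hC, fun t z hz => ?_⟩
    have hb := one_le_bracket z.2.2
    by_cases hz4 : ‖z.2.2‖ < 1 / 4
    · have := pderiv_eq_zero (e := dirVec) hV (h0 t) l hz4
      change ‖pderiv dirVec l (f t) z‖ ≤ |C t| * bracket z.2.2 ^ _
      rw [this, norm_zero]
      positivity
    · refine (h t z ⟨hz.1, by linarith⟩).trans
        (mul_le_mul_of_nonneg_right (le_abs_self _) ?_)
      change 0 ≤ bracket z.2.2 ^ _
      positivity

theorem PairBound.glue {f f' : T → Var n₁ n p → ℂ}
    (hf : PairBound (symFrame ρ δ (1 / 8) K) I μ i f f')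
    (h0 : ∀ t z, ‖z.2.2‖ < 1 / 4 → f t z = 0) (h0' : ∀ t z, ‖z.2.2‖ < 1 / 4 → f' t z = 0) :
    PairBound (symFrame ρ δ (-1) K) I μ i f f' :=
  ⟨hf.1.glue h0', hf.2.glue fun t z hz => by rw [h0 t z hz, h0' t z hz, sub_zero]⟩

theorem PairBound.symFrame_mono {R ρ' δ' : ℝ} {f f' : T → Var n₁ n p → ℂ}
    (hf : PairBound (symFrame ρ δ R K) I μ i f f') (hρ : ρ' ≤ ρ) (hδ : δ ≤ δ') :
    PairBound (symFrame ρ' δ' R K) I μ i f f' :=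
  ⟨hf.1.symFrame_mono hρ hδ, hf.2.symFrame_mono hρ hδ⟩

theorem WeightSystem.value_le_seminorm {J Z κ : Type} [NormedAddCommGroup Z] [NormedSpace ℝ Z]
    (s : WeightSystem J Z κ) (f : s.space) {k : κ} {i : ℕ} {l : List J} {z : Z} (hz : z ∈ s.S k)
    (hl : l.length ≤ i) (hr : (l.length : ℕ∞) ≤ s.r) :
    s.w l z * ‖pderiv s.e l f.1 z‖ ≤ s.seminorm (k, i) f :=
  le_ciSup (f.2.2 k i) ⟨(l, z), hz, hl, hr⟩

theorem netBound_symbol {m : ℝ} (a : T → SymbolSpace p Ω₁ Ω m ρ δ)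
    (h : (fun t => (symbolSystem p Ω₁ Ω m ρ δ).seminorm (K, i) (a t)) ∈ I.carrier) :
    NetBound (symFrame ρ δ (-1) K) I m i fun t => (a t).1 := by
  refine ⟨fun t => ?_, fun l hl => ⟨_, h, fun t z hz => ?_⟩⟩
  · rw [symFrame_U_neg_one]; exact (a t).2.1
  · have h1 := (symbolSystem p Ω₁ Ω m ρ δ).value_le_seminorm (a t) (k := K) hz.1 hl le_top
    have hb : 0 < bracket z.2.2 := by linarith [one_le_bracket z.2.2]
    rw [symFrame_cost_sum]
    change _ ≤ _ * bracket z.2.2 ^ _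
    simp only [symbolSystem] at h1
    rw [show m + (-ρ * (xiOrder l : ℝ) + δ * xyOrder l) =
      -(-m + ρ * xiOrder l - δ * xyOrder l) by ring, Real.rpow_neg hb.le,
      ← div_eq_mul_inv, le_div_iff₀ (Real.rpow_pos_of_pos hb _), mul_comm]
    exact h1

/-- For a function of `y` alone, a single direction outside the `y`-space kills the whole
derivative; otherwise the derivative is a derivative on `Ω`. -/
theorem exists_list_map_dirY_or (l : List (Dir n₁ n p)) :
    (∃ l' : List (Fin n), l = l'.map dirY) ∨
      ∃ d ∈ l, (dirVec d : Var n₁ n p).2.1 = 0 := by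
  induction l with
  | nil => exact Or.inl ⟨[], rfl⟩
  | cons d l ih =>
    rcases ih with ⟨l', rfl⟩ | ⟨d', hd', h⟩
    · rcases d with j | k | j
      · exact Or.inr ⟨_, List.mem_cons_self, rfl⟩
      · exact Or.inl ⟨k :: l', rfl⟩
      · exact Or.inr ⟨_, List.mem_cons_self, rfl⟩
    · exact Or.inr ⟨d', List.mem_cons_of_mem _ hd', h⟩

theorem netBound_comp_y {L : CompactIn (Ω : Set (Euc n))} (hKL : ∀ q ∈ K.1, q.2 ∈ L.1)
    (hδ : 0 ≤ δ) (u : T → CSpace ⊤ Ω)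
    (h : (fun t => (smoothSystem ⊤ Ω).seminorm (L, i) (u t)) ∈ I.carrier) :
    NetBound (symFrame ρ δ (-1) K) I 0 i fun t (z : Var n₁ n p) => (u t).1 z.2.1 := by
  let π : Var n₁ n p →L[ℝ] Euc n :=
    (ContinuousLinearMap.fst ℝ (Euc n) (Euc p)).comp (ContinuousLinearMap.snd ℝ (Euc n₁) _)
  refine ⟨fun t => ?_, fun l hl => ⟨_, h, fun t z hz => ?_⟩⟩
  · exact (u t).2.1.comp π.contDiff.contDiffOn fun z hz => hz.1.2
  · have hb : 1 ≤ bracket z.2.2 := one_le_bracket z.2.2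
    have h0 : 0 ≤ (smoothSystem ⊤ Ω).seminorm (L, i) (u t) := apply_nonneg _ _
    have h1 : pderiv dirVec l (fun z : Var n₁ n p => (u t).1 z.2.1) z =
        pderiv (fun d => π (dirVec d)) l (u t).1 (π z) :=
      pderiv_comp_clm π Ω.isOpen (u t).2.1 l (K.2.2 hz.1).2
    change ‖pderiv dirVec l (fun z : Var n₁ n p => (u t).1 z.2.1) z‖ ≤ _ * bracket z.2.2 ^ _
    rw [h1, symFrame_cost_sum]
    rcases exists_list_map_dirY_or l with ⟨l', rfl⟩ | ⟨d, hd, h⟩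
    · rw [← pderiv_map]
      have h2 := (smoothSystem ⊤ Ω).value_le_seminorm (u t) (k := L) (i := i) (l := l')
        (hKL _ hz.1) (by simpa using hl) le_top
      simp only [smoothSystem, one_mul] at h2
      -- Derivatives in `y` are allowed a growth of `⟨ξ⟩ ^ δ` each, but for `u` they cause none.
      refine le_trans h2 (le_mul_of_one_le_right h0 (Real.one_le_rpow hb ?_))
      have : xiOrder (l'.map dirY : List (Dir n₁ n p)) = 0 := by
        simp [xiOrder, isXi]
      rw [this]
      simp only [Nat.cast_zero, mul_zero, zero_add]
      positivity
    · rw [pderiv_eq_zero_of_mem (e := fun d => π (dirVec d)) hd h]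
      simp only [Pi.zero_apply, norm_zero]
      positivity

theorem exists_list_map_dirXi_or (l : List (Dir n₁ n p)) :
    (∃ l' : List (Fin p), l = l'.map dirXi) ∨
      ∃ d ∈ l, (dirVec d : Var n₁ n p).2.2 = 0 := by
  induction l with
  | nil => exact Or.inl ⟨[], rfl⟩
  | cons d l ih =>
    rcases ih with ⟨l', rfl⟩ | ⟨d', hd', h⟩
    · rcases d with j | k | j
      · exact Or.inr ⟨_, List.mem_cons_self, rfl⟩
      · exact Or.inr ⟨_, List.mem_cons_self, rfl⟩
      · exact Or.inl ⟨j :: l', rfl⟩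
    · exact Or.inr ⟨d', List.mem_cons_of_mem _ hd', h⟩

/-- The projection `(x, y, ξ) ↦ ξ`. -/
def projXi (n₁ n p : ℕ) : Var n₁ n p →L[ℝ] Euc p :=
  (ContinuousLinearMap.snd ℝ (Euc n) (Euc p)).comp (ContinuousLinearMap.snd ℝ (Euc n₁) _)

theorem exists_bound_pderiv {J Z : Type} [NormedAddCommGroup Z] [NormedSpace ℝ Z]
    [ProperSpace Z] (e : J → Z) (l : List J) {θ : Z → ℂ} (hθ : ContDiff ℝ ∞ θ) {R : ℝ}
    (h0 : ∀ ξ, R < ‖ξ‖ → θ ξ = 0) :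
    ∃ C : ℝ, 0 ≤ C ∧ (∀ ξ, ‖pderiv e l θ ξ‖ ≤ C) ∧ ∀ ξ, R < ‖ξ‖ → pderiv e l θ ξ = 0 := by
  have hV : IsOpen {ξ : Z | R < ‖ξ‖} := isOpen_lt continuous_const continuous_norm
  have hz : ∀ ξ, R < ‖ξ‖ → pderiv e l θ ξ = 0 := fun ξ hξ => pderiv_eq_zero hV h0 l hξ
  have hc : Continuous (pderiv e l θ) := by
    have := contDiffOn_infty_pderiv (e := e) isOpen_univ hθ.contDiffOn l
    exact (contDiffOn_univ.1 this).continuous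
  obtain ⟨C, hC⟩ := (isCompact_closedBall (0 : Z) R).exists_bound_of_continuousOn hc.continuousOn
  refine ⟨max C 0, le_max_right _ _, fun ξ => ?_, hz⟩
  by_cases h : R < ‖ξ‖
  · rw [hz ξ h]; simp
  · exact (hC ξ (by simpa using h)).trans (le_max_left _ _)

/-- Smooth compactly supported functions of `ξ` are symbols of any order. -/
theorem netBound_comp_xi {θ : Euc p → ℂ} (hθ : ContDiff ℝ ∞ θ) {R R' : ℝ}
    (h0 : ∀ ξ, R < ‖ξ‖ → θ ξ = 0) :
    NetBound (symFrame ρ δ R' K) (modIdeal τ) μ i fun _ (z : Var n₁ n p) => θ z.2.2 := by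
  refine ⟨fun t => (hθ.comp (projXi n₁ n p).contDiff).contDiffOn, fun l hl => ?_⟩
  obtain ⟨C, hC, h, hz0⟩ := exists_bound_pderiv (fun d => projXi n₁ n p (dirVec d)) l hθ h0
  set s := μ + (l.map (symFrame ρ δ R' K : Frame (Dir n₁ n p) (Var n₁ n p)).cost).sum
  refine ⟨_, const_mem_modIdeal (C * (1 + |R|) ^ |s|), fun t z hz => ?_⟩
  have h1 : pderiv dirVec l (fun z : Var n₁ n p => θ z.2.2) z = _ :=
    pderiv_comp_clm (projXi n₁ n p) isOpen_univ hθ.contDiffOn l (mem_univ _)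
  change ‖pderiv dirVec l (fun z : Var n₁ n p => θ z.2.2) z‖ ≤ _ * bracket z.2.2 ^ s
  have hb : 1 ≤ bracket z.2.2 := one_le_bracket z.2.2
  have hb0 : 0 < bracket z.2.2 := by linarith
  rw [h1]
  by_cases hR : R < ‖z.2.2‖
  · rw [show projXi n₁ n p z = z.2.2 from rfl, hz0 _ hR, norm_zero]
    positivity
  · have hbR : bracket z.2.2 ≤ 1 + |R| :=
      (bracket_le_one_add_norm _).trans (by linarith [le_abs_self R])
    refine (h _).trans ?_
    rw [mul_assoc]
    refine le_mul_of_one_le_right hC ?_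
    -- On the support `⟨ξ⟩ ≤ 1 + |R|`, so every power of `⟨ξ⟩` is bounded below there.
    calc (1 : ℝ) = bracket z.2.2 ^ |s| * bracket z.2.2 ^ (-|s|) := by
          rw [← Real.rpow_add hb0, add_neg_cancel, Real.rpow_zero]
      _ ≤ (1 + |R|) ^ |s| * bracket z.2.2 ^ s := by
          gcongr
          exact neg_abs_le s

/-- Dilations of a smooth compactly supported function of `ξ` are symbols of order `0`,
uniformly. -/
theorem netBound_dilation {θ : Euc p → ℂ} (hθ : ContDiff ℝ ∞ θ)
    (h0 : ∀ ξ, 1 / 2 < ‖ξ‖ → θ ξ = 0) (N : T → ℕ) (hρ : ρ ≤ 1) (hδ : 0 ≤ δ) :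
    NetBound (symFrame ρ δ (-1) K) (modIdeal τ) 0 i
      fun t (z : Var n₁ n p) => θ ((N t + 1 : ℝ)⁻¹ • z.2.2) := by
  -- Type `(1, 0)` is the strongest of those considered.
  suffices h : NetBound (symFrame 1 0 (-1) K) (modIdeal τ) 0 i
      fun t (z : Var n₁ n p) => θ ((N t + 1 : ℝ)⁻¹ • z.2.2) from h.symFrame_mono hρ hδ
  refine ⟨fun t => (hθ.comp
    ((N t + 1 : ℝ)⁻¹ • projXi n₁ n p).contDiff).contDiffOn, fun l hl => ?_⟩
  obtain ⟨C, hC, h, hz0⟩ := exists_bound_pderiv (fun d => projXi n₁ n p (dirVec d)) l hθ h0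
  refine ⟨_, const_mem_modIdeal (C * 2 ^ l.length), fun t z hz => ?_⟩
  set c : ℝ := (N t + 1 : ℝ)⁻¹
  have hc : 0 < c := by positivity
  have hscale : ∀ (l : List (Dir n₁ n p)) (ξ : Euc p),
      pderiv (fun d => (c • projXi n₁ n p) (dirVec d)) l θ ξ =
        c ^ l.length • pderiv (fun d => projXi n₁ n p (dirVec d)) l θ ξ := by
    intro l
    induction l with
    | nil => simp [pderiv]
    | cons d l ih =>
      intro ξ
      simp only [pderiv]
      rw [show pderiv (fun d => (c • projXi n₁ n p) (dirVec d)) l θ = _ from funext ih]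
      have hd := differentiableAt_of_contDiffOn isOpen_univ (contDiffOn_infty_pderiv
        (e := fun d => projXi n₁ n p (dirVec d)) isOpen_univ hθ.contDiffOn l) (mem_univ ξ)
      rw [fderiv_fun_const_smul hd]
      simp only [smul_apply, map_smul, List.length_cons]
      rw [smul_smul, pow_succ, mul_comm]
  have h1 : pderiv dirVec l (fun z : Var n₁ n p => θ (c • z.2.2)) z = _ :=
    pderiv_comp_clm (c • projXi n₁ n p) isOpen_univ hθ.contDiffOn l (mem_univ _)
  rw [hscale] at h1
  change ‖pderiv dirVec l (fun z : Var n₁ n p => θ (c • z.2.2)) z‖ ≤ _ * bracket z.2.2 ^ _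
  have hb : 1 ≤ bracket z.2.2 := one_le_bracket z.2.2
  have hb0 : 0 < bracket z.2.2 := by linarith
  have hpos : 0 ≤ C * 2 ^ l.length * bracket z.2.2 ^
      (0 + (l.map (symFrame 1 0 (-1) K : Frame (Dir n₁ n p) (Var n₁ n p)).cost).sum) := by
    positivity
  rw [h1]
  rcases exists_list_map_dirXi_or l with ⟨l', rfl⟩ | ⟨d, hd, h⟩
  · by_cases hR : 1 / 2 < ‖c • z.2.2‖
    · rw [show (c • projXi n₁ n p) z = c • z.2.2 from rfl, hz0 _ hR, smul_zero, norm_zero]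
      exact hpos
    · have h3 : c * ‖z.2.2‖ ≤ 1 / 2 := by
        rw [norm_smul, Real.norm_of_nonneg hc.le] at hR
        linarith
      have hc1 : c ≤ 1 := inv_le_one_of_one_le₀ (by linarith [(N t).cast_nonneg (α := ℝ)])
      -- On the support of the dilated function `c ⟨ξ⟩ ≤ c + c |ξ| ≤ 3/2`. Each `ξ`-derivative
      -- produces a factor `c`, hence gains `⟨ξ⟩⁻¹` with a constant independent of the dilation.
      have h4 : c ≤ 2 * (bracket z.2.2)⁻¹ := by
        rw [← div_eq_mul_inv, le_div_iff₀ hb0]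
        nlinarith [bracket_le_one_add_norm z.2.2]
      have h5 : xiOrder (l'.map dirXi : List (Dir n₁ n p)) = l'.length := by
        simp [xiOrder, isXi]
      have h6 : xyOrder (l'.map dirXi : List (Dir n₁ n p)) = 0 := by
        simp [xyOrder, isXi]
      rw [symFrame_cost_sum, h5, h6, norm_smul, Real.norm_of_nonneg (by positivity)]
      have h7 : bracket z.2.2 ^ (0 + (-1 * (l'.length : ℝ) + 0 * ((0 : ℕ) : ℝ))) =
          (bracket z.2.2)⁻¹ ^ l'.length := by
        rw [show (0 + (-1 * (l'.length : ℝ) + 0 * ((0 : ℕ) : ℝ))) = -(l'.length : ℝ) by simp,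
          Real.rpow_neg hb0.le, Real.rpow_natCast, inv_pow]
      rw [h7, List.length_map, mul_assoc, ← mul_pow, mul_comm]
      exact mul_le_mul (h _) (pow_le_pow_left₀ hc.le h4 _) (by positivity) hC
  · rw [pderiv_eq_zero_of_mem (e := fun d => projXi n₁ n p (dirVec d)) hd h]
    simpa using hpos

/-! ## Phase functions -/

/-- Bounds for a family of functions with seminorm bounds in `S^1_hg`, for `|ξ| > 1/8`. -/
theorem netBound_hg (φ : T → HgSpace p Ω₁ Ω)
    (h : (fun t => (hgSystem p Ω₁ Ω).seminorm (K, i) (φ t)) ∈ I.carrier) :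
    NetBound (symFrame 1 0 (1 / 8) K) I 1 i fun t => (φ t).1 := by
  have hne : ∀ z : Var n₁ n p, 1 / 8 < ‖z.2.2‖ → z.2.2 ≠ 0 := by
    intro z hz h
    rw [h, norm_zero] at hz
    norm_num at hz
  refine ⟨fun t => (φ t).2.1.mono fun z hz => ⟨hz.1, hne z hz.2⟩, fun l hl => ?_⟩
  obtain ⟨D, hD⟩ := exists_norm_rpow_le (p := p) (1 - xiOrder l)
  refine ⟨_, I.const_mul_mem D h, fun t z hz => ?_⟩
  have h1 := (hgSystem p Ω₁ Ω).value_le_seminorm (φ t) (k := K) ⟨hz.1, hne z hz.2⟩ hl le_top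
  have hξ : 0 < ‖z.2.2‖ := norm_pos_iff.2 (hne z hz.2)
  have h0 : 0 ≤ (hgSystem p Ω₁ Ω).seminorm (K, i) (φ t) := apply_nonneg _ _
  rw [symFrame_cost_sum]
  change _ ≤ _ * bracket z.2.2 ^ _
  simp only [hgSystem] at h1
  rw [show (1 : ℝ) + (-1 * (xiOrder l : ℝ) + 0 * xyOrder l) = 1 - xiOrder l by ring]
  rw [show (-1 : ℝ) + (xiOrder l : ℝ) = -(1 - xiOrder l) by ring, Real.rpow_neg hξ.le,
    ← div_eq_inv_mul, div_le_iff₀ (Real.rpow_pos_of_pos hξ _)] at h1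
  refine h1.trans ?_
  calc _ ≤ (hgSystem p Ω₁ Ω).seminorm (K, i) (φ t) * (D * bracket z.2.2 ^ (1 - xiOrder l : ℝ)) :=
        mul_le_mul_of_nonneg_left (hD _ hz.2) h0
    _ = _ := by ring

/-- The coordinates `ξ_j` are symbols of order `1`. -/
theorem netBound_coord (R : ℝ) (j : Fin p) :
    NetBound (symFrame 1 0 R K) (modIdeal τ) 1 i fun _ (z : Var n₁ n p) => ((z.2.2 j : ℝ) : ℂ) := by
  let π : Var n₁ n p →L[ℝ] ℂ :=
    Complex.ofRealCLM.comp ((EuclideanSpace.proj j).comp (projXi n₁ n p))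
  have hs : ∀ t : T, ContDiffOn ℝ ∞ (fun z : Var n₁ n p => ((z.2.2 j : ℝ) : ℂ))
      (symFrame 1 0 R K).U := fun t => π.contDiff.contDiffOn
  have hv : ∃ C ∈ (modIdeal τ).carrier, ∀ t, ∀ z ∈ (symFrame 1 0 R K).S,
      ‖((z.2.2 j : ℝ) : ℂ)‖ ≤ C t * (symFrame 1 0 R K : Frame (Dir n₁ n p) (Var n₁ n p)).b z ^
        (1 : ℝ) := by
    refine ⟨_, const_mem_modIdeal 1, fun t z hz => ?_⟩
    rw [one_mul, Real.rpow_one, Complex.norm_real]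
    exact (PiLp.norm_apply_le z.2.2 j).trans (norm_le_bracket _)
  cases i with
  | zero => exact NetBound.of_value hs hv
  | succ i =>
    refine NetBound.of_deriv hs hv fun d => ?_
    have h1 : pderiv dirVec [d] (fun z : Var n₁ n p => ((z.2.2 j : ℝ) : ℂ)) =
        fun _ => π (dirVec d) := by
      funext z
      exact congrArg (fun L => L (dirVec d)) (π.fderiv (x := z))
    change NetBound _ _ _ _ fun t => pderiv dirVec [d] (fun z : Var n₁ n p => ((z.2.2 j : ℝ) : ℂ))
    rw [h1]
    refine (NetBound.const _).mono ?_
    simp only [symFrame]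
    split <;> norm_num

theorem netBound_norm_sq (R : ℝ) :
    NetBound (symFrame 1 0 R K) (modIdeal τ) 2 i
      fun _ (z : Var n₁ n p) => ((‖z.2.2‖ ^ 2 : ℝ) : ℂ) := by
  refine ((NetBound.sum Finset.univ fun j _ =>
    (netBound_coord R j).mul (netBound_coord R j)).mono (by norm_num)).congr fun t z _ => ?_
  simp only [EuclideanSpace.norm_sq_eq, Real.norm_eq_abs, sq_abs]
  push_cast
  exact Finset.sum_congr rfl fun j _ => sq _

theorem ne_zero_of_far {z : Var n₁ n p} (hz : 1 / 8 < ‖z.2.2‖) : z.2.2 ≠ 0 := by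
  intro h
  rw [h, norm_zero] at hz
  norm_num at hz

theorem netBound_norm_sq_inv :
    NetBound (symFrame 1 0 (1 / 8) K) (modIdeal τ) (-2) i
      fun _ (z : Var n₁ n p) => ((‖z.2.2‖ ^ 2 : ℝ) : ℂ)⁻¹ := by
  refine NetBound.inv (fun i => netBound_norm_sq _) (fun t z hz => ?_) ?_ i
  · have := ne_zero_of_far hz.2
    simpa using this
  · obtain ⟨D, hD⟩ := exists_norm_rpow_le (p := p) (-2)
    refine ⟨_, const_mem_modIdeal D, fun t z hz => ?_⟩
    have := hD _ hz.2
    rw [Real.rpow_neg (norm_nonneg _)] at this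
    rw [norm_inv, Complex.norm_real, Real.norm_of_nonneg (by positivity)]
    change _ ≤ D * bracket z.2.2 ^ (-2 : ℝ)
    simpa using this

end Symbols

/-! ## Gradients of phase functions -/

section Phase

variable {n₁ n p : ℕ} {Ω₁ : TopologicalSpace.Opens (Euc n₁)} {Ω : TopologicalSpace.Opens (Euc n)}

theorem HgSpace.differentiableAt (φ : HgSpace p Ω₁ Ω) {z : Var n₁ n p}
    (hz : z ∈ fullDomain p Ω₁ Ω) (h0 : z.2.2 ≠ 0) : DifferentiableAt ℝ φ.1 z :=
  differentiableAt_of_contDiffOn (hgSystem p Ω₁ Ω).isOpen_U φ.2.1 ⟨hz, h0⟩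

theorem IsPhase.pderiv_im {φ : HgSpace p Ω₁ Ω} (hφ : IsPhase φ) {z : Var n₁ n p}
    (hz : z ∈ fullDomain p Ω₁ Ω) (h0 : z.2.2 ≠ 0) (d : Dir n₁ n p) :
    (pderiv dirVec [d] φ.1 z).im = 0 := by
  have hd := φ.differentiableAt hz h0
  have h1 : HasFDerivAt (fun z => (φ.1 z).im) (Complex.imCLM.comp (fderiv ℝ φ.1 z)) z :=
    Complex.imCLM.hasFDerivAt.comp z hd.hasFDerivAt
  have h2 : (fun z => (φ.1 z).im) =ᶠ[𝓝 z] fun _ => 0 :=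
    Filter.mem_of_superset ((isOpen_fullDomain Ω₁ Ω).mem_nhds hz) fun y hy => hφ.real y hy
  have h3 := h1.congr_of_eventuallyEq h2.symm
  have h4 := h3.unique (hasFDerivAt_const (0 : ℝ) z)
  exact congrArg (fun L => L (dirVec d)) h4

/-- The dilation of `ξ` by `t`. -/
def dilateXi (t : ℝ) : Var n₁ n p →L[ℝ] Var n₁ n p :=
  (ContinuousLinearMap.fst ℝ _ _).prod
    (((ContinuousLinearMap.fst ℝ _ _).comp (ContinuousLinearMap.snd ℝ _ _)).prod
      (t • (ContinuousLinearMap.snd ℝ _ _).comp (ContinuousLinearMap.snd ℝ _ _)))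

theorem dilateXi_apply (t : ℝ) (z : Var n₁ n p) : dilateXi t z = (z.1, z.2.1, t • z.2.2) := rfl

/-- Differentiate `φ(x, y, tξ) = t φ(x, y, ξ)`. It follows that `∂_ξ φ` is homogeneous of degree `0`
and `∂_y φ` of degree `1`. -/
theorem IsPhase.fderiv_dilate {φ : HgSpace p Ω₁ Ω} (hφ : IsPhase φ) {z : Var n₁ n p}
    (hz : z ∈ fullDomain p Ω₁ Ω) (h0 : z.2.2 ≠ 0) {t : ℝ} (ht : 0 < t) (v : Var n₁ n p) :
    fderiv ℝ φ.1 (dilateXi t z) (dilateXi t v) = t * fderiv ℝ φ.1 z v := by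
  have hd := φ.differentiableAt hz h0
  have hd' : DifferentiableAt ℝ φ.1 (dilateXi t z) :=
    φ.differentiableAt hz (smul_ne_zero ht.ne' h0)
  have h1 : HasFDerivAt (fun z => φ.1 (dilateXi t z))
      ((fderiv ℝ φ.1 (dilateXi t z)).comp (dilateXi t)) z :=
    hd'.hasFDerivAt.comp z (dilateXi t).hasFDerivAt
  have h2 : HasFDerivAt (fun z => t • φ.1 z) (t • fderiv ℝ φ.1 z) z :=
    hd.hasFDerivAt.const_smul t
  have h3 : (fun z => t • φ.1 z) =ᶠ[𝓝 z] fun z => φ.1 (dilateXi t z) :=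
    Filter.mem_of_superset ((isOpen_fullDomain Ω₁ Ω).mem_nhds hz) fun y hy =>
      Complex.real_smul.trans (hφ.homogeneous y.1 hy.1 y.2.1 hy.2 y.2.2 t ht).symm
  have h4 := (h1.congr_of_eventuallyEq h3).unique h2
  simpa using congrArg (fun L => L v) h4

theorem IsPhase.pderiv_xi_dilate {φ : HgSpace p Ω₁ Ω} (hφ : IsPhase φ) {z : Var n₁ n p}
    (hz : z ∈ fullDomain p Ω₁ Ω) (h0 : z.2.2 ≠ 0) {t : ℝ} (ht : 0 < t) (j : Fin p) :
    pderiv dirVec [dirXi j] φ.1 (dilateXi t z) = pderiv dirVec [dirXi j] φ.1 z := by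
  have h := hφ.fderiv_dilate hz h0 ht (dirVec (dirXi j))
  have e : (dilateXi t (dirVec (dirXi j)) : Var n₁ n p) = t • dirVec (dirXi j) := by
    simp [dilateXi_apply, dirVec]
  rw [e, map_smul, Complex.real_smul] at h
  exact mul_left_cancel₀ (Complex.ofReal_ne_zero.2 ht.ne') h

theorem IsPhase.pderiv_y_dilate {φ : HgSpace p Ω₁ Ω} (hφ : IsPhase φ) {z : Var n₁ n p}
    (hz : z ∈ fullDomain p Ω₁ Ω) (h0 : z.2.2 ≠ 0) {t : ℝ} (ht : 0 < t) (k : Fin n) :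
    pderiv dirVec [dirY k] φ.1 (dilateXi t z) = t * pderiv dirVec [dirY k] φ.1 z := by
  have h := hφ.fderiv_dilate hz h0 ht (dirVec (dirY k))
  have e : (dilateXi t (dirVec (dirY k)) : Var n₁ n p) = dirVec (dirY k) := by
    simp [dilateXi_apply, dirVec]
  rwa [e] at h

/-- `|∇_{y,ξ} φ(x, y, ξ / |ξ|)|²`, for real valued `φ` of degree `1`, as a polynomial in the
derivatives of `φ`. -/
def gradC (φ : Var n₁ n p → ℂ) (z : Var n₁ n p) : ℂ :=
  ∑ j : Fin p, pderiv dirVec [dirXi j] φ z * pderiv dirVec [dirXi j] φ z +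
    ((‖z.2.2‖ ^ 2 : ℝ) : ℂ)⁻¹ *
      ∑ k : Fin n, pderiv dirVec [dirY k] φ z * pderiv dirVec [dirY k] φ z

theorem mul_self_of_im_eq_zero {w : ℂ} (h : w.im = 0) : w * w = ((‖w‖ ^ 2 : ℝ) : ℂ) := by
  rw [← Complex.normSq_eq_norm_sq, Complex.normSq_apply, h]
  apply Complex.ext <;> simp [h]

/-- Homogeneity removes the normalisation `ξ / |ξ|`, and realness turns squared norms into squares.
The result is built from derivatives of `φ` and `|ξ|⁻²` by sums and products, so the symbol calculus
applies to it. -/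
theorem IsPhase.gradC_eq {φ : HgSpace p Ω₁ Ω} (hφ : IsPhase φ) {z : Var n₁ n p}
    (hz : z ∈ fullDomain p Ω₁ Ω) (h0 : z.2.2 ≠ 0) :
    gradC φ.1 z = (gradSq φ.1 (toSphere z) : ℂ) := by
  have ht : 0 < ‖z.2.2‖⁻¹ := inv_pos.2 (norm_pos_iff.2 h0)
  have e : toSphere z = dilateXi ‖z.2.2‖⁻¹ z := rfl
  simp only [gradC, gradSq, e, hφ.pderiv_xi_dilate hz h0 ht, hφ.pderiv_y_dilate hz h0 ht,
    mul_self_of_im_eq_zero (hφ.pderiv_im hz h0 _), Finset.mul_sum]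
  push_cast
  congr 1
  refine Finset.sum_congr rfl fun k _ => ?_
  simp [mul_pow]

theorem IsPhase.gradSq_toSphere_ne_zero {φ : HgSpace p Ω₁ Ω} (hφ : IsPhase φ) {z : Var n₁ n p}
    (hz : z ∈ fullDomain p Ω₁ Ω) (h0 : z.2.2 ≠ 0) : gradSq φ.1 (toSphere z) ≠ 0 :=
  hφ.gradient _ hz (smul_ne_zero (inv_ne_zero (norm_ne_zero_iff.2 h0)) h0)

theorem gradSq_nonneg (φ : Var n₁ n p → ℂ) (z : Var n₁ n p) : 0 ≤ gradSq φ z := by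
  unfold gradSq
  positivity

theorem IsCutoff.coeffA_eq_zero {χ : Euc p → ℂ} (hχ : IsCutoff χ) (φ : Var n₁ n p → ℂ) (j : Fin p)
    {z : Var n₁ n p} (hz : ‖z.2.2‖ < 1 / 4) : coeffA χ φ j z = 0 := by
  simp [coeffA, hχ.eq_one _ hz]

theorem IsCutoff.coeffB_eq_zero {χ : Euc p → ℂ} (hχ : IsCutoff χ) (φ : Var n₁ n p → ℂ) (k : Fin n)
    {z : Var n₁ n p} (hz : ‖z.2.2‖ < 1 / 4) : coeffB χ φ k z = 0 := by
  simp [coeffB, hχ.eq_one _ hz]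

theorem isOpen_near : IsOpen {z : Var n₁ n p | ‖z.2.2‖ < 1 / 4} :=
  isOpen_lt (continuous_norm.comp (continuous_snd.comp continuous_snd)) continuous_const

end Phase

/-! ## Symbol bounds for the coefficients of `L_φ` -/

section Coefficients

variable {n₁ n p : ℕ} {Ω₁ : TopologicalSpace.Opens (Euc n₁)} {Ω : TopologicalSpace.Opens (Euc n)}
  {T : Type} {τ : T → Eps} {I : BoundIdeal τ} {K : CompactIn (base Ω₁ Ω)}
  {μ ρ δ : ℝ} {i : ℕ}

variable (τ K) in
/-- A family of phase functions that is moderate and strictly nonzero over `K`. -/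
structure PhaseFamily (φ : T → HgSpace p Ω₁ Ω) : Prop where
  isPhase : ∀ t, IsPhase (φ t)
  bound : ∀ i, (fun t => (hgSystem p Ω₁ Ω).seminorm (K, i) (φ t)) ∈ (modIdeal τ).carrier
  grad : ∃ C ∈ (modIdeal τ).carrier, ∀ t, ∀ z : Var n₁ n p, (z.1, z.2.1) ∈ K.1 → z.2.2 ≠ 0 →
    (gradSq (φ t).1 (toSphere z))⁻¹ ≤ C t

variable (I K) in
/-- Two families of phase functions, the difference of which is bounded by `I`. -/
structure PhasePair (φ φ' : T → HgSpace p Ω₁ Ω) : Prop where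
  left : PhaseFamily τ K φ
  right : PhaseFamily τ K φ'
  diff : ∀ i, (fun t => (hgSystem p Ω₁ Ω).seminorm (K, i) (φ t - φ' t)) ∈ I.carrier

variable {φ φ' : T → HgSpace p Ω₁ Ω}

theorem PhaseFamily.refl (h : PhaseFamily τ K φ) (I : BoundIdeal τ) : PhasePair I K φ φ :=
  ⟨h, h, fun i => by simpa using I.zero_mem⟩

theorem PhaseFamily.net (h : PhaseFamily τ K φ) :
    NetBound (symFrame 1 0 (1 / 8) K) (modIdeal τ) 1 i fun t => (φ t).1 :=
  netBound_hg φ (h.bound i)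

theorem PhasePair.pair (h : PhasePair I K φ φ') :
    PairBound (symFrame 1 0 (1 / 8) K) I 1 i (fun t => (φ t).1) fun t => (φ' t).1 :=
  ⟨h.right.net, netBound_hg (fun t => φ t - φ' t) (h.diff i)⟩

theorem PhasePair.pair_xi (h : PhasePair I K φ φ') (j : Fin p) :
    PairBound (symFrame 1 0 (1 / 8) K) I 0 i (fun t => pderiv dirVec [dirXi j] (φ t).1)
      fun t => pderiv dirVec [dirXi j] (φ' t).1 :=
  (h.pair.deriv (dirXi j)).mono (by simp [symFrame, isXi])

theorem PhasePair.pair_y (h : PhasePair I K φ φ') (k : Fin n) :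
    PairBound (symFrame 1 0 (1 / 8) K) I 1 i (fun t => pderiv dirVec [dirY k] (φ t).1)
      fun t => pderiv dirVec [dirY k] (φ' t).1 :=
  (h.pair.deriv (dirY k)).mono (by simp [symFrame, isXi])

theorem PhaseFamily.net_xi (h : PhaseFamily τ K φ) (j : Fin p) :
    NetBound (symFrame 1 0 (1 / 8) K) (modIdeal τ) 0 i fun t => pderiv dirVec [dirXi j] (φ t).1 :=
  ((h.refl (modIdeal τ)).pair_xi j).1

theorem PhaseFamily.net_y (h : PhaseFamily τ K φ) (k : Fin n) :
    NetBound (symFrame 1 0 (1 / 8) K) (modIdeal τ) 1 i fun t => pderiv dirVec [dirY k] (φ t).1 :=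
  ((h.refl (modIdeal τ)).pair_y k).1

theorem PhasePair.pair_gradC (h : PhasePair I K φ φ') :
    PairBound (symFrame 1 0 (1 / 8) K) I 0 i (fun t => gradC (φ t).1) fun t => gradC (φ' t).1 := by
  have h1 := PairBound.sum Finset.univ fun j _ =>
    PairBound.mul (i := i) (h.left.net_xi j) (h.pair_xi j) (h.pair_xi j)
  have h2 := PairBound.sum Finset.univ fun k _ =>
    PairBound.mul (i := i) (h.left.net_y k) (h.pair_y k) (h.pair_y k)
  exact (h1.mono (by norm_num)).add ((PairBound.mul netBound_norm_sq_inv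
    (PairBound.refl netBound_norm_sq_inv) h2).mono (by norm_num))

theorem PhaseFamily.gradC_ne_zero (h : PhaseFamily τ K φ) (t : T) {z : Var n₁ n p}
    (hz : z ∈ (symFrame 1 0 (1 / 8) K).U) : gradC (φ t).1 z ≠ 0 := by
  rw [(h.isPhase t).gradC_eq hz.1 (ne_zero_of_far hz.2)]
  exact_mod_cast (h.isPhase t).gradSq_toSphere_ne_zero hz.1 (ne_zero_of_far hz.2)

/-- This is where the strict nonvanishing of the gradient enters: a moderate bound on the inverse
gradient gives symbol bounds of order `0` on the inverse with all its derivatives. -/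
theorem PhaseFamily.net_gradC_inv (h : PhaseFamily τ K φ) :
    NetBound (symFrame 1 0 (1 / 8) K) (modIdeal τ) (-0) i fun t z => (gradC (φ t).1 z)⁻¹ := by
  refine NetBound.inv (fun i => (h.refl (modIdeal τ)).pair_gradC.1)
    (fun t z hz => h.gradC_ne_zero t hz) ?_ i
  obtain ⟨C, hC, h1⟩ := h.grad
  refine ⟨C, hC, fun t z hz => ?_⟩
  rw [neg_zero, Real.rpow_zero, mul_one, norm_inv,
    (h.isPhase t).gradC_eq (K.2.2 hz.1) (ne_zero_of_far hz.2), Complex.norm_real,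
    Real.norm_of_nonneg (gradSq_nonneg _ _)]
  exact h1 t z hz.1 (ne_zero_of_far hz.2)

theorem PhasePair.pair_gradC_inv (h : PhasePair I K φ φ') :
    PairBound (symFrame 1 0 (1 / 8) K) I 0 i (fun t z => (gradC (φ t).1 z)⁻¹)
      fun t z => (gradC (φ' t).1 z)⁻¹ := by
  have := PairBound.inv (i := i) h.left.net_gradC_inv h.right.net_gradC_inv h.pair_gradC
    (fun t z hz => h.left.gradC_ne_zero t hz) (fun t z hz => h.right.gradC_ne_zero t hz)
  simpa using this

variable {χ : Euc p → ℂ}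

theorem IsCutoff.net_one_sub (hχ : IsCutoff χ) :
    NetBound (symFrame 1 0 (1 / 8) K) (modIdeal τ) 0 i
      fun _ (z : Var n₁ n p) => Complex.I * (1 - χ z.2.2) :=
  ((NetBound.const 1).sub (netBound_comp_xi hχ.smooth hχ.eq_zero)).const_mul Complex.I

theorem PhasePair.pair_coeffA_far (h : PhasePair I K φ φ') (hχ : IsCutoff χ) (j : Fin p) :
    PairBound (symFrame 1 0 (1 / 8) K) I 0 i (fun t => coeffA χ (φ t).1 j)
      fun t => coeffA χ (φ' t).1 j := by
  have h1 := PairBound.mul (i := i) (hχ.net_one_sub.mul ((h.left.net_gradC_inv).mono (by simp)))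
    (PairBound.mul hχ.net_one_sub (PairBound.refl hχ.net_one_sub) h.pair_gradC_inv) (h.pair_xi j)
  refine (h1.mono (by norm_num)).congr (fun t z hz => ?_) fun t z hz => ?_
  · simp only [coeffA, (h.left.isPhase t).gradC_eq hz.1 (ne_zero_of_far hz.2)]
    push_cast; ring
  · simp only [coeffA, (h.right.isPhase t).gradC_eq hz.1 (ne_zero_of_far hz.2)]
    push_cast; ring

theorem PhasePair.pair_coeffB_far (h : PhasePair I K φ φ') (hχ : IsCutoff χ) (k : Fin n) :
    PairBound (symFrame 1 0 (1 / 8) K) I (-1) i (fun t => coeffB χ (φ t).1 k)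
      fun t => coeffB χ (φ' t).1 k := by
  have h0 := (hχ.net_one_sub (n₁ := n₁) (n := n) (τ := τ) (K := K) (i := i)).mul
    netBound_norm_sq_inv
  have h1 := PairBound.mul (i := i) (h0.mul ((h.left.net_gradC_inv).mono (by simp)))
    (PairBound.mul h0 (PairBound.refl h0) h.pair_gradC_inv) (h.pair_y k)
  refine (h1.mono (by norm_num)).congr (fun t z hz => ?_) fun t z hz => ?_
  · simp only [coeffB, (h.left.isPhase t).gradC_eq hz.1 (ne_zero_of_far hz.2)]
    push_cast; ring
  · simp only [coeffB, (h.right.isPhase t).gradC_eq hz.1 (ne_zero_of_far hz.2)]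
    push_cast; ring

/-- The estimates hold for `|ξ| > 1/8`, where `φ` is smooth; the factor `1 - χ` vanishes for `|ξ| <
1/4`, so extension by zero is harmless. -/
theorem PhasePair.pair_coeffA (h : PhasePair I K φ φ') (hχ : IsCutoff χ) (hρ : ρ ≤ 1) (hδ : 0 ≤ δ)
    (j : Fin p) :
    PairBound (symFrame ρ δ (-1) K) I 0 i (fun t => coeffA χ (φ t).1 j)
      fun t => coeffA χ (φ' t).1 j :=
  ((h.pair_coeffA_far hχ j).symFrame_mono hρ hδ).glue
    (fun t _ hz => hχ.coeffA_eq_zero (φ t).1 j hz) fun t _ hz => hχ.coeffA_eq_zero (φ' t).1 j hz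

theorem PhasePair.pair_coeffB (h : PhasePair I K φ φ') (hχ : IsCutoff χ) (hρ : ρ ≤ 1) (hδ : 0 ≤ δ)
    (k : Fin n) :
    PairBound (symFrame ρ δ (-1) K) I (-1) i (fun t => coeffB χ (φ t).1 k)
      fun t => coeffB χ (φ' t).1 k :=
  ((h.pair_coeffB_far hχ k).symFrame_mono hρ hδ).glue
    (fun t _ hz => hχ.coeffB_eq_zero (φ t).1 k hz) fun t _ hz => hχ.coeffB_eq_zero (φ' t).1 k hz

/-- The compactly supported `χ` has any order. The divergence terms are differentiated while the
type is still `(1, 0)`: a `ξ`-derivative lowers order `0` to `-1`, and a `y`-derivative preserves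
order `-1`. -/
theorem PhasePair.pair_coeffC (h : PhasePair I K φ φ') (hχ : IsCutoff χ) (hρ : ρ ≤ 1) (hδ : 0 ≤ δ) :
    PairBound (symFrame ρ δ (-1) K) I (-1) i (fun t => coeffC χ (φ t).1)
      fun t => coeffC χ (φ' t).1 := by
  have h1 : PairBound (symFrame ρ δ (-1) K) I (-1) i (fun _ (z : Var n₁ n p) => χ z.2.2)
      fun _ z => χ z.2.2 := PairBound.refl (netBound_comp_xi hχ.smooth hχ.eq_zero)
  have hA : ∀ (ψ : Var n₁ n p → ℂ) (j : Fin p) (z : Var n₁ n p), ‖z.2.2‖ < 1 / 4 →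
      pderiv dirVec [dirXi j] (coeffA χ ψ j) z = 0 := fun ψ j z hz =>
    pderiv_eq_zero isOpen_near (fun _ h => hχ.coeffA_eq_zero ψ j h) _ hz
  have hB : ∀ (ψ : Var n₁ n p → ℂ) (k : Fin n) (z : Var n₁ n p), ‖z.2.2‖ < 1 / 4 →
      pderiv dirVec [dirY k] (coeffB χ ψ k) z = 0 := fun ψ k z hz =>
    pderiv_eq_zero isOpen_near (fun _ h => hχ.coeffB_eq_zero ψ k h) _ hz
  refine (h1.add (PairBound.sum Finset.univ fun j _ => ?_)).add
    (PairBound.sum Finset.univ fun k _ => ?_)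
  · have h2 := ((h.pair_coeffA_far (i := i + 1) hχ j).deriv (dirXi j)).mono (ν := -1)
      (by simp [symFrame, isXi])
    exact (h2.symFrame_mono hρ hδ).glue (fun t z hz => hA _ j z hz) fun t z hz => hA _ j z hz
  · have h2 := ((h.pair_coeffB_far (i := i + 1) hχ k).deriv (dirY k)).mono (ν := -1)
      (by simp [symFrame, isXi])
    exact (h2.symFrame_mono hρ hδ).glue (fun t z hz => hB _ k z hz) fun t z hz => hB _ k z hz

/-- `L_φ` lowers the order by `s = min ρ (1 - δ)`. -/
theorem PhasePair.pair_opL (h : PhasePair I K φ φ') (hχ : IsCutoff χ) (hρ : ρ ≤ 1) (hδ : 0 ≤ δ)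
    {g g' : T → Var n₁ n p → ℂ} (hg : PairBound (symFrame ρ δ (-1) K) I μ (i + 1) g g') :
    PairBound (symFrame ρ δ (-1) K) I (μ - min ρ (1 - δ)) i (fun t => opL χ (φ t).1 (g t))
      fun t => opL χ (φ' t).1 (g' t) := by
  have hs1 : min ρ (1 - δ) ≤ ρ := min_le_left _ _
  have hs2 : min ρ (1 - δ) ≤ 1 - δ := min_le_right _ _
  have hl := h.left.refl (modIdeal τ)
  -- The three kinds of terms change the order by `-ρ`, by `-1 + δ` and by `-1`; none of these
  -- exceeds `-s`, the last because `s ≤ ρ ≤ 1`.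
  refine ((PairBound.sum Finset.univ fun j _ => ?_).add
    (PairBound.sum Finset.univ fun k _ => ?_)).add ?_
  · refine (PairBound.mul (hl.pair_coeffA hχ hρ hδ j).1 (h.pair_coeffA hχ hρ hδ j)
      (hg.deriv (dirXi j))).mono ?_
    simp [symFrame, isXi]; linarith
  · refine (PairBound.mul (hl.pair_coeffB hχ hρ hδ k).1 (h.pair_coeffB hχ hρ hδ k)
      (hg.deriv (dirY k))).mono ?_
    simp only [symFrame, isXi]
    norm_num; linarith
  · exact (PairBound.mul (hl.pair_coeffC hχ hρ hδ).1 (h.pair_coeffC hχ hρ hδ)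
      (hg.of_le i.le_succ)).mono (by linarith)

theorem PhasePair.pair_opL_iterate (h : PhasePair I K φ φ') (hχ : IsCutoff χ) (hρ : ρ ≤ 1)
    (hδ : 0 ≤ δ) (k : ℕ) {g g' : T → Var n₁ n p → ℂ}
    (hg : PairBound (symFrame ρ δ (-1) K) I μ (i + k) g g') :
    PairBound (symFrame ρ δ (-1) K) I (μ - k * min ρ (1 - δ)) i
      (fun t => (opL χ (φ t).1)^[k] (g t)) fun t => (opL χ (φ' t).1)^[k] (g' t) := by
  induction k generalizing i with
  | zero => simpa using hg
  | succ k ih =>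
    simp only [Function.iterate_succ_apply']
    refine (h.pair_opL hχ hρ hδ (ih (i := i + 1) (by rwa [add_right_comm]))).mono ?_
    push_cast; linarith

end Coefficients

/-! ## Derivatives in `x` and oscillating factors -/

section Oscillation

variable {n₁ n p : ℕ} {Ω₁ : TopologicalSpace.Opens (Euc n₁)} {Ω : TopologicalSpace.Opens (Euc n)}
  {T : Type} {τ : T → Eps} {I : BoundIdeal τ} {K : CompactIn (base Ω₁ Ω)}
  {μ ρ δ : ℝ} {i : ℕ}

variable (p) in
/-- The region in which phase functions are smooth. For `p = 0` they vanish identically. -/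
def regular : Set (Euc p) := {ξ | ξ ≠ 0 ∨ p = 0}

theorem isOpen_regular : IsOpen (regular p) :=
  isOpen_ne.union isOpen_const

/-- The derivatives in the `x`-directions, each of which costs `c`. -/
def xFrame (c : ℝ) (K : CompactIn (base Ω₁ Ω)) : Frame (Fin n₁) (Var n₁ n p) where
  e i := dirVec (.inl i)
  cost _ := c
  b z := bracket z.2.2
  one_le_b _ := one_le_bracket _
  U := {z | z ∈ fullDomain p Ω₁ Ω ∧ z.2.2 ∈ regular p}
  isOpen_U := (isOpen_fullDomain Ω₁ Ω).inter
    (isOpen_regular.preimage (continuous_snd.comp continuous_snd))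
  S := {z | (z.1, z.2.1) ∈ K.1 ∧ z.2.2 ∈ regular p}
  S_subset _ hz := ⟨K.2.2 hz.1, hz.2⟩

theorem xFrame_cost_sum (c : ℝ) (l : List (Fin n₁)) :
    (l.map (xFrame c K : Frame (Fin n₁) (Var n₁ n p)).cost).sum = l.length * c := by
  simp [xFrame]

theorem NetBound.to_xFrame {f : T → Var n₁ n p → ℂ}
    (hf : NetBound (symFrame ρ δ (-1) K) I μ i f) (hδ : δ ≤ 1) : NetBound (xFrame 1 K) I μ i f := by
  refine hf.frame Sum.inl (fun _ => rfl) (fun d => ?_) rfl (fun z hz => ⟨hz.1, ?_⟩)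
    (fun z hz => ⟨hz.1, ?_⟩)
  · simpa [symFrame, isXi, xFrame] using hδ
  all_goals linarith [norm_nonneg z.2.2]

theorem NetBound.xFrame_mono {c c' : ℝ} {f : T → Var n₁ n p → ℂ}
    (hf : NetBound (xFrame c K) I μ i f) (h : c ≤ c') : NetBound (xFrame c' K) I μ i f :=
  hf.frame id (fun _ => rfl) (fun _ => h) rfl subset_rfl subset_rfl

/-- In contrast to derivatives in `ξ`, derivatives in `x` come with the weight `|ξ|⁻¹` only, and
`|ξ| ≤ ⟨ξ⟩` holds up to the origin, so no region around it has to be removed. For `p = 0` the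
seminorms carry no information, whence the extra assumption. -/
theorem netBound_hg_x (φ : T → HgSpace p Ω₁ Ω)
    (h0 : p = 0 → ∀ t, ∀ z ∈ fullDomain p Ω₁ Ω, (φ t).1 z = 0)
    (h : (fun t => (hgSystem p Ω₁ Ω).seminorm (K, i) (φ t)) ∈ I.carrier) :
    NetBound (xFrame 0 K) I 1 i fun t => (φ t).1 := by
  by_cases hp : p = 0
  · exact NetBound.zero.congr fun t z hz => h0 hp t z hz.1
  have hreg : ∀ ξ ∈ regular p, ξ ≠ 0 := fun ξ hξ => hξ.resolve_right hp
  refine ⟨fun t => (φ t).2.1.mono fun z hz => ⟨hz.1, hreg _ hz.2⟩, fun l hl =>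
    ⟨_, h, fun t z hz => ?_⟩⟩
  have h1 := (hgSystem p Ω₁ Ω).value_le_seminorm (φ t) (k := K) (i := i)
    (l := l.map Sum.inl) ⟨hz.1, hreg _ hz.2⟩ (by simpa using hl) le_top
  have hξ : 0 < ‖z.2.2‖ := norm_pos_iff.2 (hreg _ hz.2)
  have h2 : xiOrder (l.map Sum.inl : List (Dir n₁ n p)) = 0 := by simp [xiOrder, isXi]
  have h3 : 0 ≤ (hgSystem p Ω₁ Ω).seminorm (K, i) (φ t) := apply_nonneg _ _
  simp only [hgSystem, h2, Nat.cast_zero, add_zero] at h1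
  rw [Real.rpow_neg hξ.le, Real.rpow_one, ← div_eq_inv_mul, div_le_iff₀ hξ] at h1
  rw [xFrame_cost_sum, mul_zero, add_zero, Real.rpow_one]
  change ‖pderiv (fun i => dirVec (.inl i)) l (φ t).1 z‖ ≤ _ * bracket z.2.2
  rw [pderiv_map]
  exact h1.trans (mul_le_mul_of_nonneg_left (norm_le_bracket _) h3)

theorem IsPhase.eq_zero_of_dim_eq_zero {φ : HgSpace p Ω₁ Ω} (hφ : IsPhase φ) (hp : p = 0)
    {z : Var n₁ n p} (hz : z ∈ fullDomain p Ω₁ Ω) : φ.1 z = 0 := by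
  subst hp
  have h := hφ.homogeneous z.1 hz.1 z.2.1 hz.2 z.2.2 2 two_pos
  rw [Subsingleton.elim ((2 : ℝ) • z.2.2) z.2.2] at h
  change φ.1 z = ((2 : ℝ) : ℂ) * φ.1 z at h
  push_cast at h
  linear_combination -h

theorem pderiv_single_exp {J Z : Type} [NormedAddCommGroup Z] [NormedSpace ℝ Z] {e : J → Z}
    {f : Z → ℂ} {z : Z} (hf : DifferentiableAt ℝ f z) (j : J) :
    pderiv e [j] (fun z => Complex.exp (Complex.I * f z)) z =
      Complex.I * pderiv e [j] f z * Complex.exp (Complex.I * f z) := by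
  have h := ((hf.hasFDerivAt.const_mul Complex.I).cexp).fderiv
  simp only [pderiv]
  rw [h]
  simp only [smul_apply, smul_eq_mul]
  ring

theorem IsPhase.norm_exp {φ : HgSpace p Ω₁ Ω} (hφ : IsPhase φ) {z : Var n₁ n p}
    (hz : z ∈ fullDomain p Ω₁ Ω) : ‖Complex.exp (Complex.I * φ.1 z)‖ = 1 := by
  have h : φ.1 z = ((φ.1 z).re : ℂ) := Complex.ext rfl (by simp [hφ.real z hz])
  rw [h, Complex.norm_exp_I_mul_ofReal]

theorem IsPhase.norm_exp_sub_le {φ ψ : HgSpace p Ω₁ Ω} (hφ : IsPhase φ) (hψ : IsPhase ψ)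
    {z : Var n₁ n p} (hz : z ∈ fullDomain p Ω₁ Ω) :
    ‖Complex.exp (Complex.I * φ.1 z) - Complex.exp (Complex.I * ψ.1 z)‖ ≤ ‖φ.1 z - ψ.1 z‖ := by
  have h : φ.1 z - ψ.1 z = (((φ.1 z - ψ.1 z).re : ℝ) : ℂ) :=
    Complex.ext rfl (by simp [hφ.real z hz, hψ.real z hz])
  have e : Complex.exp (Complex.I * φ.1 z) - Complex.exp (Complex.I * ψ.1 z) =
      Complex.exp (Complex.I * ψ.1 z) * (Complex.exp (Complex.I * (φ.1 z - ψ.1 z)) - 1) := by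
    rw [mul_sub, ← Complex.exp_add]
    congr 2 <;> ring_nf
  rw [e, norm_mul, hψ.norm_exp hz, one_mul, h, Complex.norm_real]
  exact Real.norm_exp_I_mul_ofReal_sub_one_le

variable {φ φ' : T → HgSpace p Ω₁ Ω}

theorem PhasePair.pair_x (h : PhasePair I K φ φ') :
    PairBound (xFrame 0 K) I 1 i (fun t => (φ t).1) fun t => (φ' t).1 := by
  refine ⟨netBound_hg_x φ' (fun hp t z hz => (h.right.isPhase t).eq_zero_of_dim_eq_zero hp hz)
    (h.right.bound i), netBound_hg_x (fun t => φ t - φ' t) (fun hp t z hz => ?_) (h.diff i)⟩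
  change (φ t).1 z - (φ' t).1 z = 0
  rw [(h.right.isPhase t).eq_zero_of_dim_eq_zero hp hz,
    (h.left.isPhase t).eq_zero_of_dim_eq_zero hp hz, sub_zero]

/-- The exponential has modulus `1`, and each derivative in `x` brings down a factor `i ∂_x φ` of
order `1`; this is the cost `1` in the frame. -/
theorem PhaseFamily.net_exp (h : PhaseFamily τ K φ) :
    NetBound (xFrame 1 K) (modIdeal τ) 0 i fun t z => Complex.exp (Complex.I * (φ t).1 z) := by
  have hphi := fun i => ((h.refl (modIdeal τ)).pair_x (i := i)).1
  have hs : ∀ t, ContDiffOn ℝ ∞ (fun z => Complex.exp (Complex.I * (φ t).1 z))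
      (xFrame 1 K).U := fun t => (contDiffOn_const.mul ((hphi 0).1 t)).cexp
  have hv : ∃ C ∈ (modIdeal τ).carrier, ∀ t, ∀ z ∈ (xFrame 1 K).S,
      ‖Complex.exp (Complex.I * (φ t).1 z)‖ ≤
        C t * (xFrame 1 K : Frame (Fin n₁) (Var n₁ n p)).b z ^ (0 : ℝ) := by
    refine ⟨_, const_mem_modIdeal 1, fun t z hz => ?_⟩
    rw [(h.isPhase t).norm_exp (K.2.2 hz.1)]
    simp
  induction i with
  | zero => exact NetBound.of_value hs hv
  | succ i ih =>
    refine NetBound.of_deriv hs hv fun j => ?_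
    have h1 := ((((hphi (i + 1)).deriv j).xFrame_mono zero_le_one).const_mul Complex.I).mul ih
    refine (h1.mono (by simp [xFrame])).congr fun t z hz => ?_
    exact pderiv_single_exp (differentiableAt_of_contDiffOn (xFrame 1 K).isOpen_U
      ((hphi 0).1 t) hz) j

/-- Since the phases are real, `|e^{iφ} - e^{iφ'}| ≤ |φ - φ'|`, and the right side has order `1`.
This loss is the summand `1` in `m - h s + 1 + k`. -/
theorem PhasePair.net_exp_sub (h : PhasePair I K φ φ') :
    NetBound (xFrame 1 K) I 1 i fun t z =>
      Complex.exp (Complex.I * (φ t).1 z) - Complex.exp (Complex.I * (φ' t).1 z) := by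
  have hE := fun i => h.left.net_exp (i := i)
  have hE' := fun i => h.right.net_exp (i := i)
  have hphi := fun i => h.pair_x (i := i)
  have hl := fun i => ((h.left.refl (modIdeal τ)).pair_x (i := i)).1
  have hs : ∀ t, ContDiffOn ℝ ∞ (fun z =>
      Complex.exp (Complex.I * (φ t).1 z) - Complex.exp (Complex.I * (φ' t).1 z))
      (xFrame 1 K).U := fun t => ((hE 0).1 t).sub ((hE' 0).1 t)
  have hv : ∃ C ∈ I.carrier, ∀ t, ∀ z ∈ (xFrame 1 K).S,
      ‖Complex.exp (Complex.I * (φ t).1 z) - Complex.exp (Complex.I * (φ' t).1 z)‖ ≤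
        C t * (xFrame 1 K : Frame (Fin n₁) (Var n₁ n p)).b z ^ (1 : ℝ) := by
    obtain ⟨C, hC, h1⟩ := (hphi 0).2.value
    exact ⟨C, hC, fun t z hz => ((h.left.isPhase t).norm_exp_sub_le (h.right.isPhase t)
      (K.2.2 hz.1)).trans (h1 t z hz)⟩
  induction i with
  | zero => exact NetBound.of_value hs hv
  | succ i ih =>
    refine NetBound.of_deriv hs hv fun j => ?_
    -- With `E = e^{iφ}` and `E' = e^{iφ'}` one has `∂(E - E') = i ∂φ (E - E') + E' i (∂φ - ∂φ')`.
    -- The first term is covered by the induction hypothesis.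
    have h1 := ((((hl (i + 1)).deriv j).xFrame_mono zero_le_one).const_mul Complex.I).mul ih
    have h2 := (hE' i).mul
      ((((hphi (i + 1)).deriv j).2.xFrame_mono zero_le_one).const_mul Complex.I)
    refine ((h1.mono (ν := 1 + 1) (by simp [xFrame])).add
      (h2.mono (ν := 1 + 1) (by simp [xFrame]))).congr fun t z hz => ?_
    have hd := differentiableAt_of_contDiffOn (xFrame 1 K).isOpen_U ((hphi 0).smooth_left t) hz
    have hd' := differentiableAt_of_contDiffOn (xFrame 1 K).isOpen_U ((hphi 0).1.1 t) hz
    have h3 := pderiv_single_add (e := (xFrame 1 K : Frame (Fin n₁) (Var n₁ n p)).e)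
      (differentiableAt_of_contDiffOn (xFrame 1 K).isOpen_U (hs t) hz)
      (differentiableAt_of_contDiffOn (xFrame 1 K).isOpen_U ((hE' 0).1 t) hz) j
    simp only [sub_add_cancel] at h3
    rw [pderiv_single_exp hd, pderiv_single_exp hd'] at h3
    refine (sub_eq_of_eq_add h3).symm.trans ?_
    change _ = Complex.I * pderiv (xFrame 1 K).e [j] (φ t).1 z * _ +
      _ * (Complex.I * (pderiv (xFrame 1 K).e [j] (φ t).1 z -
        pderiv (xFrame 1 K).e [j] (φ' t).1 z))
    ring

/-- The oscillating factor costs at most one order for differences. -/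
theorem PhasePair.pair_exp_mul (h : PhasePair I K φ φ') {g g' : T → Var n₁ n p → ℂ}
    (hg : PairBound (symFrame ρ δ (-1) K) I μ i g g') (hδ : δ ≤ 1) :
    PairBound (xFrame 1 K) I (μ + 1) i (fun t z => Complex.exp (Complex.I * (φ t).1 z) * g t z)
      fun t z => Complex.exp (Complex.I * (φ' t).1 z) * g' t z := by
  have h1 : PairBound (xFrame 1 K) I 1 i (fun t z => Complex.exp (Complex.I * (φ t).1 z))
      fun t z => Complex.exp (Complex.I * (φ' t).1 z) :=
    ⟨h.right.net_exp.mono zero_le_one, h.net_exp_sub⟩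
  exact (PairBound.mul (h.left.net_exp.mono zero_le_one) h1
    ⟨hg.1.to_xFrame hδ, hg.2.to_xFrame hδ⟩).mono (by linarith)

end Oscillation

/-! ## Integrals with parameters -/

section ParametricIntegral

variable {n₁ n p : ℕ} {Ω₁ : TopologicalSpace.Opens (Euc n₁)} {Ω : TopologicalSpace.Opens (Euc n)}
  {T : Type} {τ : T → Eps} {I : BoundIdeal τ}
  {ν : ℝ} {k : ℕ}

theorem integrable_bracket_rpow (h : ν < -(p : ℝ)) :
    Integrable (fun ξ : Euc p => bracket ξ ^ ν) := by
  have h1 : (Module.finrank ℝ (Euc p) : ℝ) < -ν := by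
    rw [finrank_euclideanSpace_fin]; linarith
  refine (integrable_rpow_neg_one_add_norm_sq (μ := volume) h1).congr
    (Eventually.of_forall fun ξ => ?_)
  simp only [bracket]
  rw [Real.sqrt_eq_rpow, ← Real.rpow_mul (by positivity)]
  congr 1; ring

theorem integrableOn_bracket_rpow (h : ν < -(p : ℝ)) {K₂ : Set (Euc n)} (hK : IsCompact K₂) :
    IntegrableOn (fun q : Euc n × Euc p => bracket q.2 ^ ν) (K₂ ×ˢ univ) := by
  have h1 : Integrable (fun _ : Euc n => (1 : ℝ)) (volume.restrict K₂) :=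
    (integrableOn_const hK.measure_lt_top.ne)
  have h2 := h1.mul_prod (integrable_bracket_rpow h)
  rw [IntegrableOn, Measure.volume_eq_prod, ← Measure.prod_restrict, Measure.restrict_univ]
  simpa using h2

/-- The excluded set `ξ = 0` is a null set if `p > 0`, and nothing is excluded if `p = 0`. -/
theorem ae_mem_regular (s : Set (Euc n × Euc p)) :
    ∀ᵐ q : Euc n × Euc p ∂(volume.restrict s), q.2 ∈ regular p := by
  refine ae_restrict_of_ae ?_
  by_cases hp : p = 0
  · exact Eventually.of_forall fun q => Or.inr hp
  have : NeZero p := ⟨hp⟩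
  have : Nontrivial (Euc p) := inferInstance
  have h1 : ∀ᵐ ξ : Euc p, ξ ∈ regular p := by
    filter_upwards [Measure.ae_ne volume (0 : Euc p)] with ξ hξ using Or.inl hξ
  exact Measure.quasiMeasurePreserving_snd.ae h1

/-- The product of compact sets, as a compact subset of `Ω₁ × Ω`. -/
def prodCompact (K₁ : CompactIn (Ω₁ : Set (Euc n₁))) (K₂ : CompactIn (Ω : Set (Euc n))) :
    CompactIn (base Ω₁ Ω) :=
  ⟨K₁.1 ×ˢ K₂.1, K₁.2.1.prod K₂.2.1, prod_mono K₁.2.2 K₂.2.2⟩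

/-- Symbol bounds over all compact subsets of `Ω₁` and a fixed compact subset of `Ω`. -/
def XBound (K₂ : CompactIn (Ω : Set (Euc n))) (I : BoundIdeal τ) (ν : ℝ) (k : ℕ)
    (Φ : T → Var n₁ n p → ℂ) : Prop :=
  ∀ K₁ : CompactIn (Ω₁ : Set (Euc n₁)), NetBound (xFrame 1 (prodCompact K₁ K₂)) I ν k Φ

variable {K₂ : CompactIn (Ω : Set (Euc n))} {Φ : T → Var n₁ n p → ℂ}

theorem exists_compactIn_nhds {x : Euc n₁} (hx : x ∈ Ω₁) :
    ∃ K₁ : CompactIn (Ω₁ : Set (Euc n₁)), K₁.1 ∈ 𝓝 x := by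
  obtain ⟨K, hK, hxK, hKΩ⟩ := exists_compact_subset Ω₁.isOpen hx
  exact ⟨⟨K, hK, hKΩ⟩, mem_interior_iff_mem_nhds.1 hxK⟩

namespace XBound

theorem deriv (h : XBound (Ω₁ := Ω₁) K₂ I ν (k + 1) Φ) (j : Fin n₁) :
    XBound (Ω₁ := Ω₁) K₂ I (ν + 1) k fun t => pderiv dirVec [.inl j] (Φ t) :=
  fun K₁ => (h K₁).deriv j

theorem continuousAt (h : XBound (Ω₁ := Ω₁) K₂ I ν k Φ) (t : T) {z : Var n₁ n p}
    (hz : z ∈ fullDomain p Ω₁ Ω) (hr : z.2.2 ∈ regular p) : ContinuousAt (Φ t) z := by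
  let F : Frame (Fin n₁) (Var n₁ n p) :=
    xFrame 1 (prodCompact (Ω₁ := Ω₁) ⟨∅, isCompact_empty, empty_subset _⟩ K₂)
  have h1 : ContDiffOn ℝ ∞ (Φ t) F.U := (h ⟨∅, isCompact_empty, empty_subset _⟩).1 t
  exact h1.continuousOn.continuousAt (F.isOpen_U.mem_nhds ⟨hz, hr⟩)

theorem differentiableAt (h : XBound (Ω₁ := Ω₁) K₂ I ν k Φ) (t : T) {z : Var n₁ n p}
    (hz : z ∈ fullDomain p Ω₁ Ω) (hr : z.2.2 ∈ regular p) : DifferentiableAt ℝ (Φ t) z := by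
  let F : Frame (Fin n₁) (Var n₁ n p) :=
    xFrame 1 (prodCompact (Ω₁ := Ω₁) ⟨∅, isCompact_empty, empty_subset _⟩ K₂)
  have h1 : ContDiffOn ℝ ∞ (Φ t) F.U := (h ⟨∅, isCompact_empty, empty_subset _⟩).1 t
  exact differentiableAt_of_contDiffOn F.isOpen_U h1 ⟨hz, hr⟩

theorem value (h : XBound (Ω₁ := Ω₁) K₂ I ν k Φ) (K₁ : CompactIn (Ω₁ : Set (Euc n₁))) :
    ∃ C ∈ I.carrier, ∀ t, ∀ᵐ q ∂(volume.restrict (K₂.1 ×ˢ univ)), ∀ x ∈ K₁.1,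
      ‖Φ t (x, q)‖ ≤ C t * bracket q.2 ^ ν := by
  obtain ⟨C, hC, h1⟩ := (h K₁).value
  refine ⟨C, hC, fun t => ?_⟩
  filter_upwards [ae_mem_regular (K₂.1 ×ˢ univ),
    ae_restrict_mem (K₂.2.1.measurableSet.prod MeasurableSet.univ)] with q hq hq' x hx
  exact h1 t (x, q) ⟨⟨hx, hq'.1⟩, hq⟩

/-- Continuity is known off `ξ = 0` only, so the null set is removed from the domain of integration
first. -/
theorem aestronglyMeasurable (h : XBound (Ω₁ := Ω₁) K₂ I ν k Φ) (t : T) {x : Euc n₁}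
    (hx : x ∈ Ω₁) :
    AEStronglyMeasurable (fun q => Φ t (x, q)) (volume.restrict (K₂.1 ×ˢ univ)) := by
  have hm : MeasurableSet (K₂.1 ×ˢ regular p) :=
    K₂.2.1.measurableSet.prod isOpen_regular.measurableSet
  have h1 : volume.restrict (K₂.1 ×ˢ (univ : Set (Euc p))) =
      volume.restrict (K₂.1 ×ˢ regular p) := by
    refine Measure.restrict_congr_set ?_
    have h2 := (ae_mem_regular (n := n) (p := p) univ)
    rw [Measure.restrict_univ] at h2
    filter_upwards [h2] with q hq
    apply propext
    exact ⟨fun h => ⟨h.1, hq⟩, fun h => ⟨h.1, trivial⟩⟩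
  rw [h1]
  refine ContinuousOn.aestronglyMeasurable (fun q hq => ?_) hm
  have h2 : ContinuousAt (Φ t) (x, q) := h.continuousAt t ⟨hx, K₂.2.2 hq.1⟩ hq.2
  exact (ContinuousAt.comp (f := fun q => (x, q)) h2
    (by fun_prop)).continuousWithinAt

theorem integrableOn (h : XBound (Ω₁ := Ω₁) K₂ I ν k Φ) (hν : ν < -(p : ℝ)) (t : T) {x : Euc n₁}
    (hx : x ∈ Ω₁) : IntegrableOn (fun q => Φ t (x, q)) (K₂.1 ×ˢ univ) := by
  obtain ⟨C, -, h1⟩ := h.value ⟨{x}, isCompact_singleton, singleton_subset_iff.2 hx⟩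
  exact Integrable.mono' ((integrableOn_bracket_rpow hν K₂.2.1).const_mul (C t))
    (h.aestronglyMeasurable t hx) ((h1 t).mono fun q hq => hq x rfl)

theorem norm_integral_le (h : XBound (Ω₁ := Ω₁) K₂ I ν k Φ) (hν : ν < -(p : ℝ))
    (K₁ : CompactIn (Ω₁ : Set (Euc n₁))) :
    ∃ C ∈ I.carrier, ∀ t, ∀ x ∈ K₁.1, ‖∫ q in K₂.1 ×ˢ univ, Φ t (x, q)‖ ≤ C t := by
  obtain ⟨C, hC, h1⟩ := h.value K₁
  refine ⟨_, I.const_mul_mem (∫ q : Euc n × Euc p in K₂.1 ×ˢ univ, bracket q.2 ^ ν) hC,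
    fun t x hx => ?_⟩
  refine (norm_integral_le_of_norm_le ((integrableOn_bracket_rpow hν K₂.2.1).const_mul (C t))
    ((h1 t).mono fun q hq => hq x hx)).trans_eq ?_
  rw [integral_const_mul, mul_comm]

theorem continuousOn_integral (h : XBound (Ω₁ := Ω₁) K₂ I ν k Φ) (hν : ν < -(p : ℝ)) (t : T) :
    ContinuousOn (fun x => ∫ q in K₂.1 ×ˢ univ, Φ t (x, q)) Ω₁ := by
  intro x hx
  obtain ⟨K₁, hK₁⟩ := exists_compactIn_nhds hx
  obtain ⟨C, -, h1⟩ := h.value K₁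
  have hb := (integrableOn_bracket_rpow hν K₂.2.1).const_mul (C t)
  suffices hc : ContinuousAt (fun x => ∫ q in K₂.1 ×ˢ univ, Φ t (x, q)) x from
    hc.continuousWithinAt
  refine continuousAt_of_dominated (F := fun x q => Φ t (x, q))
    (bound := fun q => C t * bracket q.2 ^ ν) ?_ ?_ hb ?_
  · filter_upwards [Ω₁.isOpen.mem_nhds hx] with y hy using h.aestronglyMeasurable t hy
  · filter_upwards [hK₁] with y hy using (h1 t).mono fun q hq => hq y hy
  · filter_upwards [ae_mem_regular (K₂.1 ×ˢ univ),
      ae_restrict_mem (K₂.2.1.measurableSet.prod MeasurableSet.univ)] with q hq hq'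
    have h2 : ContinuousAt (Φ t) (x, q) := h.continuousAt t ⟨hx, K₂.2.2 hq'.1⟩ hq
    exact ContinuousAt.comp (f := fun y => (y, q)) h2 (by fun_prop)

end XBound

/-- The coordinate functionals, with complex values. -/
def coordC (j : Fin n₁) : Euc n₁ →L[ℝ] ℂ := Complex.ofRealCLM.comp (EuclideanSpace.proj j)

theorem clm_eq_sum (L : Euc n₁ →L[ℝ] ℂ) :
    L = ∑ j, L (EuclideanSpace.single j 1) • coordC j := by
  ext v
  have hv : v = ∑ j, v j • EuclideanSpace.single j (1 : ℝ) := by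
    ext i
    simp [Finset.sum_apply, Pi.single_apply]
  conv_lhs => rw [hv]
  simp [coordC, mul_comm]

namespace XBound

/-- Differentiation under the integral sign. The `x`-derivatives are dominated near `x` by multiples
of `⟨ξ⟩ ^ (ν + 1)`, which is integrable because `ν + 1 < -p`. -/
theorem hasFDerivAt_integral (h : XBound (Ω₁ := Ω₁) K₂ I ν (k + 1) Φ)
    (hν : ν + (k + 1 : ℕ) < -(p : ℝ)) (t : T) {x : Euc n₁} (hx : x ∈ Ω₁) :
    HasFDerivAt (fun x => ∫ q in K₂.1 ×ˢ univ, Φ t (x, q))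
      (∑ j, (∫ q in K₂.1 ×ˢ univ, pderiv dirVec [.inl j] (Φ t) (x, q)) • coordC j) x := by
  obtain ⟨K₁, hK₁⟩ := exists_compactIn_nhds hx
  have hk : (0 : ℝ) ≤ k := k.cast_nonneg
  push_cast at hν
  choose C _ hC using fun j => (h.deriv j).value K₁
  have hint : ∀ j, Integrable (fun q => pderiv dirVec [.inl j] (Φ t) (x, q))
      (volume.restrict (K₂.1 ×ˢ univ)) := fun j => (h.deriv j).integrableOn (by linarith) t hx
  have hb := integrableOn_bracket_rpow (n := n) (p := p) (ν := ν + 1) (by linarith) K₂.2.1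
  have key := hasFDerivAt_integral_of_dominated_of_fderiv_le (𝕜 := ℝ)
    (μ := volume.restrict (K₂.1 ×ˢ (univ : Set (Euc p))))
    (F := fun x q => Φ t (x, q))
    (F' := fun x q => ∑ j, pderiv dirVec [.inl j] (Φ t) (x, q) • coordC j)
    (bound := fun q => ∑ j, C j t * bracket q.2 ^ (ν + 1) * ‖coordC j‖)
    (s := K₁.1 ∩ Ω₁) (x₀ := x) (inter_mem hK₁ (Ω₁.isOpen.mem_nhds hx)) ?_ ?_ ?_ ?_ ?_ ?_
  · refine key.congr_fderiv ?_
    rw [integral_finsetSum _ fun j _ => (hint j).smul_const _]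
    exact Finset.sum_congr rfl fun j _ => integral_smul_const _ _
  · filter_upwards [Ω₁.isOpen.mem_nhds hx] with y hy using h.aestronglyMeasurable t hy
  · exact h.integrableOn (by linarith) t hx
  · exact (integrable_finsetSum _ fun j _ =>
      (hint j).smul_const (coordC j)).aestronglyMeasurable
  · filter_upwards [ae_all_iff.2 fun j => hC j t] with q hq y hy
    refine (norm_sum_le _ _).trans (Finset.sum_le_sum fun j _ => ?_)
    rw [norm_smul]
    exact mul_le_mul_of_nonneg_right (hq j y hy.1) (norm_nonneg _)
  · exact integrable_finsetSum _ fun j _ => (hb.const_mul (C j t)).mul_const _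
  · filter_upwards [ae_mem_regular (K₂.1 ×ˢ univ),
      ae_restrict_mem (K₂.2.1.measurableSet.prod MeasurableSet.univ)] with q hq hq' y hy
    have h1 := (h.differentiableAt t (z := (y, q)) ⟨hy.2, K₂.2.2 hq'.1⟩ hq).hasFDerivAt
    have h2 := HasFDerivAt.comp (g := Φ t) (f := fun y => (y, q)) y h1
      (hasFDerivAt_prodMk_left y q)
    refine h2.congr_fderiv ?_
    rw [clm_eq_sum ((fderiv ℝ (Φ t) (y, q)).comp _)]
    rfl

theorem contDiffOn_integral (h : XBound (Ω₁ := Ω₁) K₂ I ν k Φ) (hν : ν + k < -(p : ℝ)) (t : T) :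
    ContDiffOn ℝ k (fun x => ∫ q in K₂.1 ×ˢ univ, Φ t (x, q)) Ω₁ := by
  induction k generalizing ν Φ with
  | zero =>
    exact contDiffOn_zero.2 (h.continuousOn_integral (by simpa using hν) t)
  | succ k ih =>
    have hd := fun x hx => h.hasFDerivAt_integral hν t (x := x) hx
    push_cast
    rw [contDiffOn_succ_iff_fderiv_of_isOpen Ω₁.isOpen]
    refine ⟨fun x hx => (hd x hx).differentiableAt.differentiableWithinAt, by simp, ?_⟩
    refine ContDiffOn.congr ?_ fun x hx => (hd x hx).fderiv
    refine ContDiffOn.sum fun j _ => ContDiffOn.fun_smul ?_ contDiffOn_const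
    exact ih (h.deriv j) (by push_cast at hν; linarith)

/-- Moving one derivative under the integral raises `ν` by one and lowers `k` by one, so `ν + k <
-p` is preserved until all derivatives are inside. -/
theorem norm_pderiv_integral_le (h : XBound (Ω₁ := Ω₁) K₂ I ν k Φ) (hν : ν + k < -(p : ℝ))
    (K₁ : CompactIn (Ω₁ : Set (Euc n₁))) (l : List (Fin n₁)) (hl : l.length ≤ k) :
    ∃ C ∈ I.carrier, ∀ t, ∀ x ∈ K₁.1,
      ‖pderiv (fun j => EuclideanSpace.single j (1 : ℝ)) l
        (fun x => ∫ q in K₂.1 ×ˢ univ, Φ t (x, q)) x‖ ≤ C t := by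
  induction k generalizing ν Φ l with
  | zero =>
    rw [List.length_eq_zero_iff.1 (Nat.le_zero.1 hl)]
    exact h.norm_integral_le (by simpa using hν) K₁
  | succ k ih =>
    rcases List.eq_nil_or_concat' l with rfl | ⟨l, j, rfl⟩
    · refine h.norm_integral_le ?_ K₁
      have : (0 : ℝ) ≤ (k + 1 : ℕ) := Nat.cast_nonneg _
      linarith
    · obtain ⟨C, hC, h1⟩ := ih (h.deriv j) (by push_cast at hν; linarith) l (by simpa using hl)
      refine ⟨C, hC, fun t x hx => ?_⟩
      have h2 : EqOn (pderiv (fun j => EuclideanSpace.single j (1 : ℝ)) [j]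
          fun x => ∫ q in K₂.1 ×ˢ univ, Φ t (x, q))
          (fun x => ∫ q in K₂.1 ×ˢ univ, pderiv dirVec [.inl j] (Φ t) (x, q)) Ω₁ := by
        intro x hx
        have := (h.hasFDerivAt_integral hν t hx).fderiv
        simp only [pderiv] at this ⊢
        rw [this]
        simp [coordC, apply_ite Complex.ofReal]
      rw [pderiv_append, pderiv_congr Ω₁.isOpen h2 l (K₁.2.2 hx)]
      exact h1 t x hx

end XBound

end ParametricIntegral

/-! ## Bounds for oscillatory integrals -/

section OscInt

variable {n₁ n p : ℕ} {Ω₁ : TopologicalSpace.Opens (Euc n₁)} {Ω : TopologicalSpace.Opens (Euc n)}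
  {T : Type} {τ : T → Eps} {I : BoundIdeal τ} {K₂ : CompactIn (Ω : Set (Euc n))}
  {m ρ δ : ℝ} {k h : ℕ} {φ φ' : T → HgSpace p Ω₁ Ω} {a a' : T → SymbolSpace p Ω₁ Ω m ρ δ}
  {u u' : T → CSpace ⊤ Ω} {χ : Euc p → ℂ}

/-- The integral of `integrand` over `K × ℝ^p`. -/
def oscInt (χ : Euc p → ℂ) (φ a : Var n₁ n p → ℂ) (u : Euc n → ℂ) (h : ℕ) (K : Set (Euc n))
    (x : Euc n₁) : ℂ :=
  ∫ q in K ×ˢ univ, integrand χ φ a u h x q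

variable (I K₂ k h) in
/-- Two families of data for an oscillatory integral over `K₂ × ℝ^p`, the differences of which are
bounded by `I`. -/
structure DataPair (φ φ' : T → HgSpace p Ω₁ Ω) (a a' : T → SymbolSpace p Ω₁ Ω m ρ δ)
    (u u' : T → CSpace ⊤ Ω) : Prop where
  phase : ∀ K₁ : CompactIn (Ω₁ : Set (Euc n₁)), PhasePair I (prodCompact K₁ K₂) φ φ'
  symbol_left : ∀ K i, (fun t => (symbolSystem p Ω₁ Ω m ρ δ).seminorm (K, i) (a t)) ∈
    (modIdeal τ).carrier
  symbol_right : ∀ K i, (fun t => (symbolSystem p Ω₁ Ω m ρ δ).seminorm (K, i) (a' t)) ∈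
    (modIdeal τ).carrier
  symbol_diff : ∀ K i, (fun t => (symbolSystem p Ω₁ Ω m ρ δ).seminorm (K, i) (a t - a' t)) ∈
    I.carrier
  fun_right : (fun t => (smoothSystem ⊤ Ω).seminorm (K₂, k + h) (u' t)) ∈ (modIdeal τ).carrier
  fun_diff : (fun t => (smoothSystem ⊤ Ω).seminorm (K₂, k + h) (u t - u' t)) ∈ I.carrier

/-- The central estimate: `a u` has order `m`, `L_φ^h` subtracts `h s` and uses up `h` of the `k +
h` available derivatives, and the oscillating factor adds `1`. -/
theorem DataPair.xBound (H : DataPair I K₂ k h φ φ' a a' u u') (hχ : IsCutoff χ) (hρ : ρ ≤ 1)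
    (hδ : 0 ≤ δ) (hδ1 : δ ≤ 1) (K₁ : CompactIn (Ω₁ : Set (Euc n₁))) :
    PairBound (xFrame 1 (prodCompact K₁ K₂)) I (m - h * min ρ (1 - δ) + 1) k
      (fun t (z : Var n₁ n p) => integrand χ (φ t).1 (a t).1 (u t).1 h z.1 z.2)
      fun t z => integrand χ (φ' t).1 (a' t).1 (u' t).1 h z.1 z.2 := by
  have hK : ∀ q ∈ (prodCompact K₁ K₂).1, q.2 ∈ K₂.1 := fun q hq => hq.2
  have hau : PairBound (symFrame ρ δ (-1) (prodCompact K₁ K₂)) I (m + 0) (k + h)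
      (fun t (z : Var n₁ n p) => (a t).1 z * (u t).1 z.2.1)
      fun t z => (a' t).1 z * (u' t).1 z.2.1 :=
    -- Only the left factor `a` has to be moderate in its own right. Nothing is assumed on `u`
    -- beyond its difference from `u'`, which later allows `u` to range over all smooth functions.
    PairBound.mul (netBound_symbol a (H.symbol_left _ _))
      ⟨netBound_symbol a' (H.symbol_right _ _),
        netBound_symbol (fun t => a t - a' t) (H.symbol_diff _ _)⟩
      ⟨netBound_comp_y hK hδ u' H.fun_right,
        netBound_comp_y hK hδ (fun t => u t - u' t) H.fun_diff⟩
  rw [add_zero] at hau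
  exact ((H.phase K₁).pair_exp_mul ((H.phase K₁).pair_opL_iterate hχ hρ hδ h hau) hδ1).const_mul _

theorem DataPair.xBound_right (H : DataPair I K₂ k h φ φ' a a' u u') (hχ : IsCutoff χ)
    (hρ : ρ ≤ 1) (hδ : 0 ≤ δ) (hδ1 : δ ≤ 1) :
    XBound (Ω₁ := Ω₁) K₂ (modIdeal τ) (m - h * min ρ (1 - δ) + 1) k
      fun t (z : Var n₁ n p) => integrand χ (φ' t).1 (a' t).1 (u' t).1 h z.1 z.2 :=
  fun K₁ => (H.xBound hχ hρ hδ hδ1 K₁).1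

theorem DataPair.xBound_diff (H : DataPair I K₂ k h φ φ' a a' u u') (hχ : IsCutoff χ)
    (hρ : ρ ≤ 1) (hδ : 0 ≤ δ) (hδ1 : δ ≤ 1) :
    XBound (Ω₁ := Ω₁) K₂ I (m - h * min ρ (1 - δ) + 1) k
      fun t (z : Var n₁ n p) => integrand χ (φ t).1 (a t).1 (u t).1 h z.1 z.2 -
        integrand χ (φ' t).1 (a' t).1 (u' t).1 h z.1 z.2 :=
  fun K₁ => (H.xBound hχ hρ hδ hδ1 K₁).2

end OscInt

/-! ## Integration by parts -/

section IntegrationByParts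

variable {n₁ n p : ℕ} {Ω₁ : TopologicalSpace.Opens (Euc n₁)} {Ω : TopologicalSpace.Opens (Euc n)}

/-- Compactness of `K` times the unit sphere, on which the gradient is continuous and without zeros.
-/
theorem IsPhase.exists_gradSq_inv_le {φ : HgSpace p Ω₁ Ω} (hφ : IsPhase φ)
    (K : CompactIn (base Ω₁ Ω)) :
    ∃ C : ℝ, ∀ z : Var n₁ n p, (z.1, z.2.1) ∈ K.1 → z.2.2 ≠ 0 →
      (gradSq φ.1 (toSphere z))⁻¹ ≤ C := by
  let Q : Set (Var n₁ n p) := (fun a : (Euc n₁ × Euc n) × Euc p => (a.1.1, a.1.2, a.2)) ''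
    (K.1 ×ˢ Metric.sphere 0 1)
  have hQ : IsCompact Q := (K.2.1.prod (isCompact_sphere 0 1)).image (by fun_prop)
  have hne : ∀ z ∈ Q, z ∈ fullDomain p Ω₁ Ω ∧ z.2.2 ≠ 0 := by
    rintro _ ⟨⟨q, ξ⟩, ⟨hq, hξ⟩, rfl⟩
    refine ⟨K.2.2 hq, ?_⟩
    rw [mem_sphere_zero_iff_norm] at hξ
    intro h
    change ξ = 0 at h
    rw [h, norm_zero] at hξ
    exact zero_ne_one hξ
  have hc : ∀ d, ContinuousOn (pderiv dirVec [d] φ.1) Q := fun d =>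
    ((contDiffOn_infty_pderiv (hgSystem p Ω₁ Ω).isOpen_U φ.2.1 [d]).continuousOn).mono hne
  have hg : ContinuousOn (fun z => (gradSq φ.1 z)⁻¹) Q := by
    refine ContinuousOn.inv₀ ?_ fun z hz => hφ.gradient z (hne z hz).1 (hne z hz).2
    exact (continuousOn_finsetSum _ fun j _ => (hc _).norm.pow 2).add
      (continuousOn_finsetSum _ fun k _ => (hc _).norm.pow 2)
  obtain ⟨C, hC⟩ := hQ.exists_bound_of_continuousOn hg
  refine ⟨C, fun z hz h0 => (le_abs_self _).trans (hC _ ⟨((z.1, z.2.1), ‖z.2.2‖⁻¹ • z.2.2), ⟨hz, ?_⟩,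
    rfl⟩)⟩
  rw [mem_sphere_zero_iff_norm, norm_smul, norm_inv, norm_norm,
    inv_mul_cancel₀ (norm_ne_zero_iff.2 h0)]

/-- A constant family of phase functions. -/
theorem IsPhase.family {φ : HgSpace p Ω₁ Ω} (hφ : IsPhase φ) {T : Type} (τ : T → Eps)
    (K : CompactIn (base Ω₁ Ω)) : PhaseFamily τ K fun _ => φ := by
  obtain ⟨C, hC⟩ := hφ.exists_gradSq_inv_le K
  exact ⟨fun _ => hφ, fun i => const_mem_modIdeal _, _, const_mem_modIdeal C, fun _ => hC⟩

/-- `f` is smooth on `Ω₁ × Ω × ℝ^p` and vanishes for `y ∉ K` and for `R < |ξ|`. -/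
structure SupportedIn (Ω₁ : TopologicalSpace.Opens (Euc n₁)) {Ω : TopologicalSpace.Opens (Euc n)}
    (K : CompactIn (Ω : Set (Euc n))) (R : ℝ) (f : Var n₁ n p → ℂ) : Prop where
  smooth : ContDiffOn ℝ ∞ f (fullDomain p Ω₁ Ω)
  eq_zero : ∀ z, (z.2.1 ∉ K.1 ∨ R < ‖z.2.2‖) → f z = 0

variable {K : CompactIn (Ω : Set (Euc n))} {R : ℝ} {f : Var n₁ n p → ℂ}

theorem isOpen_outside (K : CompactIn (Ω : Set (Euc n))) (R : ℝ) :
    IsOpen {z : Var n₁ n p | z.2.1 ∉ K.1 ∨ R < ‖z.2.2‖} :=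
  (K.2.1.isClosed.isOpen_compl.preimage (continuous_fst.comp continuous_snd)).union
    (isOpen_lt continuous_const (continuous_norm.comp (continuous_snd.comp continuous_snd)))

/-- The empty set, as a compact subset. -/
def emptyCompact {X : Type} [TopologicalSpace X] (U : Set X) : CompactIn U :=
  ⟨∅, isCompact_empty, empty_subset _⟩

/-- Over the empty compact set the estimates are void, and `NetBound` reduces to smoothness. Results
on symbols thus yield the smoothness of the coefficients and of `L_φ f`. -/
theorem netBound_of_smooth {T : Type} {τ : T → Eps} {f : Var n₁ n p → ℂ} {μ : ℝ} {i : ℕ}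
    (hf : ContDiffOn ℝ ∞ f (fullDomain p Ω₁ Ω)) :
    NetBound (symFrame 1 0 (-1) (emptyCompact (base Ω₁ Ω))) (modIdeal τ) μ i fun _ => f := by
  refine ⟨fun _ => ?_, fun l hl => ⟨_, (modIdeal τ).zero_mem, fun t z hz => absurd hz.1 (by
    simp [emptyCompact])⟩⟩
  rwa [symFrame_U_neg_one]

section Smooth

variable {φ : HgSpace p Ω₁ Ω} {χ : Euc p → ℂ}

theorem IsPhase.contDiffOn_coeffA (hφ : IsPhase φ) (hχ : IsCutoff χ) (j : Fin p) :
    ContDiffOn ℝ ∞ (coeffA χ φ.1 j) (fullDomain p Ω₁ Ω) := by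
  have h := (hφ.family (fun _ : Unit => (⟨1, one_pos, le_rfl⟩ : Eps))
    (emptyCompact (base Ω₁ Ω))).refl (modIdeal _)
  have := (h.pair_coeffA (i := 0) hχ (ρ := 1) (δ := 0) le_rfl le_rfl j).1.1 ()
  rwa [symFrame_U_neg_one] at this

theorem IsPhase.contDiffOn_coeffB (hφ : IsPhase φ) (hχ : IsCutoff χ) (k : Fin n) :
    ContDiffOn ℝ ∞ (coeffB χ φ.1 k) (fullDomain p Ω₁ Ω) := by
  have h := (hφ.family (fun _ : Unit => (⟨1, one_pos, le_rfl⟩ : Eps))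
    (emptyCompact (base Ω₁ Ω))).refl (modIdeal _)
  have := (h.pair_coeffB (i := 0) hχ (ρ := 1) (δ := 0) le_rfl le_rfl k).1.1 ()
  rwa [symFrame_U_neg_one] at this

theorem IsPhase.contDiffOn_opL (hφ : IsPhase φ) (hχ : IsCutoff χ)
    (hf : ContDiffOn ℝ ∞ f (fullDomain p Ω₁ Ω)) :
    ContDiffOn ℝ ∞ (opL χ φ.1 f) (fullDomain p Ω₁ Ω) := by
  have h := (hφ.family (fun _ : Unit => (⟨1, one_pos, le_rfl⟩ : Eps))
    (emptyCompact (base Ω₁ Ω))).refl (modIdeal _)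
  have := (h.pair_opL (i := 0) hχ (ρ := 1) (δ := 0) (μ := 0) le_rfl le_rfl
    (PairBound.refl (netBound_of_smooth hf))).1.1 ()
  rwa [symFrame_U_neg_one] at this

end Smooth

theorem opL_congr {χ : Euc p → ℂ} {φ : Var n₁ n p → ℂ} {V : Set (Var n₁ n p)} (hV : IsOpen V)
    {f g : Var n₁ n p → ℂ} (h : EqOn f g V) : EqOn (opL χ φ f) (opL χ φ g) V := by
  intro z hz
  simp only [opL, pderiv_congr hV h _ hz, h hz]

theorem opL_iterate_congr {χ : Euc p → ℂ} {φ : Var n₁ n p → ℂ} {V : Set (Var n₁ n p)}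
    (hV : IsOpen V) {f g : Var n₁ n p → ℂ} (h : EqOn f g V) (k : ℕ) :
    EqOn ((opL χ φ)^[k] f) ((opL χ φ)^[k] g) V := by
  induction k with
  | zero => exact h
  | succ k ih =>
    simp only [Function.iterate_succ_apply']
    exact opL_congr hV ih

theorem opL_zero (χ : Euc p → ℂ) (φ : Var n₁ n p → ℂ) : opL χ φ 0 = 0 := by
  funext z
  simp [opL, pderiv_zero]

theorem opL_iterate_zero (χ : Euc p → ℂ) (φ : Var n₁ n p → ℂ) (k : ℕ) : (opL χ φ)^[k] 0 = 0 := by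
  induction k with
  | zero => rfl
  | succ k ih => rw [Function.iterate_succ_apply', ih, opL_zero]

theorem opL_iterate_eq_zero {χ : Euc p → ℂ} {φ : Var n₁ n p → ℂ} {V : Set (Var n₁ n p)}
    (hV : IsOpen V) {f : Var n₁ n p → ℂ} (h : ∀ z ∈ V, f z = 0) (k : ℕ) {z : Var n₁ n p}
    (hz : z ∈ V) : (opL χ φ)^[k] f z = 0 := by
  have := opL_iterate_congr (χ := χ) (φ := φ) (g := 0) hV (fun z hz => h z hz) k hz
  rw [this, opL_iterate_zero, Pi.zero_apply]

theorem SupportedIn.map_opL {φ : HgSpace p Ω₁ Ω} {χ : Euc p → ℂ} (hf : SupportedIn Ω₁ K R f)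
    (hφ : IsPhase φ) (hχ : IsCutoff χ) : SupportedIn Ω₁ K R (opL χ φ.1 f) :=
  ⟨hφ.contDiffOn_opL hχ hf.smooth, fun _ hz =>
    opL_iterate_eq_zero (isOpen_outside K R) hf.eq_zero 1 hz⟩

theorem SupportedIn.map_opL_iterate {φ : HgSpace p Ω₁ Ω} {χ : Euc p → ℂ} (hf : SupportedIn Ω₁ K R f)
    (hφ : IsPhase φ) (hχ : IsCutoff χ) (h : ℕ) :
    SupportedIn Ω₁ K R ((opL χ φ.1)^[h] f) := by
  induction h with
  | zero => exact hf
  | succ h ih =>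
    rw [Function.iterate_succ_apply']
    exact ih.map_opL hφ hχ

theorem hasCompactSupport_slice (h0 : ∀ z, (z.2.1 ∉ K.1 ∨ R < ‖z.2.2‖) → f z = 0) (x : Euc n₁) :
    HasCompactSupport fun q => f (x, q) := by
  refine HasCompactSupport.intro (K.2.1.prod (isCompact_closedBall (0 : Euc p) R)) fun q hq => ?_
  refine h0 (x, q) ?_
  by_contra! h
  exact hq ⟨h.1, by simpa using h.2⟩

theorem integrable_slice (hc : ContinuousOn f (fullDomain p Ω₁ Ω))
    (h0 : ∀ z, (z.2.1 ∉ K.1 ∨ R < ‖z.2.2‖) → f z = 0) {x : Euc n₁} (hx : x ∈ Ω₁) :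
    Integrable fun q => f (x, q) := by
  refine Continuous.integrable_of_hasCompactSupport ?_ (hasCompactSupport_slice h0 x)
  rw [continuous_iff_continuousAt]
  intro q
  have h1 : ContinuousAt f (x, q) := by
    by_cases hq : q.1 ∈ K.1
    · exact hc.continuousAt ((isOpen_fullDomain Ω₁ Ω).mem_nhds ⟨hx, K.2.2 hq⟩)
    · have : f =ᶠ[𝓝 (x, q)] fun _ => 0 :=
        Filter.mem_of_superset ((isOpen_outside K R).mem_nhds (Or.inl hq)) fun z hz => h0 z hz
      exact continuousAt_const.congr this.symm
  exact ContinuousAt.comp (f := fun q => (x, q)) h1 (by fun_prop)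

/-- The integral of a derivative of a function with compact support in `(y, ξ)`, smooth for
`|ξ| > 1/8` and zero for small `ξ`, vanishes. -/
theorem integral_pderiv_slice
    (hs : ContDiffOn ℝ ∞ f {z | z ∈ fullDomain p Ω₁ Ω ∧ 1 / 8 < ‖z.2.2‖})
    (hn : ∀ z, ‖z.2.2‖ < 1 / 4 → f z = 0)
    (h0 : ∀ z, (z.2.1 ∉ K.1 ∨ R < ‖z.2.2‖) → f z = 0) {x : Euc n₁} (hx : x ∈ Ω₁)
    (d : Fin n ⊕ Fin p) :
    Integrable (fun q => pderiv dirVec [.inr d] f (x, q)) ∧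
      ∫ q, pderiv dirVec [.inr d] f (x, q) = 0 := by
  have hU : IsOpen {z : Var n₁ n p | z ∈ fullDomain p Ω₁ Ω ∧ 1 / 8 < ‖z.2.2‖} :=
    (symFrame 1 0 (1 / 8) (emptyCompact (base Ω₁ Ω))).isOpen_U
  -- Every point either lies in the region where `f` is smooth or has a neighbourhood on which `f`
  -- vanishes.
  have hf : ∀ q : Euc n × Euc p, ContDiffAt ℝ ∞ f (x, q) := by
    intro q
    by_cases hq : q.1 ∈ K.1
    · by_cases hξ : ‖q.2‖ < 1 / 4
      · have : f =ᶠ[𝓝 (x, q)] fun _ => 0 :=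
          Filter.mem_of_superset (isOpen_near.mem_nhds hξ) fun z hz => hn z hz
        exact contDiffAt_const.congr_of_eventuallyEq this
      · exact hs.contDiffAt (hU.mem_nhds ⟨⟨hx, K.2.2 hq⟩, by
          change 1 / 8 < ‖q.2‖; linarith⟩)
    · have : f =ᶠ[𝓝 (x, q)] fun _ => 0 :=
        Filter.mem_of_superset ((isOpen_outside K R).mem_nhds (Or.inl hq)) fun z hz => h0 z hz
      exact contDiffAt_const.congr_of_eventuallyEq this
  have hF : ContDiff ℝ ∞ fun q => f (x, q) := contDiff_iff_contDiffAt.2 fun q =>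
    ContDiffAt.comp (f := fun q => (x, q)) q (hf q) (by fun_prop)
  set v : Euc n × Euc p := (dirVec (.inr d) : Var n₁ n p).2
  have hv : (dirVec (.inr d) : Var n₁ n p) = ContinuousLinearMap.inr ℝ (Euc n₁) _ v := by
    rcases d with k | j <;> simp [v, dirVec]
  have hd : ∀ q, pderiv dirVec [.inr d] f (x, q) = fderiv ℝ (fun q => f (x, q)) q v := by
    intro q
    have h1 := HasFDerivAt.comp (g := f) (f := fun q => (x, q)) q
      ((hf q).differentiableAt (by simp)).hasFDerivAt (hasFDerivAt_prodMk_right x q)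
    simp only [pderiv]
    rw [show fderiv ℝ (fun q => f (x, q)) q = _ from h1.fderiv, hv]
    rfl
  have hcs := hasCompactSupport_slice h0 x
  have hi : Integrable fun q => fderiv ℝ (fun q => f (x, q)) q v :=
    ((hF.continuous_fderiv (by simp)).clm_apply continuous_const).integrable_of_hasCompactSupport
      (hcs.fderiv_apply ℝ v)
  simp only [hd]
  refine ⟨hi, ?_⟩
  have : (volume : Measure (Euc n × Euc p)).IsAddHaarMeasure := by
    rw [Measure.volume_eq_prod]; infer_instance
  -- Integration by parts against the constant function `1`.
  have := integral_mul_fderiv_eq_neg_fderiv_mul_of_integrable (μ := volume)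
    (f := fun _ : Euc n × Euc p => (1 : ℂ)) (g := fun q => f (x, q)) (v := v)
    (by simp) (by simpa using hi)
    (by simpa using hF.continuous.integrable_of_hasCompactSupport hcs) (by fun_prop)
    (fun q _ => hF.differentiable (by simp) q)
  simpa using this

/-! ### The transpose of `L_φ` and the oscillating factor -/

section Transpose

variable {φ : HgSpace p Ω₁ Ω} {χ : Euc p → ℂ}

/-- The vector field in `L_φ`, applied to `iφ`: the two factors `i` give `-1`, and `|∂_ξ φ|² + |ξ|⁻²
|∂_y φ|²` cancels against the inverse gradient in the coefficients, leaving `-(1 - χ)`. -/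
theorem IsPhase.sum_coeff (hφ : IsPhase φ) {z : Var n₁ n p} (hz : z ∈ fullDomain p Ω₁ Ω)
    (h0 : z.2.2 ≠ 0) :
    ∑ j, Complex.I * pderiv dirVec [dirXi j] φ.1 z * coeffA χ φ.1 j z +
      ∑ k, Complex.I * pderiv dirVec [dirY k] φ.1 z * coeffB χ φ.1 k z = χ z.2.2 - 1 := by
  have hG := hφ.gradC_eq hz h0
  have hG0 : (gradSq φ.1 (toSphere z) : ℂ) ≠ 0 := by
    exact_mod_cast hφ.gradSq_toSphere_ne_zero hz h0
  have h1 : ∑ j, Complex.I * pderiv dirVec [dirXi j] φ.1 z * coeffA χ φ.1 j z +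
      ∑ k, Complex.I * pderiv dirVec [dirY k] φ.1 z * coeffB χ φ.1 k z =
      (χ z.2.2 - 1) * (gradSq φ.1 (toSphere z) : ℂ)⁻¹ * gradC φ.1 z := by
    simp only [gradC, mul_add, Finset.mul_sum]
    congr 1
    · refine Finset.sum_congr rfl fun j _ => ?_
      simp only [coeffA]
      push_cast
      linear_combination (1 - χ z.2.2) * (gradSq φ.1 (toSphere z) : ℂ)⁻¹ *
        pderiv dirVec [dirXi j] φ.1 z ^ 2 * Complex.I_mul_I
    · refine Finset.sum_congr rfl fun k _ => ?_
      simp only [coeffB]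
      push_cast
      linear_combination (1 - χ z.2.2) * ((‖z.2.2‖ : ℂ) ^ 2)⁻¹ *
        (gradSq φ.1 (toSphere z) : ℂ)⁻¹ * pderiv dirVec [dirY k] φ.1 z ^ 2 * Complex.I_mul_I
  rw [h1, hG, mul_assoc, inv_mul_cancel₀ hG0, mul_one]

/-- The transpose of `L_φ` maps `e^{iφ}` to itself, up to derivatives. -/
theorem IsPhase.exp_mul_opL (hφ : IsPhase φ) (hχ : IsCutoff χ) {z : Var n₁ n p}
    (hf : ContDiffOn ℝ ∞ f (fullDomain p Ω₁ Ω)) (hz : z ∈ fullDomain p Ω₁ Ω) :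
    Complex.exp (Complex.I * φ.1 z) * opL χ φ.1 f z = Complex.exp (Complex.I * φ.1 z) * f z +
      (∑ j, pderiv dirVec [dirXi j]
        (fun z => Complex.exp (Complex.I * φ.1 z) * coeffA χ φ.1 j z * f z) z +
      ∑ k, pderiv dirVec [dirY k]
        (fun z => Complex.exp (Complex.I * φ.1 z) * coeffB χ φ.1 k z * f z) z) := by
  -- Here `φ` need not be differentiable, but the coefficients vanish near `z` and `χ = 1`, so `L_φ`
  -- acts as the identity.
  by_cases hξ : ‖z.2.2‖ < 1 / 4
  · have hA : ∀ j, pderiv dirVec [dirXi j] (coeffA χ φ.1 j) z = 0 := fun j =>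
      pderiv_eq_zero isOpen_near (fun _ h => hχ.coeffA_eq_zero φ.1 j h) _ hξ
    have hB : ∀ k, pderiv dirVec [dirY k] (coeffB χ φ.1 k) z = 0 := fun k =>
      pderiv_eq_zero isOpen_near (fun _ h => hχ.coeffB_eq_zero φ.1 k h) _ hξ
    have hA' : ∀ j, pderiv dirVec [dirXi j]
        (fun z => Complex.exp (Complex.I * φ.1 z) * coeffA χ φ.1 j z * f z) z = 0 := fun j =>
      pderiv_eq_zero isOpen_near
        (fun z h => by simp [hχ.coeffA_eq_zero φ.1 j (z := z) h]) _ hξ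
    have hB' : ∀ k, pderiv dirVec [dirY k]
        (fun z => Complex.exp (Complex.I * φ.1 z) * coeffB χ φ.1 k z * f z) z = 0 := fun k =>
      pderiv_eq_zero isOpen_near
        (fun z h => by simp [hχ.coeffB_eq_zero φ.1 k (z := z) h]) _ hξ
    simp [opL, coeffC, hA, hB, hA', hB', hχ.coeffA_eq_zero φ.1 _ hξ,
      hχ.coeffB_eq_zero φ.1 _ hξ, hχ.eq_one _ hξ]
  · have h0 : z.2.2 ≠ 0 := ne_zero_of_far (by linarith)
    have hU := isOpen_fullDomain (p := p) Ω₁ Ω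
    have hdφ := φ.differentiableAt hz h0
    have hdE : DifferentiableAt ℝ (fun z => Complex.exp (Complex.I * φ.1 z)) z :=
      (hdφ.const_mul Complex.I).cexp
    have hdf := differentiableAt_of_contDiffOn hU hf hz
    have key : ∀ (d : Dir n₁ n p) (c : Var n₁ n p → ℂ), ContDiffOn ℝ ∞ c (fullDomain p Ω₁ Ω) →
        pderiv dirVec [d] (fun z => Complex.exp (Complex.I * φ.1 z) * c z * f z) z =
        Complex.exp (Complex.I * φ.1 z) * (c z * pderiv dirVec [d] f z) +
        Complex.exp (Complex.I * φ.1 z) * f z * pderiv dirVec [d] c z +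
        Complex.exp (Complex.I * φ.1 z) * f z * (Complex.I * pderiv dirVec [d] φ.1 z * c z) := by
      intro d c hc
      have hdc := differentiableAt_of_contDiffOn hU hc hz
      have hdEc : DifferentiableAt ℝ (fun z => Complex.exp (Complex.I * φ.1 z) * c z) z :=
        hdE.mul hdc
      rw [pderiv_single_mul hdEc hdf, pderiv_single_mul hdE hdc, pderiv_single_exp hdφ]
      ring
    simp only [key _ _ (hφ.contDiffOn_coeffA hχ _), key _ _ (hφ.contDiffOn_coeffB hχ _)]
    simp only [Finset.sum_add_distrib, ← Finset.mul_sum]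
    -- The divergence part of `c` is matched by the derivatives of the coefficients; what is left is
    -- `χ` minus the sum of `i ∂φ` times the coefficients, which equals `1`.
    have hsum := hφ.sum_coeff (χ := χ) hz h0
    simp only [opL, coeffC]
    linear_combination -(Complex.exp (Complex.I * φ.1 z) * f z) * hsum

theorem SupportedIn.integrable_exp_mul (hf : SupportedIn Ω₁ K R f) (hφ : IsPhase φ)
    {x : Euc n₁} (hx : x ∈ Ω₁) :
    Integrable fun q => Complex.exp (Complex.I * φ.1 (x, q)) * f (x, q) :=
  integrable_slice (f := fun z => Complex.exp (Complex.I * φ.1 z) * f z)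
    (((continuousOn_const.mul hφ.continuousOn).cexp).mul hf.smooth.continuousOn)
    (fun z hz => by rw [hf.eq_zero z hz, mul_zero]) hx

theorem SupportedIn.integral_exp_mul_opL (hf : SupportedIn Ω₁ K R f) (hφ : IsPhase φ)
    (hχ : IsCutoff χ) {x : Euc n₁} (hx : x ∈ Ω₁) :
    ∫ q, Complex.exp (Complex.I * φ.1 (x, q)) * opL χ φ.1 f (x, q) =
      ∫ q, Complex.exp (Complex.I * φ.1 (x, q)) * f (x, q) := by
  have hsm : ∀ c : Var n₁ n p → ℂ, ContDiffOn ℝ ∞ c (fullDomain p Ω₁ Ω) →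
      ContDiffOn ℝ ∞ (fun z => Complex.exp (Complex.I * φ.1 z) * c z * f z)
        {z | z ∈ fullDomain p Ω₁ Ω ∧ 1 / 8 < ‖z.2.2‖} := fun c hc =>
    (((contDiffOn_const.mul (φ.2.1.mono fun z hz => ⟨hz.1, ne_zero_of_far hz.2⟩)).cexp).mul
      (hc.mono fun z hz => hz.1)).mul (hf.smooth.mono fun z hz => hz.1)
  have hz0 : ∀ c : Var n₁ n p → ℂ, ∀ z : Var n₁ n p, (z.2.1 ∉ K.1 ∨ R < ‖z.2.2‖) →
      Complex.exp (Complex.I * φ.1 z) * c z * f z = 0 := fun c z hz => by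
    rw [hf.eq_zero z hz, mul_zero]
  have hA := fun j => integral_pderiv_slice (hsm _ (hφ.contDiffOn_coeffA hχ j))
    (fun z hz => by rw [hχ.coeffA_eq_zero _ _ hz, mul_zero, zero_mul]) (hz0 _) hx (.inr j)
  have hB := fun k => integral_pderiv_slice (hsm _ (hφ.contDiffOn_coeffB hχ k))
    (fun z hz => by rw [hχ.coeffB_eq_zero _ _ hz, mul_zero, zero_mul]) (hz0 _) hx (.inl k)
  have hpt : ∀ q, Complex.exp (Complex.I * φ.1 (x, q)) * opL χ φ.1 f (x, q) =
      Complex.exp (Complex.I * φ.1 (x, q)) * f (x, q) +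
      (∑ j, pderiv dirVec [dirXi j]
        (fun z => Complex.exp (Complex.I * φ.1 z) * coeffA χ φ.1 j z * f z) (x, q) +
      ∑ k, pderiv dirVec [dirY k]
        (fun z => Complex.exp (Complex.I * φ.1 z) * coeffB χ φ.1 k z * f z) (x, q)) := by
    intro q
    by_cases hq : q.1 ∈ K.1
    · exact hφ.exp_mul_opL hχ (z := (x, q)) hf.smooth ⟨hx, K.2.2 hq⟩
    -- Off `K` the pointwise identity cannot be quoted, as `q.1` may lie outside `Ω`, but all terms
    -- vanish.
    · have hW : (x, q) ∈ {z : Var n₁ n p | z.2.1 ∉ K.1 ∨ R < ‖z.2.2‖} := Or.inl hq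
      have h1 := fun (c : Var n₁ n p → ℂ) (d : Dir n₁ n p) =>
        pderiv_eq_zero (e := dirVec) (isOpen_outside K R) (hz0 c) [d] hW
      have h2 := (hf.map_opL hφ hχ).eq_zero _ hW
      simp only [h1, h2, hf.eq_zero _ hW, Finset.sum_const_zero, mul_zero, add_zero]
  simp_rw [hpt]
  rw [integral_add (hf.integrable_exp_mul hφ hx), integral_add, integral_finsetSum _ fun j _ =>
    (hA j).1, integral_finsetSum _ fun k _ => (hB k).1]
  · simp only [(hA _).2, (hB _).2, Finset.sum_const_zero, add_zero]
  · exact integrable_finsetSum _ fun j _ => (hA j).1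
  · exact integrable_finsetSum _ fun k _ => (hB k).1
  · exact (integrable_finsetSum _ fun j _ => (hA j).1).add
      (integrable_finsetSum _ fun k _ => (hB k).1)

theorem SupportedIn.integral_exp_mul_opL_iterate (hf : SupportedIn Ω₁ K R f) (hφ : IsPhase φ)
    (hχ : IsCutoff χ) {x : Euc n₁} (hx : x ∈ Ω₁) (h : ℕ) :
    ∫ q, Complex.exp (Complex.I * φ.1 (x, q)) * (opL χ φ.1)^[h] f (x, q) =
      ∫ q, Complex.exp (Complex.I * φ.1 (x, q)) * f (x, q) := by
  induction h generalizing f with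
  | zero => rfl
  | succ h ih => rw [Function.iterate_succ_apply, ih (hf.map_opL hφ hχ), hf.integral_exp_mul_opL hφ hχ hx]

end Transpose

/-! ## Independence of the regularization -/

section Regularization

variable {φ : HgSpace p Ω₁ Ω} {χ χ₀ : Euc p → ℂ} {m ρ δ : ℝ}

/-- The oscillatory integral over a set that contains the support of `u` is the limit of integrals
with compact support. -/
theorem tendsto_oscInt (hφ : IsPhase φ) (hχ : IsCutoff χ) (hχ₀ : IsCutoff χ₀) (hρ : ρ ≤ 1)
    (hδ : 0 ≤ δ) (a : SymbolSpace p Ω₁ Ω m ρ δ) (u : CSpace ⊤ Ω)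
    (hu : ∀ y ∉ K.1, u.1 y = 0) {h : ℕ} (hm : m - h * min ρ (1 - δ) < -(p : ℝ))
    {x : Euc n₁} (hx : x ∈ Ω₁) :
    Tendsto (fun N : ℕ => ∫ q : Euc n × Euc p, ((((2 * Real.pi) ^ p)⁻¹ : ℝ) : ℂ) *
        (Complex.exp (Complex.I * φ.1 (x, q)) *
          (χ₀ ((N + 1 : ℝ)⁻¹ • q.2) * (a.1 (x, q) * u.1 q.1)))) atTop
      (𝓝 (oscInt χ φ.1 a.1 u.1 h K.1 x)) := by
  let g : Var n₁ n p → ℂ := fun z => a.1 z * u.1 z.2.1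
  let gN : ℕ → Var n₁ n p → ℂ := fun N z => χ₀ ((N + 1 : ℝ)⁻¹ • z.2.2) * g z
  -- All indices share the parameter `1`, so a moderate bound is a single number, that is, a bound
  -- uniform in `N`.
  let τ : ℕ → Eps := fun _ => ⟨1, one_pos, le_rfl⟩
  let K₁ : CompactIn (Ω₁ : Set (Euc n₁)) := ⟨{x}, isCompact_singleton, singleton_subset_iff.2 hx⟩
  have hg : NetBound (symFrame ρ δ (-1) (prodCompact K₁ K)) (modIdeal τ) (m + 0) (0 + h)
      fun _ => g :=
    NetBound.mul (netBound_symbol (fun _ => a) (const_mem_modIdeal _))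
      (netBound_comp_y (K := prodCompact K₁ K) (L := K) (fun q hq => hq.2) hδ (fun _ => u) (const_mem_modIdeal _))
  have hgN : NetBound (symFrame ρ δ (-1) (prodCompact K₁ K)) (modIdeal τ) m (0 + h) gN := by
    refine ((netBound_dilation hχ₀.smooth hχ₀.eq_zero (fun N : ℕ => N) hρ hδ).mul hg).mono ?_
    linarith
  have hL := (((hφ.family τ (prodCompact K₁ K)).refl (modIdeal τ)).pair_opL_iterate hχ hρ hδ h
    (PairBound.refl hgN)).1
  obtain ⟨C, hC, hCb⟩ := hL.value
  obtain ⟨B, -, hB⟩ := mem_modIdeal.1 hC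
  have hsm : ContDiffOn ℝ ∞ g (fullDomain p Ω₁ Ω) := by
    have := hg.1 0
    rwa [symFrame_U_neg_one] at this
  have hsmN : ∀ N, ContDiffOn ℝ ∞ (gN N) (fullDomain p Ω₁ Ω) := fun N => by
    have := hgN.1 N
    rwa [symFrame_U_neg_one] at this
  have hsupp : ∀ N : ℕ, SupportedIn Ω₁ K ((N + 1 : ℝ) / 2) (gN N) := by
    refine fun N => ⟨hsmN N, fun z hz => ?_⟩
    rcases hz with hz | hz
    · simp only [gN, g, hu _ hz, mul_zero]
    · have h1 : 1 / 2 < ‖(N + 1 : ℝ)⁻¹ • z.2.2‖ := by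
        have hN : (0 : ℝ) < N + 1 := by positivity
        rw [norm_smul, Real.norm_of_nonneg (by positivity), ← div_eq_inv_mul, lt_div_iff₀ hN]
        linarith
      simp only [gN, hχ₀.eq_zero _ h1, zero_mul]
  have hW : IsOpen {z : Var n₁ n p | z.2.1 ∉ K.1} :=
    K.2.1.isClosed.isOpen_compl.preimage (continuous_fst.comp continuous_snd)
  -- The cut-off `χ₀` makes the support compact, so `L_φ^h` may be inserted by integration by parts;
  -- the integrals then acquire a common integrable majorant.
  have hrw : ∀ N : ℕ, ∫ q : Euc n × Euc p, ((((2 * Real.pi) ^ p)⁻¹ : ℝ) : ℂ) *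
      (Complex.exp (Complex.I * φ.1 (x, q)) *
        (χ₀ ((N + 1 : ℝ)⁻¹ • q.2) * (a.1 (x, q) * u.1 q.1))) =
      ∫ q in K.1 ×ˢ univ, ((((2 * Real.pi) ^ p)⁻¹ : ℝ) : ℂ) *
        (Complex.exp (Complex.I * φ.1 (x, q)) * (opL χ φ.1)^[h] (gN N) (x, q)) := by
    intro N
    rw [integral_const_mul, integral_const_mul]
    congr 1
    refine ((hsupp N).integral_exp_mul_opL_iterate hφ hχ hx h).symm.trans ?_
    refine (setIntegral_eq_integral_of_forall_compl_eq_zero fun q hq => ?_).symm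
    have hq1 : (x, q) ∈ {z : Var n₁ n p | z.2.1 ∉ K.1} := fun h => hq ⟨h, trivial⟩
    rw [opL_iterate_eq_zero hW (fun z hz => (hsupp N).eq_zero z (Or.inl hz)) h hq1, mul_zero]
  simp_rw [hrw]
  have hKm : MeasurableSet (K.1 ×ˢ (univ : Set (Euc p))) :=
    K.2.1.measurableSet.prod MeasurableSet.univ
  refine tendsto_integral_of_dominated_convergence
    (fun q => (((2 * Real.pi) ^ p)⁻¹ : ℝ) *
      (|B ⟨1, one_pos, le_rfl⟩| * bracket q.2 ^ (m - h * min ρ (1 - δ)))) ?_ ?_ ?_ ?_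
  · intro N
    have hsL : SupportedIn Ω₁ K ((N + 1 : ℝ) / 2) ((opL χ φ.1)^[h] (gN N)) := by
      exact (hsupp N).map_opL_iterate hφ hχ h
    exact (((hsL.integrable_exp_mul hφ hx).const_mul _).integrableOn).aestronglyMeasurable
  · exact ((integrableOn_bracket_rpow hm K.2.1).const_mul _).const_mul _
  · intro N
    filter_upwards [ae_restrict_mem hKm] with q hq
    have hmem : (x, q) ∈ fullDomain p Ω₁ Ω := ⟨hx, K.2.2 hq.1⟩
    rw [norm_mul, norm_mul, hφ.norm_exp hmem, one_mul, Complex.norm_real,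
      Real.norm_of_nonneg (by positivity)]
    refine mul_le_mul_of_nonneg_left ?_ (by positivity)
    refine (hCb N (x, q) ⟨⟨rfl, hq.1⟩, ?_⟩).trans ?_
    · change -1 < ‖q.2‖
      linarith [norm_nonneg q.2]
    · have hb := one_le_bracket q.2
      exact mul_le_mul_of_nonneg_right ((le_abs_self _).trans (hB N)) (by positivity)
  · filter_upwards [ae_restrict_mem hKm] with q hq
    -- At a fixed point the sequence is eventually constant: the dilated cut-off is `1` on the open
    -- set `|ξ| < (N + 1) / 4`, and `L_φ^h` is local.
    refine tendsto_const_nhds.congr' ?_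
    obtain ⟨N₀, hN₀⟩ := exists_nat_gt (4 * ‖q.2‖)
    filter_upwards [eventually_ge_atTop N₀] with N hN
    have hN' : (N₀ : ℝ) ≤ N := by exact_mod_cast hN
    have hpos : (0 : ℝ) < N + 1 := by positivity
    have hV : IsOpen {z : Var n₁ n p | ‖z.2.2‖ < (N + 1) / 4} :=
      isOpen_lt (continuous_norm.comp (continuous_snd.comp continuous_snd)) continuous_const
    have hE : EqOn g (gN N) {z : Var n₁ n p | ‖z.2.2‖ < (N + 1) / 4} := by
      intro z hz
      have h1 : ‖(N + 1 : ℝ)⁻¹ • z.2.2‖ < 1 / 4 := by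
        rw [norm_smul, Real.norm_of_nonneg (by positivity), ← div_eq_inv_mul, div_lt_iff₀ hpos]
        have : ‖z.2.2‖ < (N + 1) / 4 := hz
        linarith
      simp only [gN, hχ₀.eq_one _ h1, one_mul]
    have hqV : (x, q) ∈ {z : Var n₁ n p | ‖z.2.2‖ < (N + 1) / 4} := by
      change ‖q.2‖ < _
      linarith
    simp only [integrand]
    rw [← opL_iterate_congr (χ := χ) (φ := φ.1) hV hE h hqV]

/-- The oscillatory integral does not depend on the cut-off, on the number of applications of
`L_φ`, and on the domain of integration. -/
theorem oscInt_eq (hφ : IsPhase φ) (hχ : IsCutoff χ) (hχ₀ : IsCutoff χ₀) (hρ : ρ ≤ 1)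
    (hδ : 0 ≤ δ) (a : SymbolSpace p Ω₁ Ω m ρ δ) (u : CSpace ⊤ Ω)
    {K' : CompactIn (Ω : Set (Euc n))} (hu : ∀ y ∉ K.1, u.1 y = 0) (hu' : ∀ y ∉ K'.1, u.1 y = 0)
    {h h' : ℕ} (hm : m - h * min ρ (1 - δ) < -(p : ℝ)) (hm' : m - h' * min ρ (1 - δ) < -(p : ℝ))
    {x : Euc n₁} (hx : x ∈ Ω₁) :
    oscInt χ φ.1 a.1 u.1 h K.1 x = oscInt χ₀ φ.1 a.1 u.1 h' K'.1 x :=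
  -- Both sides are limits of the same integrals, regularized by dilations of `χ`; these involve
  -- neither `h` nor `h'` nor the compact sets.
  tendsto_nhds_unique (tendsto_oscInt hφ hχ hχ hρ hδ a u hu hm hx)
    (tendsto_oscInt hφ hχ₀ hχ hρ hδ a u hu' hm' hx)

end Regularization

end IntegrationByParts

/-! ## Representatives -/

section Representatives

theorem GenModule.mk_eq_mk_iff {E ι : Type} [AddCommGroup E] [Module ℂ E] {P : ι → Seminorm ℂ E}
    {u v : moderateNets P} :
    GenModule.mk P u = GenModule.mk P v ↔ u.1 - v.1 ∈ negligibleNets P :=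
  Submodule.Quotient.eq _

theorem GenModule.exists_smul_add_rep {E ι : Type} [AddCommGroup E] [Module ℂ E]
    {P : ι → Seminorm ℂ E} (z : moderateNumbers) (u v : moderateNets P) :
    ∃ w : moderateNets P, GenModule.mk P w = GenNumber.mk z • GenModule.mk P u + GenModule.mk P v ∧
      ∀ ε, w.1 ε = z.1 ε • u.1 ε + v.1 ε :=
  ⟨z • u + v, rfl, fun _ => rfl⟩

theorem smul_mem_negligibleNets {E ι : Type} [AddCommGroup E] [Module ℂ E]
    {P : ι → Seminorm ℂ E} (z : moderateNumbers) {u : Eps → E} (hu : u ∈ negligibleNets P) :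
    (fun ε => z.1 ε • u ε) ∈ negligibleNets P :=
  Submodule.smul_mem _ z hu

variable {n₁ n p : ℕ} {Ω₁ : TopologicalSpace.Opens (Euc n₁)} {Ω : TopologicalSpace.Opens (Euc n)}
  {T : Type} {τ : T → Eps} {I : BoundIdeal τ}

theorem comp_mem_negIdeal {B : Eps → ℝ} (h : IsNegligible B) :
    (fun t => B (τ t)) ∈ (negIdeal τ).carrier :=
  ⟨B, h, fun _ => le_rfl⟩

theorem IsNegligible.of_mem_negIdeal {B : Eps → ℝ} (h : B ∈ (negIdeal (id : Eps → Eps)).carrier) :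
    IsNegligible B := by
  obtain ⟨D, hD, hB⟩ := h
  exact hD.mono hB

theorem IsModerate.of_mem_modIdeal {B : Eps → ℝ} (h : B ∈ (modIdeal (id : Eps → Eps)).carrier) :
    IsModerate B := by
  obtain ⟨D, hD, hB⟩ := mem_modIdeal.1 h
  exact hD.mono hB

theorem eventually_le_epsZero (η : Eps) : ∀ᶠ ε in epsZero, ε ≤ η := by
  filter_upwards [preimage_mem_comap (m := fun ε : Eps => (ε : ℝ)) (gt_mem_nhds η.2.1)] with ε h
  exact le_of_lt (Set.mem_preimage.1 h)

theorem isModerate_of_le {f : Eps → ℝ} {r : ℝ} {η : Eps} (h : ∀ ε ≤ η, |f ε| ≤ (ε : ℝ) ^ (-r)) :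
    IsModerate f := by
  obtain ⟨N, hN⟩ := exists_nat_ge r
  refine ⟨N, IsOrder.weaken (b := -r) ?_ (by linarith)⟩
  refine Asymptotics.IsBigO.of_bound 1 ((eventually_le_epsZero η).mono fun ε hε => ?_)
  rw [one_mul]
  exact (h ε hε).trans (le_abs_self _)

theorem PhaseNet.family (φN : PhaseNet p Ω₁ Ω) (τ : T → Eps) (K : CompactIn (base Ω₁ Ω)) :
    PhaseFamily τ K fun t => φN.net (τ t) := by
  refine ⟨fun t => φN.isPhase _, fun i => comp_mem_modIdeal (φN.moderate (K, i)), ?_⟩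
  let K₁ : CompactIn (Ω₁ : Set (Euc n₁)) := ⟨Prod.fst '' K.1, K.2.1.image continuous_fst, by
    rintro _ ⟨q, hq, rfl⟩; exact (K.2.2 hq).1⟩
  let K₂ : CompactIn (Ω : Set (Euc n)) := ⟨Prod.snd '' K.1, K.2.1.image continuous_snd, by
    rintro _ ⟨q, hq, rfl⟩; exact (K.2.2 hq).2⟩
  obtain ⟨r, -, η, hη⟩ := φN.strictlyNonzero K₁ K₂
  choose c hc using fun ε => (φN.isPhase ε).exists_gradSq_inv_le K
  classical
  -- For `ε > η` only compactness yields a bound, for each `ε` separately; moderateness ignores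
  -- these values.
  let B : Eps → ℝ := fun ε => if ε ≤ η then (ε : ℝ) ^ (-r) else c ε
  have hB : IsModerate B := by
    refine isModerate_of_le (r := r) (η := η) fun ε hε => ?_
    simp only [B, if_pos hε]
    rw [abs_of_nonneg (Real.rpow_nonneg ε.2.1.le _)]
  refine ⟨_, comp_mem_modIdeal hB, fun t z hz h0 => ?_⟩
  simp only [B]
  split_ifs with h
  · have hpos : (0 : ℝ) < (τ t : ℝ) := (τ t).2.1
    rw [Real.rpow_neg hpos.le]
    exact inv_anti₀ (Real.rpow_pos_of_pos hpos _)
      (hη _ h z.1 ⟨_, hz, rfl⟩ z.2.1 ⟨_, hz, rfl⟩ z.2.2 h0)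
  · exact hc _ z hz h0

theorem PhaseNet.pair {φN φN' : PhaseNet p Ω₁ Ω}
    (h : (Quotient.mk _ φN : GenPhase p Ω₁ Ω) = Quotient.mk _ φN') (τ : T → Eps)
    (K : CompactIn (base Ω₁ Ω)) :
    PhasePair (negIdeal τ) K (fun t => φN.net (τ t)) fun t => φN'.net (τ t) :=
  ⟨φN.family τ K, φN'.family τ K, fun i => comp_mem_negIdeal (Quotient.exact h (K, i))⟩

/-! ## Seminorms of smooth functions -/

section Seminorms

variable {r : ℕ∞} {K : CompactIn (Ω : Set (Euc n))} {i : ℕ}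

/-- Only finitely many lists have length at most `i`, so the sum of the bounds for single
derivatives bounds the supremum. -/
theorem seminorm_mem {v : T → CSpace r Ω}
    (h : ∀ l : List (Fin n), l.length ≤ i → (l.length : ℕ∞) ≤ r → ∃ C ∈ I.carrier,
      ∀ t, ∀ x ∈ K.1, ‖pderiv (fun j => EuclideanSpace.single j (1 : ℝ)) l (v t).1 x‖ ≤ C t) :
    (fun t => (smoothSystem r Ω).seminorm (K, i) (v t)) ∈ I.carrier := by
  have h' : ∀ l : List (Fin n), ∃ C ∈ I.carrier, l.length ≤ i → (l.length : ℕ∞) ≤ r →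
      ∀ t, ∀ x ∈ K.1, ‖pderiv (fun j => EuclideanSpace.single j (1 : ℝ)) l (v t).1 x‖ ≤ C t := by
    intro l
    by_cases hl : l.length ≤ i ∧ (l.length : ℕ∞) ≤ r
    · obtain ⟨C, hC, hb⟩ := h l hl.1 hl.2
      exact ⟨C, hC, fun _ _ => hb⟩
    · exact ⟨_, I.zero_mem, fun h1 h2 => absurd ⟨h1, h2⟩ hl⟩
  choose C hC hb using h'
  let s : Finset (List (Fin n)) := (List.finite_length_le (Fin n) i).toFinset
  refine I.mono_mem (I.sum_mem s (g := fun l t => |C l t|) fun l _ => I.abs_mem (hC l)) fun t => ?_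
  rw [abs_of_nonneg (apply_nonneg _ _)]
  refine le_trans ?_ (le_abs_self _)
  have h0 : 0 ≤ ∑ l ∈ s, |C l t| := Finset.sum_nonneg fun l _ => abs_nonneg _
  refine Real.iSup_le ?_ h0
  rintro ⟨⟨l, x⟩, hx, hl, hr⟩
  have h1 : |C l t| ≤ ∑ l ∈ s, |C l t| :=
    Finset.single_le_sum (f := fun l => |C l t|) (fun l _ => abs_nonneg _)
      ((List.finite_length_le (Fin n) i).mem_toFinset.2 hl)
  refine le_trans ?_ ((le_abs_self _).trans h1)
  simpa [WeightSystem.value, smoothSystem] using hb l hl hr t x hx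

/-- All the derivatives of functions on `Ω`, without weights. -/
def flatFrame (K : CompactIn (Ω : Set (Euc n))) : Frame (Fin n) (Euc n) where
  e j := EuclideanSpace.single j 1
  cost _ := 0
  b _ := 1
  one_le_b _ := le_rfl
  U := Ω
  isOpen_U := Ω.isOpen
  S := K.1
  S_subset := K.2.2

theorem netBound_flatFrame {v : T → CSpace ⊤ Ω}
    (h : (fun t => (smoothSystem ⊤ Ω).seminorm (K, i) (v t)) ∈ I.carrier) :
    NetBound (flatFrame K) I 0 i fun t => (v t).1 := by
  refine ⟨fun t => (v t).2.1, fun l hl => ⟨_, h, fun t x hx => ?_⟩⟩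
  have := (smoothSystem ⊤ Ω).value_le_seminorm (v t) (k := K) hx hl le_top
  simpa [flatFrame, smoothSystem] using this

theorem NetBound.pderiv_le {v : T → Euc n → ℂ} {μ : ℝ} (h : NetBound (flatFrame K) I μ i v)
    (l : List (Fin n)) (hl : l.length ≤ i) : ∃ C ∈ I.carrier,
      ∀ t, ∀ x ∈ K.1, ‖pderiv (fun j => EuclideanSpace.single j (1 : ℝ)) l (v t) x‖ ≤ C t := by
  obtain ⟨C, hC, hb⟩ := h.2 l hl
  exact ⟨C, hC, fun t x hx => by simpa [flatFrame] using hb t x hx⟩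

theorem seminorm_le_incl {k : ℕ} (hi : i ≤ k) (f : CSpace ⊤ Ω) :
    (smoothSystem ⊤ Ω).seminorm (K, i) f ≤ (smoothSystem k Ω).seminorm (K, i) (f.incl k Ω) := by
  refine Real.iSup_le ?_ (apply_nonneg _ _)
  rintro ⟨⟨l, x⟩, hx, hl, hr⟩
  exact (smoothSystem k Ω).value_le_seminorm (f.incl k Ω) (k := K) hx hl
    (by simp only [smoothSystem]; exact_mod_cast hl.trans hi)

theorem seminorm_incl_le (f : CSpace ⊤ Ω) :
    (smoothSystem r Ω).seminorm (K, i) (f.incl r Ω) ≤ (smoothSystem ⊤ Ω).seminorm (K, i) f := by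
  refine Real.iSup_le ?_ (apply_nonneg _ _)
  rintro ⟨⟨l, x⟩, hx, hl, hr⟩
  exact (smoothSystem ⊤ Ω).value_le_seminorm f (k := K) hx hl le_top

/-- A net of smooth functions that is negligible in all `C^k(Ω)` is negligible. -/
theorem mem_negligibleC_of_incl {v : Eps → CSpace ⊤ Ω}
    (h : ∀ k : ℕ, (fun ε => (v ε).incl k Ω) ∈ negligibleC k Ω) : v ∈ negligibleC ⊤ Ω :=
  fun ⟨K, i⟩ => (h i (K, i)).mono fun ε => by
    rw [abs_of_nonneg (apply_nonneg _ _), abs_of_nonneg (apply_nonneg _ _)]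
    exact seminorm_le_incl le_rfl _

end Seminorms

/-! ## Supports and cut-off functions -/

section Supports

theorem exists_isCutoff (p : ℕ) : ∃ χ : Euc p → ℂ, IsCutoff χ := by
  let f : ContDiffBump (0 : Euc p) := ⟨1 / 4, 1 / 2, by norm_num, by norm_num⟩
  refine ⟨fun ξ => (f ξ : ℂ), Complex.ofRealCLM.contDiff.comp f.contDiff, fun ξ hξ => ?_,
    fun ξ hξ => ?_⟩
  · have : f ξ = 1 := f.one_of_mem_closedBall (by rw [mem_closedBall_zero_iff]; exact hξ.le)
    simp [this]
  · have : f ξ = 0 := f.zero_of_le_dist (by rw [dist_zero_right]; exact hξ.le)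
    simp [this]

variable {u : GenFun Ω} {K : CompactIn (Ω : Set (Euc n))}

theorem GenFun.isClosed_supp (hK : GenFun.supp Ω u ⊆ K.1) : IsClosed (GenFun.supp Ω u) := by
  rw [← isOpen_compl_iff, isOpen_iff_mem_nhds]
  intro x hx
  by_cases hxK : x ∈ K.1
  · have : ∃ V : Set (Euc n), IsOpen V ∧ V ⊆ Ω ∧ x ∈ V ∧ GenFun.IsZeroOn Ω u V := by
      by_contra! h
      exact hx ⟨K.2.2 hxK, h⟩
    obtain ⟨V, hV, hVΩ, hxV, hz⟩ := this
    exact mem_of_superset (hV.mem_nhds hxV) fun y hy h => h.2 V hV hVΩ hy hz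
  · exact mem_of_superset (K.2.1.isClosed.isOpen_compl.mem_nhds hxK) fun y hy h => hy (hK h)

/-- A generalized function is negligible on compact sets that do not meet its support. -/
theorem GenFun.isNegligible_of_disjoint_supp (uN : moderateC ⊤ Ω) (hu : GenModule.mk _ uN = u)
    (h : Disjoint K.1 (GenFun.supp Ω u)) (i : ℕ) :
    IsNegligible fun ε => (smoothSystem ⊤ Ω).seminorm (K, i) (uN.1 ε) := by
  -- Bounds on single derivatives make sense over arbitrary sets, unlike the seminorms; the
  -- induction over a finite cover of the compact set requires this.
  suffices H : ∃ B, IsNegligible B ∧ ∀ l : List (Fin n), l.length ≤ i → ∀ ε, ∀ x ∈ K.1,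
      ‖pderiv (fun j => EuclideanSpace.single j (1 : ℝ)) l (uN.1 ε).1 x‖ ≤ B ε by
    obtain ⟨B, hB, H⟩ := H
    exact IsNegligible.of_mem_negIdeal (seminorm_mem fun l hl _ =>
      ⟨B, comp_mem_negIdeal (τ := id) hB, H l hl⟩)
  refine K.2.1.induction_on (p := fun s => ∃ B, IsNegligible B ∧ ∀ l : List (Fin n),
    l.length ≤ i → ∀ ε, ∀ x ∈ s,
      ‖pderiv (fun j => EuclideanSpace.single j (1 : ℝ)) l (uN.1 ε).1 x‖ ≤ B ε)
    ⟨_, isNegligible_zero, by simp⟩ ?_ ?_ ?_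
  · rintro s t hst ⟨B, hB, H⟩
    exact ⟨B, hB, fun l hl ε x hx => H l hl ε x (hst hx)⟩
  · rintro s t ⟨B, hB, H⟩ ⟨D, hD, H'⟩
    refine ⟨_, hB.abs.add hD.abs, fun l hl ε x hx => ?_⟩
    rcases hx with hx | hx
    · exact (H l hl ε x hx).trans ((le_abs_self _).trans (le_add_of_nonneg_right (abs_nonneg _)))
    · exact (H' l hl ε x hx).trans ((le_abs_self _).trans (le_add_of_nonneg_left (abs_nonneg _)))
  · intro x hx
    have : ∃ V : Set (Euc n), IsOpen V ∧ V ⊆ Ω ∧ x ∈ V ∧ GenFun.IsZeroOn Ω u V := by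
      by_contra! h1
      exact h.le_bot ⟨hx, K.2.2 hx, h1⟩
    obtain ⟨V, hV, hVΩ, hxV, v, hv, hz⟩ := this
    obtain ⟨L, hL, hxL, hLV⟩ := exists_compact_subset hV hxV
    let L' : CompactIn (Ω : Set (Euc n)) := ⟨L, hL, hLV.trans hVΩ⟩
    have hd : uN.1 - v.1 ∈ negligibleC ⊤ Ω := GenModule.mk_eq_mk_iff.1 (hu.trans hv.symm)
    refine ⟨L, mem_nhdsWithin_of_mem_nhds (mem_interior_iff_mem_nhds.1 hxL), _,
      (hz L' i hLV).add (hd (L', i)), fun l hl ε y hy => ?_⟩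
    have h1 := (smoothSystem ⊤ Ω).value_le_seminorm (uN.1 ε) (k := L') (z := y) hy hl le_top
    have h2 := map_add_le_add ((smoothSystem ⊤ Ω).seminorm (L', i)) (v.1 ε) ((uN.1 - v.1) ε)
    rw [show v.1 ε + (uN.1 - v.1) ε = uN.1 ε by simp] at h2
    simp only [smoothSystem, one_mul] at h1
    exact h1.trans h2

/-- The constant function `1`. -/
def CSpace.one (Ω : TopologicalSpace.Opens (Euc n)) : CSpace ⊤ Ω :=
  ⟨fun _ => 1, (mem_smoothSystem_space_iff ⊤ Ω _).2 contDiffOn_const⟩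

/-- A generalized function with support in the interior of a compact set has a representative that
vanishes outside of this set. -/
theorem GenFun.exists_rep_eq_zero (hK : GenFun.supp Ω u ⊆ interior K.1) :
    ∃ U : moderateC ⊤ Ω, GenModule.mk _ U = u ∧ ∀ ε, ∀ y ∉ K.1, (U.1 ε).1 y = 0 := by
  obtain ⟨uN, hu⟩ := GenModule.mk_surjective _ u
  -- A smooth `f` that is `1` near the support and `0` outside of `K`; the new representative is `f
  -- u_ε`.
  obtain ⟨f, hf1, hf0, -⟩ := exists_contMDiffMap_one_nhds_of_subset_interior (n := ⊤)
    (modelWithCornersSelf ℝ (Euc n)) (GenFun.isClosed_supp (hK.trans interior_subset)) hK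
  have hf : ContDiff ℝ ∞ fun y => (f y : ℂ) :=
    Complex.ofRealCLM.contDiff.comp (contMDiff_iff_contDiff.1 f.contMDiff)
  let ψ : CSpace ⊤ Ω := ⟨_, (mem_smoothSystem_space_iff ⊤ Ω _).2 hf.contDiffOn⟩
  let U : Eps → CSpace ⊤ Ω := fun ε => ⟨fun y => ψ.1 y * (uN.1 ε).1 y,
    (mem_smoothSystem_space_iff ⊤ Ω _).2 (ψ.2.1.mul (uN.1 ε).2.1)⟩
  have hU : U ∈ moderateC ⊤ Ω := fun ⟨Q, i⟩ => IsModerate.of_mem_modIdeal (seminorm_mem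
    fun l hl _ => ((netBound_flatFrame (v := fun _ => ψ) (const_mem_modIdeal _)).mul
      (netBound_flatFrame (comp_mem_modIdeal (τ := id) (uN.2 (Q, i))))).pderiv_le l hl)
  refine ⟨⟨U, hU⟩, ?_, fun ε y hy => by simp [U, ψ, hf0 y hy]⟩
  rw [← hu, GenModule.mk_eq_mk_iff]
  rintro ⟨Q, i⟩
  refine IsNegligible.of_mem_negIdeal (seminorm_mem fun l hl _ => ?_)
  obtain ⟨O, hO, hsO, hO1⟩ := mem_nhdsSet_iff_exists.1 hf1
  -- The difference `(f - 1) u_ε` vanishes on `O`, where `f = 1`. The rest of `Q` is compact and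
  -- disjoint from the support, so `u_ε` is negligible there.
  let Q' : CompactIn (Ω : Set (Euc n)) := ⟨Q.1 \ O, Q.2.1.diff hO, sdiff_subset.trans Q.2.2⟩
  have hQ' : Disjoint Q'.1 (GenFun.supp Ω u) :=
    Set.disjoint_left.2 fun y hy h => hy.2 (hsO h)
  obtain ⟨C, hC, hb⟩ := ((netBound_flatFrame (v := fun _ => ψ - CSpace.one Ω)
    (const_mem_modIdeal _)).mul (netBound_flatFrame (comp_mem_negIdeal (τ := id)
      (GenFun.isNegligible_of_disjoint_supp uN hu hQ' i)))).pderiv_le l hl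
  refine ⟨_, (negIdeal id).abs_mem hC, fun ε y hy => ?_⟩
  have hE : (U ε - uN.1 ε).1 = fun y => (ψ - CSpace.one Ω).1 y * (uN.1 ε).1 y := by
    funext y
    change ψ.1 y * (uN.1 ε).1 y - (uN.1 ε).1 y = (ψ.1 y - 1) * (uN.1 ε).1 y
    ring
  change ‖pderiv _ l (U ε - uN.1 ε).1 y‖ ≤ _
  rw [hE]
  by_cases hyO : y ∈ O
  · rw [pderiv_eq_zero hO (fun z hz => ?_) l hyO, norm_zero]
    · exact abs_nonneg _
    · change (((f z : ℝ) : ℂ) - 1) * (uN.1 ε).1 z = 0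
      rw [show f z = 1 from hO1 hz, Complex.ofReal_one, sub_self, zero_mul]
  · exact (hb ε y ⟨hy, hyO⟩).trans (le_abs_self _)

end Supports

end Representatives

/-! ## Generalized oscillatory integrals -/

section GeneralizedIntegral

variable {n₁ n p : ℕ} {Ω₁ : TopologicalSpace.Opens (Euc n₁)} {Ω : TopologicalSpace.Opens (Euc n)}
  {m ρ δ : ℝ}

/-! ### Linearity of the integrand in `u` -/

section Linear

variable {φ : HgSpace p Ω₁ Ω} {χ : Euc p → ℂ}

theorem opL_smul_add (χ : Euc p → ℂ) (φ : Var n₁ n p → ℂ) {f g : Var n₁ n p → ℂ} (c : ℂ)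
    (hf : ContDiffOn ℝ ∞ f (fullDomain p Ω₁ Ω)) (hg : ContDiffOn ℝ ∞ g (fullDomain p Ω₁ Ω)) :
    EqOn (opL χ φ (c • f + g)) (c • opL χ φ f + opL χ φ g) (fullDomain p Ω₁ Ω) := by
  intro z hz
  have hU := isOpen_fullDomain (p := p) Ω₁ Ω
  have hcf : ContDiffOn ℝ ∞ (c • f) (fullDomain p Ω₁ Ω) := contDiffOn_const.smul hf
  have h : ∀ d, pderiv dirVec [d] (c • f + g) z =
      c * pderiv dirVec [d] f z + pderiv dirVec [d] g z := fun d => by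
    rw [WeightSystem.pderiv_add (r := ⊤) hU hcf hg [d] le_top hz,
      WeightSystem.pderiv_smul (r := ⊤) hU c hf [d] le_top hz]
  simp only [opL, h, Pi.add_apply, Pi.smul_apply, smul_eq_mul, mul_add, Finset.sum_add_distrib,
    Finset.mul_sum, mul_left_comm _ c]
  ring

theorem IsPhase.opL_iterate_smul_add (hφ : IsPhase φ) (hχ : IsCutoff χ) {f g : Var n₁ n p → ℂ}
    (c : ℂ) (hf : ContDiffOn ℝ ∞ f (fullDomain p Ω₁ Ω))
    (hg : ContDiffOn ℝ ∞ g (fullDomain p Ω₁ Ω)) (h : ℕ) :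
    EqOn ((opL χ φ.1)^[h] (c • f + g)) (c • (opL χ φ.1)^[h] f + (opL χ φ.1)^[h] g)
      (fullDomain p Ω₁ Ω) := by
  induction h generalizing f g with
  | zero => exact fun _ _ => rfl
  | succ h ih =>
    simp only [Function.iterate_succ_apply]
    exact (opL_iterate_congr (isOpen_fullDomain Ω₁ Ω) (opL_smul_add χ φ.1 c hf hg) h).trans
      (ih (hφ.contDiffOn_opL hχ hf) (hφ.contDiffOn_opL hχ hg))

theorem SymbolSpace.contDiffOn_mul (a : SymbolSpace p Ω₁ Ω m ρ δ) (u : CSpace ⊤ Ω) :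
    ContDiffOn ℝ ∞ (fun z : Var n₁ n p => a.1 z * u.1 z.2.1) (fullDomain p Ω₁ Ω) :=
  a.2.1.mul (u.2.1.comp ((contDiff_fst.comp contDiff_snd).contDiffOn
    (f := fun z : Var n₁ n p => z.2.1)) fun _ hz => hz.2)

theorem IsPhase.integrand_smul_add (hφ : IsPhase φ) (hχ : IsCutoff χ)
    (a : SymbolSpace p Ω₁ Ω m ρ δ) (u v : CSpace ⊤ Ω) (c : ℂ) (h : ℕ) {x : Euc n₁} (hx : x ∈ Ω₁)
    {q : Euc n × Euc p} (hq : q.1 ∈ Ω) :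
    integrand χ φ.1 a.1 (c • u + v).1 h x q =
      c * integrand χ φ.1 a.1 u.1 h x q + integrand χ φ.1 a.1 v.1 h x q := by
  have h1 := hφ.opL_iterate_smul_add hχ c (SymbolSpace.contDiffOn_mul a u)
    (SymbolSpace.contDiffOn_mul a v) h (x := (x, q)) ⟨hx, hq⟩
  have h2 : (fun z : Var n₁ n p => a.1 z * (c • u + v).1 z.2.1) =
      c • (fun z : Var n₁ n p => a.1 z * u.1 z.2.1) + fun z => a.1 z * v.1 z.2.1 := by
    funext z
    change a.1 z * (c * u.1 z.2.1 + v.1 z.2.1) = c * (a.1 z * u.1 z.2.1) + a.1 z * v.1 z.2.1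
    ring
  simp only [integrand, h2, h1, Pi.add_apply, Pi.smul_apply, smul_eq_mul]
  ring

end Linear

theorem XBound.seminorm_mem {T : Type} {τ : T → Eps} {I : BoundIdeal τ}
    {K₂ : CompactIn (Ω : Set (Euc n))} {ν : ℝ} {k : ℕ} {Φ : T → Var n₁ n p → ℂ}
    (h : XBound (Ω₁ := Ω₁) K₂ I ν k Φ) (hν : ν + k < -(p : ℝ)) {v : T → CSpace k Ω₁}
    (hv : ∀ t, ∀ x ∈ Ω₁, (v t).1 x = ∫ q in K₂.1 ×ˢ univ, Φ t (x, q))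
    (K₁ : CompactIn (Ω₁ : Set (Euc n₁))) (i : ℕ) :
    (fun t => (smoothSystem k Ω₁).seminorm (K₁, i) (v t)) ∈ I.carrier := by
  refine Colombeau.seminorm_mem fun l _ hl => ?_
  obtain ⟨C, hC, hb⟩ := h.norm_pderiv_integral_le hν K₁ l (by exact_mod_cast hl)
  refine ⟨C, hC, fun t x hx => ?_⟩
  rw [pderiv_congr Ω₁.isOpen (hv t) l (K₁.2.2 hx)]
  exact hb t x hx

variable {φN φN' : PhaseNet p Ω₁ Ω} {aN aN' : moderateNets (symbolSystem p Ω₁ Ω m ρ δ).seminorm}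
  {uN uN' : moderateC ⊤ Ω} {χ χ' : Euc p → ℂ} {K K' : CompactIn (Ω : Set (Euc n))} {k h h' : ℕ}

theorem dataPair_of_equiv
    (hφ : (Quotient.mk _ φN : GenPhase p Ω₁ Ω) = Quotient.mk _ φN')
    (ha : GenModule.mk _ aN = GenModule.mk _ aN') (hu : GenModule.mk _ uN = GenModule.mk _ uN')
    (K : CompactIn (Ω : Set (Euc n))) (k h : ℕ) :
    DataPair (negIdeal id) K k h φN.net φN'.net aN.1 aN'.1 uN.1 uN'.1 :=
  ⟨fun _ => PhaseNet.pair hφ id _, fun K i => comp_mem_modIdeal (aN.2 (K, i)),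
    fun K i => comp_mem_modIdeal (aN'.2 (K, i)),
    fun K i => comp_mem_negIdeal (GenModule.mk_eq_mk_iff.1 ha (K, i)),
    comp_mem_modIdeal (uN'.2 _), comp_mem_negIdeal (GenModule.mk_eq_mk_iff.1 hu _)⟩

/-- The net of oscillatory integrals of order `h` over `K`, as a family of functions. -/
def IsOscNet (φN : PhaseNet p Ω₁ Ω) (aN : moderateNets (symbolSystem p Ω₁ Ω m ρ δ).seminorm)
    (uN : moderateC ⊤ Ω) (χ : Euc p → ℂ) (K : CompactIn (Ω : Set (Euc n))) (h : ℕ)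
    (v : Eps → Euc n₁ → ℂ) : Prop :=
  ∀ ε, ∀ x ∈ Ω₁, v ε x = ∫ q in K.1 ×ˢ univ, integrand χ (φN.net ε).1 (aN.1 ε).1 (uN.1 ε).1 h x q

theorem integrableOn_integrand (φN : PhaseNet p Ω₁ Ω)
    (aN : moderateNets (symbolSystem p Ω₁ Ω m ρ δ).seminorm) (uN : moderateC ⊤ Ω)
    (hχ : IsCutoff χ) (hρ : ρ ≤ 1) (hδ : 0 ≤ δ) (hδ1 : δ ≤ 1) (K : CompactIn (Ω : Set (Euc n)))
    (hm : m - h * min ρ (1 - δ) + 1 + k < -(p : ℝ)) (ε : Eps) {x : Euc n₁} (hx : x ∈ Ω₁) :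
    IntegrableOn (integrand χ (φN.net ε).1 (aN.1 ε).1 (uN.1 ε).1 h x) (K.1 ×ˢ univ) := by
  have hk : (0 : ℝ) ≤ k := k.cast_nonneg
  exact ((dataPair_of_equiv (φN := φN) (aN := aN) (uN := uN) rfl rfl rfl K k h).xBound_right hχ hρ
    hδ hδ1).integrableOn (by linarith) ε hx

theorem exists_isOscNet (φN : PhaseNet p Ω₁ Ω)
    (aN : moderateNets (symbolSystem p Ω₁ Ω m ρ δ).seminorm) (uN : moderateC ⊤ Ω)
    (hχ : IsCutoff χ) (hρ : ρ ≤ 1) (hδ : 0 ≤ δ) (hδ1 : δ ≤ 1) (K : CompactIn (Ω : Set (Euc n)))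
    (hm : m - h * min ρ (1 - δ) + 1 + k < -(p : ℝ)) :
    ∃ v ∈ moderateC k Ω₁, IsOscNet φN aN uN χ K h fun ε => (v ε).1 := by
  have H := (dataPair_of_equiv (φN := φN) (aN := aN) (uN := uN) rfl rfl rfl K k h).xBound_right hχ
    hρ hδ hδ1
  let v : Eps → CSpace k Ω₁ := fun ε => ⟨_, (mem_smoothSystem_space_iff k Ω₁ _).2
    (H.contDiffOn_integral hm ε)⟩
  have hv : IsOscNet φN aN uN χ K h fun ε => (v ε).1 := fun ε x _ => rfl
  exact ⟨v, fun ⟨K₁, i⟩ => IsModerate.of_mem_modIdeal (H.seminorm_mem hm hv K₁ i), hv⟩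

/-- Negligible changes of the data change the oscillatory integral by a negligible net. -/
theorem IsOscNet.sub_mem_of_equiv {v v' : Eps → CSpace k Ω₁}
    (hv : IsOscNet φN aN uN χ K h fun ε => (v ε).1)
    (hv' : IsOscNet φN' aN' uN' χ K h fun ε => (v' ε).1)
    (hφ : (Quotient.mk _ φN : GenPhase p Ω₁ Ω) = Quotient.mk _ φN')
    (ha : GenModule.mk _ aN = GenModule.mk _ aN') (hu : GenModule.mk _ uN = GenModule.mk _ uN')
    (hχ : IsCutoff χ) (hρ : ρ ≤ 1) (hδ : 0 ≤ δ) (hδ1 : δ ≤ 1)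
    (hm : m - h * min ρ (1 - δ) + 1 + k < -(p : ℝ)) : v - v' ∈ negligibleC k Ω₁ := by
  have H := (dataPair_of_equiv hφ ha hu K k h).xBound_diff hχ hρ hδ hδ1
  refine fun ⟨K₁, i⟩ => IsNegligible.of_mem_negIdeal
    (H.seminorm_mem (v := v - v') hm (fun ε x hx => ?_) K₁ i)
  change (v ε).1 x - (v' ε).1 x = _
  rw [show (v ε).1 x = _ from hv ε x hx, show (v' ε).1 x = _ from hv' ε x hx]
  exact (integral_sub (integrableOn_integrand φN aN uN hχ hρ hδ hδ1 K hm ε hx)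
    (integrableOn_integrand φN' aN' uN' hχ hρ hδ hδ1 K hm ε hx)).symm

/-- If `u` vanishes outside of `K` and `K'`, then the regularization does not matter. -/
theorem IsOscNet.congr {v : Eps → Euc n₁ → ℂ} (hv : IsOscNet φN aN uN χ K h v)
    (hK : ∀ ε, ∀ y ∉ K.1, (uN.1 ε).1 y = 0) (hK' : ∀ ε, ∀ y ∉ K'.1, (uN.1 ε).1 y = 0)
    (hχ : IsCutoff χ) (hχ' : IsCutoff χ') (hρ : ρ ≤ 1) (hδ : 0 ≤ δ)
    (hm : m - h * min ρ (1 - δ) < -(p : ℝ)) (hm' : m - h' * min ρ (1 - δ) < -(p : ℝ)) :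
    IsOscNet φN aN uN χ' K' h' v := fun ε x hx => (hv ε x hx).trans
  (oscInt_eq (φN.isPhase ε) hχ hχ' hρ hδ (aN.1 ε) (uN.1 ε) (hK ε) (hK' ε) hm hm' hx)

/-- The class of the net of oscillatory integrals depends neither on the representatives nor on the
regularization. -/
theorem IsOscNet.sub_mem {u : GenFun Ω} {v v' : Eps → CSpace k Ω₁}
    (hv : IsOscNet φN aN uN χ K h fun ε => (v ε).1)
    (hv' : IsOscNet φN' aN' uN' χ' K' h' fun ε => (v' ε).1)
    (hφ : (Quotient.mk _ φN : GenPhase p Ω₁ Ω) = Quotient.mk _ φN')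
    (ha : GenModule.mk _ aN = GenModule.mk _ aN') (hu : GenModule.mk _ uN = u)
    (hu' : GenModule.mk _ uN' = u) (hK : GenFun.supp Ω u ⊆ interior K.1)
    (hK' : GenFun.supp Ω u ⊆ interior K'.1) (hχ : IsCutoff χ) (hχ' : IsCutoff χ')
    (hρ : ρ ≤ 1) (hδ : 0 ≤ δ) (hδ1 : δ ≤ 1)
    (hm : m - h * min ρ (1 - δ) + 1 + k < -(p : ℝ))
    (hm' : m - h' * min ρ (1 - δ) + 1 + k < -(p : ℝ)) : v - v' ∈ negligibleC k Ω₁ := by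
  -- A representative vanishing off the intersection vanishes off both sets, so its integral `v₀`
  -- can be computed with either regularization. Then `v - v₀` and `v₀ - v'` are each a change of
  -- representatives at a fixed regularization.
  let K₀ : CompactIn (Ω : Set (Euc n)) :=
    ⟨K.1 ∩ K'.1, K.2.1.inter K'.2.1, inter_subset_left.trans K.2.2⟩
  obtain ⟨U, hU, hU0⟩ := GenFun.exists_rep_eq_zero (u := u) (K := K₀)
    (by simp only [K₀, interior_inter]; exact subset_inter hK hK')
  obtain ⟨v₀, -, hv₀⟩ := exists_isOscNet φN' aN' U hχ hρ hδ hδ1 K hm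
  have hk : (0 : ℝ) ≤ k := k.cast_nonneg
  have hv₀' : IsOscNet φN' aN' U χ' K' h' fun ε => (v₀ ε).1 :=
    hv₀.congr (fun ε y hy => hU0 ε y fun h => hy h.1) (fun ε y hy => hU0 ε y fun h => hy h.2)
      hχ hχ' hρ hδ (by linarith) (by linarith)
  rw [← sub_add_sub_cancel v v₀ v']
  exact add_mem (hv.sub_mem_of_equiv hv₀ hφ ha (hu.trans hU.symm) hχ hρ hδ hδ1 hm)
    (hv₀'.sub_mem_of_equiv hv' rfl rfl (hU.trans hu'.symm) hχ' hρ hδ hδ1 hm')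

theorem IsOscNet.smul_add {v v' : Eps → Euc n₁ → ℂ} {UN : moderateC ⊤ Ω}
    (hv : IsOscNet φN aN uN χ K h v) (hv' : IsOscNet φN aN uN' χ K h v') {c : Eps → ℂ}
    (hU : ∀ ε, UN.1 ε = c ε • uN.1 ε + uN'.1 ε)
    (hχ : IsCutoff χ) (hρ : ρ ≤ 1) (hδ : 0 ≤ δ) (hδ1 : δ ≤ 1)
    (hm : m - h * min ρ (1 - δ) + 1 + k < -(p : ℝ)) :
    IsOscNet φN aN UN χ K h fun ε => c ε • v ε + v' ε := by
  intro ε x hx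
  change c ε * v ε x + v' ε x = _
  rw [hv ε x hx, hv' ε x hx, ← integral_const_mul, ← integral_add
    ((integrableOn_integrand φN aN uN hχ hρ hδ hδ1 K hm ε hx).const_mul _)
    (integrableOn_integrand φN aN uN' hχ hρ hδ hδ1 K hm ε hx)]
  refine setIntegral_congr_fun (K.2.1.measurableSet.prod MeasurableSet.univ) fun q hq => ?_
  rw [hU]
  exact ((φN.isPhase ε).integrand_smul_add hχ (aN.1 ε) (uN.1 ε) (uN'.1 ε) (c ε) h hx
    (K.2.2 hq.1)).symm

/-- The oscillatory integral is bounded by seminorms of `u`, with moderate constants. -/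
theorem exists_isOscNet_bound (φN : PhaseNet p Ω₁ Ω)
    (aN : moderateNets (symbolSystem p Ω₁ Ω m ρ δ).seminorm)
    (hχ : IsCutoff χ) (hρ : ρ ≤ 1) (hδ : 0 ≤ δ) (hδ1 : δ ≤ 1) (K : CompactIn (Ω : Set (Euc n)))
    (hm : m - h * min ρ (1 - δ) + 1 + k < -(p : ℝ)) (K₁ : CompactIn (Ω₁ : Set (Euc n₁))) (i : ℕ) :
    ∃ B, IsModerate B ∧ ∀ (uN : moderateC ⊤ Ω) (v : Eps → CSpace k Ω₁),
      IsOscNet φN aN uN χ K h (fun ε => (v ε).1) → ∀ ε,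
        (smoothSystem k Ω₁).seminorm (K₁, i) (v ε) ≤
          |B ε| * (smoothSystem ⊤ Ω).seminorm (K, k + h) (uN.1 ε) := by
  -- Indexing by all `u`, all resulting `v` and all `ε` at once makes the bound `B` independent of
  -- `u`.
  let T : Type := {t : (CSpace ⊤ Ω × CSpace k Ω₁) × Eps // ∀ x ∈ Ω₁, t.1.2.1 x =
    ∫ q in K.1 ×ˢ univ, integrand χ (φN.net t.2).1 (aN.1 t.2).1 t.1.1.1 h x q}
  let τ : T → Eps := fun t => t.1.2
  let I := weightedIdeal τ fun t => (smoothSystem ⊤ Ω).seminorm (K, k + h) t.1.1.1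
  have hI : (fun t : T => (smoothSystem ⊤ Ω).seminorm (K, k + h) t.1.1.1) ∈ I.carrier :=
    ⟨_, isModerate_const 1, fun t => by simp⟩
  -- Compared with `u' = 0`, the difference of the integrands is the integrand itself, and its
  -- bounds are multiples of the seminorm of `u`.
  have D : DataPair I K k h (fun t => φN.net (τ t)) (fun t => φN.net (τ t))
      (fun t => aN.1 (τ t)) (fun t => aN.1 (τ t)) (fun t => t.1.1.1) fun _ => 0 :=
    ⟨fun _ => (φN.family τ _).refl I, fun K i => comp_mem_modIdeal (aN.2 (K, i)),
      fun K i => comp_mem_modIdeal (aN.2 (K, i)), fun K i => by simpa using I.zero_mem,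
      const_mem_modIdeal _, by simpa using hI⟩
  have H := D.xBound_diff hχ hρ hδ hδ1
  have h0 : ∀ (t : T) (z : Var n₁ n p),
      integrand χ (φN.net (τ t)).1 (aN.1 (τ t)).1 (0 : CSpace ⊤ Ω).1 h z.1 z.2 = 0 := by
    intro t z
    have h1 : (fun z : Var n₁ n p => (aN.1 (τ t)).1 z * (0 : CSpace ⊤ Ω).1 z.2.1) = 0 :=
      funext fun z => mul_zero _
    simp only [integrand, h1, opL_iterate_zero, Pi.zero_apply, mul_zero]
  simp only [h0, sub_zero] at H
  obtain ⟨B, hB, hb⟩ := H.seminorm_mem (v := fun t => t.1.1.2) hm (fun t => t.2) K₁ i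
  refine ⟨B, hB, fun uN v hv ε => ?_⟩
  have h1 := hb ⟨((uN.1 ε, v ε), ε), hv ε⟩
  rwa [abs_of_nonneg (apply_nonneg _ _), abs_of_nonneg (apply_nonneg _ _)] at h1

end GeneralizedIntegral

/-! ## The generalized Fourier integral operator -/

section Operator

variable {n₁ n p : ℕ} {Ω₁ : TopologicalSpace.Opens (Euc n₁)} {Ω : TopologicalSpace.Opens (Euc n)}
  {m ρ δ : ℝ} {φ : GenPhase p Ω₁ Ω} {a : GenSymbol p Ω₁ Ω m ρ δ}

theorem exists_order (hρ : 0 < ρ) (hδ : δ < 1) (m : ℝ) (p k : ℕ) :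
    ∃ h : ℕ, m - h * min ρ (1 - δ) + 1 + k < -(p : ℝ) := by
  have hs : 0 < min ρ (1 - δ) := lt_min hρ (by linarith)
  obtain ⟨h, hh⟩ := exists_nat_gt ((m + 1 + k + p) / min ρ (1 - δ))
  rw [div_lt_iff₀ hs] at hh
  exact ⟨h, by linarith⟩

theorem exists_compactIn_interior (K : CompactIn (Ω : Set (Euc n))) :
    ∃ L : CompactIn (Ω : Set (Euc n)), K.1 ⊆ interior L.1 := by
  obtain ⟨L, hL, hKL, hLΩ⟩ := exists_compact_between K.2.1 Ω.isOpen K.2.2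
  exact ⟨⟨L, hL, hLΩ⟩, hKL⟩

theorem exists_isOscillatoryIntegral (hρ : 0 < ρ) (hρ_le : ρ ≤ 1) (hδ : 0 ≤ δ) (hδ_lt : δ < 1)
    (φ : GenPhase p Ω₁ Ω) (a : GenSymbol p Ω₁ Ω m ρ δ) (u : GenFunC Ω) :
    ∃ w, IsOscillatoryIntegral φ a u w := by
  obtain ⟨φ₀, rfl⟩ := Quotient.mk_surjective φ
  obtain ⟨a₀, rfl⟩ := GenModule.mk_surjective _ a
  obtain ⟨χ₀, hχ₀⟩ := exists_isCutoff p
  obtain ⟨K, hK⟩ := u.2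
  obtain ⟨K₀, hK₀⟩ := exists_compactIn_interior K
  replace hK₀ : GenFun.supp Ω u.toGenFun ⊆ interior K₀.1 := hK.trans hK₀
  obtain ⟨U, hU, hU0⟩ := GenFun.exists_rep_eq_zero hK₀
  obtain ⟨h₀, hh₀⟩ := exists_order hρ hδ_lt m p 0
  -- The order `h₀` is enough for continuity only. Since `U` vanishes off `K₀`, the same `f` arises
  -- for every larger admissible order, which gives the remaining smoothness.
  let f : Eps → Euc n₁ → ℂ := fun ε x =>
    ∫ q in K₀.1 ×ˢ univ, integrand χ₀ (φ₀.net ε).1 (a₀.1 ε).1 (U.1 ε).1 h₀ x q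
  have hf₀ : IsOscNet φ₀ a₀ U χ₀ K₀ h₀ f := fun _ _ _ => rfl
  have hf : ∀ k h : ℕ, m - h * min ρ (1 - δ) + 1 + k < -(p : ℝ) →
      IsOscNet φ₀ a₀ U χ₀ K₀ h f := fun k h hm => by
    have hk : (0 : ℝ) ≤ k := k.cast_nonneg
    exact hf₀.congr hU0 hU0 hχ₀ hχ₀ hρ_le hδ (by push_cast at hh₀; linarith) (by linarith)
  have hsmooth : ∀ ε, ContDiffOn ℝ ∞ (f ε) Ω₁ := fun ε => by
    rw [contDiffOn_infty]
    intro k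
    obtain ⟨h, hm⟩ := exists_order hρ hδ_lt m p k
    obtain ⟨v, -, hv⟩ := exists_isOscNet φ₀ a₀ U hχ₀ hρ_le hδ hδ_lt.le K₀ hm
    exact ((mem_smoothSystem_space_iff k Ω₁ _).1 (v ε).2).congr fun x hx =>
      (hf k h hm ε x hx).trans (hv ε x hx).symm
  let w : Eps → CSpace ⊤ Ω₁ := fun ε =>
    ⟨f ε, (mem_smoothSystem_space_iff ⊤ Ω₁ _).2 (hsmooth ε)⟩
  have hw : w ∈ moderateC ⊤ Ω₁ := by
    rintro ⟨K₁, i⟩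
    obtain ⟨h, hm⟩ := exists_order hρ hδ_lt m p i
    obtain ⟨B, hB, hb⟩ := exists_isOscNet_bound φ₀ a₀ hχ₀ hρ_le hδ hδ_lt.le K₀ hm K₁ i
    refine (hB.abs.mul (U.2 (K₀, i + h))).mono fun ε => ?_
    rw [abs_of_nonneg (apply_nonneg _ _)]
    exact ((seminorm_le_incl le_rfl _).trans
      (hb U (fun ε => (w ε).incl i Ω₁) (hf i h hm) ε)).trans (le_abs_self _)
  refine ⟨GenModule.mk _ ⟨w, hw⟩, ?_⟩
  intro φN aN uN wN hφ ha hu hwN χ hχ K hK k h hm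
  obtain ⟨v, hv, hvI⟩ := exists_isOscNet φN aN uN hχ hρ_le hδ hδ_lt.le K hm
  refine ⟨fun ε x hx => integrableOn_integrand φN aN uN hχ hρ_le hδ hδ_lt.le K hm ε hx, v, hv, hvI,
    ?_⟩
  -- The integral for arbitrary representatives, cut-off and compact set is compared with `f`, at
  -- the same order `h`; `h2` then replaces `w` by an arbitrary representative of its class.
  have h1 : v - (fun ε => (w ε).incl k Ω₁) ∈ negligibleC k Ω₁ :=
    hvI.sub_mem (v' := fun ε => (w ε).incl k Ω₁) (hf k h hm) hφ ha hu hU hK hK₀ hχ hχ₀ hρ_le hδ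
      hδ_lt.le hm hm
  have h2 : (fun ε => (w ε).incl k Ω₁) - (fun ε => (wN.1 ε).incl k Ω₁) ∈ negligibleC k Ω₁ := by
    rintro ⟨K₁, i⟩
    refine (GenModule.mk_eq_mk_iff.1 hwN.symm (K₁, i)).mono fun ε => ?_
    rw [abs_of_nonneg (apply_nonneg _ _), abs_of_nonneg (apply_nonneg _ _)]
    exact seminorm_incl_le (w ε - wN.1 ε)
  have h3 := add_mem h1 h2
  rwa [sub_add_sub_cancel] at h3

/-- `W` is any element with the characterizing property, not a chosen one. Additivity, homogeneity
and uniqueness are therefore all special cases. -/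
theorem IsOscillatoryIntegral.smul_add (hρ : 0 < ρ) (hρ_le : ρ ≤ 1) (hδ : 0 ≤ δ) (hδ_lt : δ < 1)
    {u u' : GenFunC Ω} {w w' W : GenFun Ω₁} {z : GenNumber}
    (hw : IsOscillatoryIntegral φ a u w) (hw' : IsOscillatoryIntegral φ a u' w')
    (hW : IsOscillatoryIntegral φ a (z • u + u') W) : W = z • w + w' := by
  obtain ⟨φN, rfl⟩ := Quotient.mk_surjective φ
  obtain ⟨aN, rfl⟩ := GenModule.mk_surjective _ a
  obtain ⟨χ, hχ⟩ := exists_isCutoff p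
  obtain ⟨uN, hu⟩ := GenModule.mk_surjective _ u.toGenFun
  obtain ⟨uN', hu'⟩ := GenModule.mk_surjective _ u'.toGenFun
  obtain ⟨wN, rfl⟩ := GenModule.mk_surjective _ w
  obtain ⟨wN', rfl⟩ := GenModule.mk_surjective _ w'
  obtain ⟨WN, rfl⟩ := GenModule.mk_surjective _ W
  obtain ⟨zN, rfl⟩ : ∃ c, GenNumber.mk c = z := Ideal.Quotient.mk_surjective z
  obtain ⟨K, hK⟩ := u.2
  obtain ⟨K', hK'⟩ := u'.2
  obtain ⟨L, hL⟩ := exists_compactIn_interior (Ω := Ω)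
    ⟨K.1 ∪ K'.1, K.2.1.union K'.2.1, union_subset K.2.2 K'.2.2⟩
  have hs : GenFun.supp Ω u.toGenFun ⊆ interior L.1 :=
    (hK.trans subset_union_left).trans hL
  have hs' : GenFun.supp Ω u'.toGenFun ⊆ interior L.1 :=
    (hK'.trans subset_union_right).trans hL
  have hS : GenFun.supp Ω (GenNumber.mk zN • u + u').toGenFun ⊆ interior L.1 :=
    (GenFun.supp_add _ _).trans (union_subset ((GenFun.supp_smul _ _).trans hs) hs')
  obtain ⟨UN, hU, hUε⟩ := GenModule.exists_smul_add_rep zN uN uN'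
  rw [hu, hu'] at hU
  obtain ⟨VN, hVN, hVε⟩ := GenModule.exists_smul_add_rep zN wN wN'
  rw [← hVN, GenModule.mk_eq_mk_iff]
  refine mem_negligibleC_of_incl fun k => ?_
  obtain ⟨h, hm⟩ := exists_order hρ hδ_lt m p k
  obtain ⟨-, v, -, hv, hvw⟩ := hw φN aN uN wN rfl rfl hu rfl χ hχ L hs k h hm
  obtain ⟨-, v', -, hv', hvw'⟩ := hw' φN aN uN' wN' rfl rfl hu' rfl χ hχ L hs' k h hm
  obtain ⟨-, V, -, hV, hVW⟩ := hW φN aN UN WN rfl rfl hU rfl χ hχ L hS k h hm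
  have hvv : IsOscNet φN aN UN χ L h fun ε => (zN.1 ε • v ε + v' ε).1 :=
    IsOscNet.smul_add (v := fun ε => (v ε).1) (v' := fun ε => (v' ε).1) hv hv' hUε hχ hρ_le hδ
      hδ_lt.le hm
  have h1 : V - (fun ε => zN.1 ε • v ε + v' ε) ∈ negligibleC k Ω₁ :=
    IsOscNet.sub_mem (v := V) (v' := fun ε => zN.1 ε • v ε + v' ε)
      hV hvv rfl rfl hU hU hS hS hχ hχ hρ_le hδ hδ_lt.le hm hm
  -- The integrals `V`, `v`, `v'` cancel, leaving a representative of `W - (z w + w')`.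
  have h2 := add_mem (sub_mem h1 hVW) (add_mem (smul_mem_negligibleNets zN hvw) hvw')
  refine (congrArg (· ∈ negligibleC k Ω₁) ?_).mp h2
  funext ε
  refine Subtype.ext (funext fun x => ?_)
  have hx : (VN.1 ε).1 x = zN.1 ε * (wN.1 ε).1 x + (wN'.1 ε).1 x := by
    rw [hVε]; rfl
  change ((V ε).1 x - (zN.1 ε * (v ε).1 x + (v' ε).1 x)) - ((V ε).1 x - (WN.1 ε).1 x) +
      (zN.1 ε * ((v ε).1 x - (wN.1 ε).1 x) + ((v' ε).1 x - (wN'.1 ε).1 x)) =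
    (WN.1 ε).1 x - (VN.1 ε).1 x
  rw [hx]
  ring

theorem IsOscillatoryIntegral.zero (hρ : 0 < ρ) (hρ_le : ρ ≤ 1) (hδ : 0 ≤ δ) (hδ_lt : δ < 1)
    {w : GenFun Ω₁} (hw : IsOscillatoryIntegral φ a 0 w) : w = 0 := by
  have hW : IsOscillatoryIntegral φ a ((1 : GenNumber) • 0 + 0) w := by simpa using hw
  have := hw.smul_add hρ hρ_le hδ hδ_lt hw hW
  rw [one_smul] at this
  exact left_eq_add.1 this

theorem IsOscillatoryIntegral.unique (hρ : 0 < ρ) (hρ_le : ρ ≤ 1) (hδ : 0 ≤ δ) (hδ_lt : δ < 1)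
    {u : GenFunC Ω} {w w' : GenFun Ω₁} (hw : IsOscillatoryIntegral φ a u w)
    (hw' : IsOscillatoryIntegral φ a u w') : w = w' := by
  obtain ⟨v, hv⟩ := exists_isOscillatoryIntegral hρ hρ_le hδ hδ_lt φ a (0 : GenFunC Ω)
  have hw₁ : IsOscillatoryIntegral φ a ((1 : GenNumber) • u + 0) w := by simpa using hw
  have := hw'.smul_add hρ hρ_le hδ hδ_lt hv hw₁
  rwa [hv.zero hρ hρ_le hδ hδ_lt, one_smul, add_zero] at this

/-- The constant `B` of the seminorm estimate is `O(ε^{-M})` with `M` independent of `u`, so the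
valuation drops by at most `M`; the factor is `e^M`. -/
theorem IsOscillatoryIntegral.exists_ultra_bound (hρ : 0 < ρ) (hρ_le : ρ ≤ 1) (hδ : 0 ≤ δ)
    (hδ_lt : δ < 1) (φ : GenPhase p Ω₁ Ω) (a : GenSymbol p Ω₁ Ω m ρ δ)
    (K : CompactIn (Ω : Set (Euc n))) (q : CompactIn (Ω₁ : Set (Euc n₁)) × ℕ) :
    ∃ (L : CompactIn (Ω : Set (Euc n))) (j : ℕ) (N : ENNReal), K.1 ⊆ interior L.1 ∧ N < ⊤ ∧
      ∀ (u : GenFunC Ω) (w : GenFun Ω₁), IsOscillatoryIntegral φ a u w →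
        GenFun.supp Ω u.toGenFun ⊆ K.1 → ∀ r : ENNReal,
        GenModule.ultra (smoothSystem ⊤ Ω).seminorm (L, j) u.toGenFun < r →
        GenModule.ultra (smoothSystem ⊤ Ω₁).seminorm q w < N * r := by
  obtain ⟨φN, rfl⟩ := Quotient.mk_surjective φ
  obtain ⟨aN, rfl⟩ := GenModule.mk_surjective _ a
  obtain ⟨χ, hχ⟩ := exists_isCutoff p
  obtain ⟨L, hL⟩ := exists_compactIn_interior K
  obtain ⟨K₁, i⟩ := q
  obtain ⟨h, hm⟩ := exists_order hρ hδ_lt m p i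
  obtain ⟨B, ⟨M, hB⟩, hb⟩ := exists_isOscNet_bound φN aN hχ hρ_le hδ hδ_lt.le L hm K₁ i
  refine ⟨L, i + h, EReal.exp ((M : ℝ) : EReal), hL,
    EReal.exp_lt_top_iff.2 (EReal.coe_lt_top _), fun u w hw hu r hr => ?_⟩
  rw [GenModule.ultra_lt_iff] at hr ⊢
  obtain ⟨b, uN, huN, hbu, hbr⟩ := hr
  obtain ⟨wN, rfl⟩ := GenModule.mk_surjective _ w
  obtain ⟨-, v, -, hv, hvw⟩ := hw φN aN uN wN rfl rfl huN rfl χ hχ L (hu.trans hL) i h hm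
  refine ⟨b - M, wN, rfl, ?_, ?_⟩
  · have h1 : IsOrder (fun ε => (smoothSystem i Ω₁).seminorm (K₁, i) (v ε)) (b - M) := by
      have h2 := IsOrder.mul (f := fun ε => |B ε|) (hB.mono fun ε => by rw [abs_abs]) hbu
      rw [neg_add_eq_sub] at h2
      refine h2.mono fun ε => ?_
      rw [abs_of_nonneg (apply_nonneg _ _)]
      exact (hb uN v hv ε).trans (le_abs_self _)
    -- The integrals represent `w` up to a negligible net, of which the order `Q ≥ b - M` is all
    -- that is needed.
    obtain ⟨Q, hQ⟩ := exists_nat_ge (b - M)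
    refine (h1.add ((hvw (K₁, i) Q).weaken hQ)).mono fun ε => ?_
    rw [abs_of_nonneg (apply_nonneg _ _)]
    refine ((seminorm_le_incl le_rfl (wN.1 ε)).trans ?_).trans (le_abs_self _)
    have h3 := map_sub_le_add ((smoothSystem i Ω₁).seminorm (K₁, i)) (v ε)
      (v ε - CSpace.incl i Ω₁ (wN.1 ε))
    rwa [sub_sub_cancel] at h3
  · have h1 : (-((b - M : ℝ) : EReal)) = ((M : ℝ) : EReal) + -(b : EReal) := by
      rw [← EReal.coe_neg, ← EReal.coe_neg, ← EReal.coe_add]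
      congr 1; ring
    rw [h1, EReal.exp_add]
    refine (ENNReal.mul_lt_mul_iff_right ?_ ?_).2 hbr
    · rw [Ne, EReal.exp_eq_zero_iff]; exact EReal.coe_ne_bot _
    · exact (EReal.exp_lt_top_iff.2 (EReal.coe_lt_top _)).ne

end Operator

end Colombeau

end

theorem mainTheorem1 {n₁ n p : ℕ} (Ω₁ : TopologicalSpace.Opens (Euc n₁))
    (Ω : TopologicalSpace.Opens (Euc n)) (m ρ δ : ℝ) (hρ : 0 < ρ) (hρ_le : ρ ≤ 1)
    (hδ : 0 ≤ δ) (hδ_lt : δ < 1) (φ : GenPhase p Ω₁ Ω) (a : GenSymbol p Ω₁ Ω m ρ δ) :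
    ∃ A : GenFunC Ω →L[GenNumber] GenFun Ω₁, ∀ u : GenFunC Ω,
      IsOscillatoryIntegral φ a u (A u) ∧
        ∀ w : GenFun Ω₁, IsOscillatoryIntegral φ a u w → w = A u := by
  choose A hA using exists_isOscillatoryIntegral hρ hρ_le hδ hδ_lt φ a
  let A' : GenFunC Ω →ₗ[GenNumber] GenFun Ω₁ :=
    { toFun := A
      -- Additivity is the case `z = 1` of the combined identity; homogeneity is the case of second
      -- summand `0`, whose integral is `0`.
      map_add' := fun u v => by
        have hW : IsOscillatoryIntegral φ a ((1 : GenNumber) • u + v) (A (u + v)) := by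
          simpa using hA (u + v)
        simpa using (hA u).smul_add hρ hρ_le hδ hδ_lt (hA v) hW
      map_smul' := fun z u => by
        have hW : IsOscillatoryIntegral φ a (z • u + 0) (A (z • u)) := by
          simpa using hA (z • u)
        have h0 := (hA 0).zero hρ hρ_le hδ hδ_lt
        simpa [h0] using (hA u).smul_add hρ hρ_le hδ hδ_lt (hA 0) hW }
  refine ⟨⟨A', continuous_of_ultra_bound A' fun K q => ?_⟩, fun u =>
    ⟨hA u, fun w hw => hw.unique hρ hρ_le hδ hδ_lt (hA u)⟩⟩
  obtain ⟨L, j, N, hL, hN, H⟩ :=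
    IsOscillatoryIntegral.exists_ultra_bound hρ hρ_le hδ hδ_lt φ a K q
  exact ⟨L, j, N, hL, hN, fun u hu r => H u _ (hA u) hu r⟩
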